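/- Theorem 2 (MISE of $\hat\sigma^2_N$). *Model.* Let $(W_t)_{t\in[0,1]}$ be a standard Brownian motion and, for each $n$, let $\epsilon_{1,n},\dots,\epsilon_{n,n}$ be i.i.d. random variables, independent of $W$, with $E\epsilon_{i,n}=0$, $E\epsilon_{i,n}^2=1$ and $E\epsilon_{i,n}^4\le M<\infty$, $M$ not depending on $n$. Let $\sigma,\tau$ be positive deterministic functions on $[0,1]$. For $i=1,\dots,n$ one observes either (1) $Y_{i,n}=\int_0^{i/n}\sigma(s)\,dW_s+\tau(i/n)\epsilon_{i,n}$, or (2) $Y_{i,n}=\sigma(i/n)W_{i/n}+\tau(i/n)\epsilon_{i,n}$. *Classes.* For $\alpha,C>0$ and $0<l<u<\infty$ let $\Theta^b_s(\alpha,C,[l,u])$ be the set of $f\in L^2[0,1]$ with $l\le f\le u$ that can be written as $f(x)=\theta_0+2\sum_{i\ge1}\theta_i\cos(i\pi x)$, $x\in[0,1]$, with $\sum_{i\ge1}i^{2\alpha}\theta_i^2\le C$. Fix $Q,\bar Q>0$, $0<\sigma_{\min}<\sigma_{\max}$, $0<\tau_{\min}<\tau_{\max}$ and write $\Theta_\sigma=\Theta^b_s(\alpha,Q,[\sigma_{\min},\sigma_{\max}])$,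 $\Theta_\tau=\Theta^b_s(\beta,\bar Q,[\tau_{\min},\tau_{\max}])$. *Estimator.* Let $f_0=1$, $f_k(x)=\sqrt2\cos(k\pi x/2)$ for $k\ge1$, and let $\Delta Y^k\in\mathbb R^{n-1}$ have entries $(Y_{i+1,n}-Y_{i,n})f_k(i/n)$. Let $D=(\sqrt{2/n}\,\sin(ij\pi/n))_{1\le i,j\le n-1}$ and $\lambda_i=4\sin^2(i\pi/(2n))$; let $J_n^\tau$ be the diagonal matrix with entries $(n-n/\log_2 n)^{-1}\lambda_i^{-1}$ for $[n/\log_2 n]\le i\le n-1$ and $0$ otherwise, and $J_n$ the diagonal matrix with entries $\sqrt n$ for $[\sqrt n]+1\le i\le 2[\sqrt n]$ and $0$ otherwise. Put $$\hat t_{k,0}=(\Delta Y^k)^tDJ_n^\tau D^t\Delta Y^k,\qquad \hat s_{k,0}=(\Delta Y^k)^tDJ_nD^t\Delta Y^k-\tfrac{7\pi^2}{3}\hat t_{k,0},$$ $$\hat\sigma^2_N(t)=\hat s_{0,0}+2\sum_{i=1}^N(\hat s_{i,0}-\hat s_{0,0})\cos(i\pi t),\qquad \operatorname{MISE}(\hat\sigma_N^2)=E\int_0^1\bigl(\hat\sigma_N^2(t)-\sigma^2(t)\bigr)^2dt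 .$$ *Claim.* Let $\beta>5/4$, and assume either model (1) and $\alpha>3/4$, or model (2) and $\alpha>3/2$. Then, as $n\to\infty$: (a) for every sequence of integers $N=N_n\ge1$ with $N_n=o(n^{1/4})$, $$\sup_{\sigma^2\in\Theta_\sigma,\ \tau^2\in\Theta_\tau}\operatorname{MISE}(\hat\sigma_N^2)=O\bigl(N^{-2\alpha}+Nn^{-1/2}\bigr);$$ (b) every sequence of integers $N^*_n\ge1$ minimizing the right-hand side $N^{-2\alpha}+Nn^{-1/2}$ over integers $N\ge 1$ satisfies $N^*_n\asymp n^{1/(4\alpha+2)}$, and for every sequence of integers with $N_n^*\asymp n^{1/(4\alpha+2)}$, $$\sup_{\sigma^2\in\Theta_\sigma,\ \tau^2\in\Theta_\tau}\operatorname{MISE}(\hat\sigma_{N^*}^2)=O\bigl(n^{-\alpha/(2\alpha+1)}\bigr).$$ -/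

import Mathlib

open MeasureTheory ProbabilityTheory Filter Asymptotics
open scoped NNReal ENNReal Topology Matrix

/-! ### Sobolev s-ellipsoids -/

/-- The Sobolev s-ellipsoid `Θ_s(α, C)`: square integrable functions on `[0,1]` with a cosine
expansion `f x = θ₀ + 2 ∑_{i ≥ 1} θᵢ cos (i π x)` such that `∑_{i ≥ 1} i^{2α} θᵢ² ≤ C`.
Members are functions, not classes (they get evaluated at the design points). For `α > 1/2` the
series converges absolutely and uniformly, so that the members are the continuous versions. -/
def sobolevS (α C : ℝ) : Set (ℝ → ℝ) :=
  {f | MemLp f 2 (volume.restrict (Set.Icc (0 : ℝ) 1)) ∧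
    ∃ θ : ℕ → ℝ,
      (∀ x ∈ Set.Icc (0 : ℝ) 1,
        Tendsto (fun m : ℕ => θ 0 + 2 * ∑ i ∈ Finset.Icc 1 m, θ i * Real.cos (i * Real.pi * x))
          atTop (𝓝 (f x))) ∧
      Summable (fun i : ℕ => ((i + 1 : ℕ) : ℝ) ^ (2 * α) * θ (i + 1) ^ 2) ∧
      ∑' i : ℕ, ((i + 1 : ℕ) : ℝ) ^ (2 * α) * θ (i + 1) ^ 2 ≤ C}

/-- The uniformly bounded Sobolev s-ellipsoid `Θ_s^b(α, C, [l, u])`. -/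
def sobolevSBdd (α C l u : ℝ) : Set (ℝ → ℝ) :=
  {f | f ∈ sobolevS α C ∧ ∀ x ∈ Set.Icc (0 : ℝ) 1, l ≤ f x ∧ f x ≤ u}

/-! ### The estimator, as a function of the data `y 1, …, y n` -/

/-- The cosine basis `ψ₀ = 1`, `ψ_k t = √2 cos (k π t)`. -/
noncomputable def cosBasis (k : ℕ) (t : ℝ) : ℝ :=
  if k = 0 then 1 else Real.sqrt 2 * Real.cos (k * Real.pi * t)

/-- `f_k x = ψ_k (x / 2)`. -/
noncomputable def halfCos (k : ℕ) (x : ℝ) : ℝ := cosBasis k (x / 2)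

/-- The vector of weighted first differences `(y_{i+1} - y_i) f_k(i/n)`, `i = 1, …, n-1`;
the entry with index `i : Fin (n - 1)` is the one with number `i + 1`. -/
noncomputable def diffVec (n k : ℕ) (y : ℕ → ℝ) : Fin (n - 1) → ℝ := fun i =>
  (y ((i : ℕ) + 2) - y ((i : ℕ) + 1)) * halfCos k ((((i : ℕ) + 1 : ℕ) : ℝ) / n)

/-- The discrete sine transform `D i j = √(2/n) sin (i j π / n)`, `1 ≤ i, j ≤ n - 1`. -/
noncomputable def dst (n : ℕ) : Matrix (Fin (n - 1)) (Fin (n - 1)) ℝ := Matrix.of fun i j =>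
  Real.sqrt (2 / n) *
    Real.sin ((((i : ℕ) + 1 : ℕ) : ℝ) * (((j : ℕ) + 1 : ℕ) : ℝ) * Real.pi / n)

/-- `λ_i = 4 sin² (i π / (2 n))`. -/
noncomputable def eigLam (n i : ℕ) : ℝ := 4 * Real.sin (i * Real.pi / (2 * n)) ^ 2

/-- The diagonal matrix with entries `(n - n / log n)⁻¹ λ_i⁻¹` for `[n / log n] ≤ i ≤ n - 1`
(binary logarithm). -/
noncomputable def filterTau (n : ℕ) : Matrix (Fin (n - 1)) (Fin (n - 1)) ℝ :=
  Matrix.diagonal fun i =>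
    if ⌊(n : ℝ) / Real.logb 2 n⌋₊ ≤ (i : ℕ) + 1 then
      ((n : ℝ) - (n : ℝ) / Real.logb 2 n)⁻¹ * (eigLam n ((i : ℕ) + 1))⁻¹
    else 0

/-- The diagonal matrix with entries `√n` for `[√n] + 1 ≤ i ≤ 2 [√n]`. -/
noncomputable def filterSigma (n : ℕ) : Matrix (Fin (n - 1)) (Fin (n - 1)) ℝ :=
  Matrix.diagonal fun i =>
    if ⌊Real.sqrt n⌋₊ + 1 ≤ (i : ℕ) + 1 ∧ (i : ℕ) + 1 ≤ 2 * ⌊Real.sqrt n⌋₊ then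
      Real.sqrt n
    else 0

/-- The estimator of `∫₀¹ τ² f_k²`. -/
noncomputable def tHat (n k : ℕ) (y : ℕ → ℝ) : ℝ :=
  diffVec n k y ⬝ᵥ ((dst n * filterTau n * (dst n)ᵀ) *ᵥ diffVec n k y)

/-- The bias corrected estimator of `∫₀¹ σ² f_k²`. -/
noncomputable def sHat (n k : ℕ) (y : ℕ → ℝ) : ℝ :=
  diffVec n k y ⬝ᵥ ((dst n * filterSigma n * (dst n)ᵀ) *ᵥ diffVec n k y)
    - 7 * Real.pi ^ 2 * tHat n k y / 3

/-- The cosine series estimator of `σ²` with cut-off `N`. -/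
noncomputable def sigmaSqHat (n N : ℕ) (y : ℕ → ℝ) (t : ℝ) : ℝ :=
  sHat n 0 y + 2 * ∑ i ∈ Finset.Icc 1 N, (sHat n i y - sHat n 0 y) * Real.cos (i * Real.pi * t)

/-! ### Wiener integrals of deterministic functions -/

/-- A step function on `(0, t]`, with value `c j` on `(p j, p (j + 1)]` for `j < m`. -/
structure StepIntegrand (t : ℝ≥0) where
  /-- number of steps -/
  m : ℕ
  /-- grid points -/
  p : ℕ → ℝ≥0
  /-- values -/
  c : ℕ → ℝ
  mono : Monotone p
  p_zero : p 0 = 0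
  p_last : p m = t

/-- The step function as a function on the line. -/
noncomputable def StepIntegrand.eval {t : ℝ≥0} (g : StepIntegrand t) (s : ℝ) : ℝ :=
  ∑ j ∈ Finset.range g.m,
    (Set.Ioc (g.p j : ℝ) (g.p (j + 1) : ℝ)).indicator (fun _ => g.c j) s

/-- The elementary integral `∫₀ᵗ g dW` of a step function. -/
def StepIntegrand.integral {t : ℝ≥0} {Ω : Type*} (g : StepIntegrand t) (W : ℝ≥0 → Ω → ℝ)
    (ω : Ω) : ℝ :=
  ∑ j ∈ Finset.range g.m, g.c j * (W (g.p (j + 1)) ω - W (g.p j) ω)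

/-- `X` is (a version of) the Wiener integral `∫₀ᵗ f dW`: the `L²(μ)` limit of elementary
integrals of step functions that converge to `f` in `L²((0, t])`. -/
def IsWienerIntegral {Ω : Type*} [MeasurableSpace Ω] (μ : Measure Ω) (W : ℝ≥0 → Ω → ℝ)
    (f : ℝ → ℝ) (t : ℝ≥0) (X : Ω → ℝ) : Prop :=
  AEStronglyMeasurable X μ ∧
    ∀ δ : ℝ, 0 < δ → ∃ g : StepIntegrand t,
      eLpNorm (fun s => f s - g.eval s) 2 (volume.restrict (Set.Ioc (0 : ℝ) t))
          ≤ ENNReal.ofReal δ ∧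
        eLpNorm (fun ω => X ω - g.integral W ω) 2 μ ≤ ENNReal.ofReal δ

/-! ### The observation models -/

/-- Microstructure noise: for every `n`, the variables `ε_{1,n}, …, ε_{n,n}` are i.i.d., centered,
with unit variance and finite fourth moment (bounded in `n`), and independent of the process
`(W_t)_{0 ≤ t ≤ 1}`. The variable `ε_{i,n}` is `ε n i`. -/
structure IsMicroNoise {Ω : Type*} [MeasurableSpace Ω] (μ : Measure Ω) (W : ℝ≥0 → Ω → ℝ)
    (ε : ℕ → ℕ → Ω → ℝ) : Prop where
  aemeasurable : ∀ n, ∀ i ∈ Finset.Icc 1 n, AEMeasurable (ε n i) μ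
  indep : ∀ n, iIndepFun (fun i : Finset.Icc 1 n => ε n i) μ
  identDistrib : ∀ n, ∀ i ∈ Finset.Icc 1 n, ∀ j ∈ Finset.Icc 1 n,
    IdentDistrib (ε n i) (ε n j) μ μ
  mean : ∀ n, ∀ i ∈ Finset.Icc 1 n, ∫ ω, ε n i ω ∂μ = 0
  second : ∀ n, ∀ i ∈ Finset.Icc 1 n, ∫ ω, ε n i ω ^ 2 ∂μ = 1
  fourth : ∃ M : ℝ≥0, ∀ n, ∀ i ∈ Finset.Icc 1 n, ∫⁻ ω, ‖ε n i ω‖ₑ ^ 4 ∂μ ≤ M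
  indep_brownian : ∀ n, IndepFun (fun ω (t : Set.Iic (1 : ℝ≥0)) => W t ω)
    (fun ω (i : Finset.Icc 1 n) => ε n i ω) μ

/-- The two models: time-transformed Brownian motion `∫₀ᵗ σ dW` and space-transformed Brownian
motion `σ(t) W_t`. -/
inductive VolModel : Type
  | timeTransformed
  | spaceTransformed

/-- `X` is (a version of) the noise-free signal at time `t`. -/
def IsSignal {Ω : Type*} [MeasurableSpace Ω] (m : VolModel) (μ : Measure Ω) (W : ℝ≥0 → Ω → ℝ)
    (σ : ℝ → ℝ) (t : ℝ≥0) (X : Ω → ℝ) : Prop :=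
  match m with
  | .timeTransformed => IsWienerIntegral μ W σ t X
  | .spaceTransformed => X =ᵐ[μ] fun ω => σ t * W t ω

/-- `Y 1, …, Y n` are the observations at the times `i / n`: signal plus `τ(i/n) ε_{i,n}`. -/
def IsObservation {Ω : Type*} [MeasurableSpace Ω] (m : VolModel) (μ : Measure Ω)
    (W : ℝ≥0 → Ω → ℝ) (ε : ℕ → ℕ → Ω → ℝ) (σ τ : ℝ → ℝ) (n : ℕ) (Y : ℕ → Ω → ℝ) : Prop :=
  ∀ i ∈ Finset.Icc 1 n, ∃ X : Ω → ℝ, IsSignal m μ W σ ((i : ℝ≥0) / (n : ℝ≥0)) X ∧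
    Y i =ᵐ[μ] fun ω => X ω + τ ((i : ℝ) / (n : ℝ)) * ε n i ω

/-! ### Risk -/

/-- Mean integrated squared error `E ∫₀¹ (est(t) - g(t))² dt`, with values in `[0, ∞]`. -/
noncomputable def mise {Ω : Type*} [MeasurableSpace Ω] (μ : Measure Ω) (est : Ω → ℝ → ℝ)
    (g : ℝ → ℝ) : ℝ≥0∞ :=
  ∫⁻ ω, (∫⁻ t in Set.Icc (0 : ℝ) 1, ENNReal.ofReal ((est ω t - g t) ^ 2)) ∂μ

/-- `σ` is a positive function on `[0,1]` whose square belongs to `Θ_s^b(α, C, [l, u])`. -/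
def IsRootOf (α C l u : ℝ) (σ : ℝ → ℝ) : Prop :=
  (∀ x ∈ Set.Icc (0 : ℝ) 1, 0 < σ x) ∧ (fun x => σ x ^ 2) ∈ sobolevSBdd α C l u

/-- The supremum of the MISE of the estimator of `σ²` with cut-off `N` from `n` observations over
`σ² ∈ Θ_s^b(α, Q, [σmin, σmax])` and `τ² ∈ Θ_s^b(β, Q', [τmin, τmax])`
(all versions of the observations have the same MISE). -/
noncomputable def worstMise {Ω : Type*} [MeasurableSpace Ω] (m : VolModel) (μ : Measure Ω)
    (W : ℝ≥0 → Ω → ℝ) (ε : ℕ → ℕ → Ω → ℝ) (α Q σmin σmax β Q' τmin τmax : ℝ) (n N : ℕ) : ℝ≥0∞ :=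
  ⨆ (σ : ℝ → ℝ) (τ : ℝ → ℝ) (Y : ℕ → Ω → ℝ) (_ : IsRootOf α Q σmin σmax σ)
    (_ : IsRootOf β Q' τmin τmax τ) (_ : IsObservation m μ W ε σ τ n Y),
    mise μ (fun ω => sigmaSqHat n N (fun i => Y i ω)) (fun x => σ x ^ 2)

/-- The error bound `N^{-2α} + N n^{-1/2}`. -/
noncomputable def riskBound (α : ℝ) (n N : ℕ) : ℝ :=
  (N : ℝ) ^ (-(2 * α)) + (N : ℝ) * (n : ℝ) ^ (-(1 / 2) : ℝ)

/-! ### Trigonometric sums -/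

/-! Everything reduces to one estimate: `sHat n k` has mean squared error O(n^{-1/2}) as an
estimator of ∫σ²f_k², uniformly over the two classes and over k⁴ ≤ n. Since f_k² = 1 + cos(kπx) for
k ≥ 1 and f_0 = 1, this integral is θ_0 + θ_k, respectively θ_0, where θ are the cosine coefficients
of σ². Hence ŝ_k - ŝ_0 estimates θ_k, and Parseval turns the coefficient errors into O(N n^{-1/2})
and the missing frequencies into O(N^{-2α}) (`mise_sigmaSqHat_le`).

For a fixed k, the increments of the data in either model are s_i ξ_i + ρ_i + (b_{i+1} η_{i+1} - b_i
η_i), where ξ and η are jointly independent, centered, of unit variance and with bounded fourth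
moments, s_i² is the integral of σ² over the i-th cell up to O(n^{-2}), and ρ_i is O(1/n) in L⁴
(`exists_hasNoisyIncrements`). Summation by parts moves the noise difference onto the sine, where it
becomes a cosine times a factor with square λ_p (`sum_increment_eq`). The p-th sine coefficient
therefore has variance close to n^{-1} Σ s_i² f_k² + λ_p n^{-1} Σ b_j² f_k², up to a negligible part
caused by ρ and by the variation of f_k. A sum of squared coefficients with weights w_p concentrates
around (Σ w_p / n) Σ s_i² f_k² + (Σ w_p λ_p) · (1/n) Σ b_j² f_k². The pair (Σ w_p / n, Σ w_p λ_p)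
tends to (1, 7π²/3) for the low frequency filter and to (0, 1) for the high frequency one
(`weightSigma_spec`, `weightTau_spec`), so the correction by 7π²/3 cancels the noise average,
whatever its value.

Concentration at rate n^{-1/4} has three ingredients. The variance of a quadratic form in white
variables is bounded by its squared Frobenius norm (`IsWhite.integral_sq_quad_le`), which Bessel
inequalities for the sine and cosine systems control (`sum_sum_weight_mul_sq_le`). Replacing sin²
and cos² by their averages costs an oscillating sum, again handled by Bessel
(`sq_specMeanExact_sub_le`). The negligible part enters through Cauchy–Schwarz
(`integral_sq_specSum_sub_le`).

For the Wiener integral, the closed linear span of the pairs (1_{(0,t]}, W_t) in L² × L² is used. It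
contains (σ 1_{(0,t]}, ∫₀ᵗ σ dW), and members with orthonormal first components have independent
standard normal second components, which are functionals of the path on [0,1] and hence independent
of the noise (`iIndepFun_of_mem_wienerGraph`, `isWhite_sumElim`).

Finally x = n^{1/(4α+2)} balances the two terms of the bound, and α > 1/2 makes it o(n^{1/4}). -/

lemma sum_pow_eq_zero_of_pow_eq_one {r : ℂ} {N : ℕ} (h1 : r ^ N = 1) (h : r ≠ 1) :
    ∑ p ∈ Finset.range N, r ^ p = 0 := by
  rw [geom_sum_eq h, h1, sub_self, zero_div]

/-- Parseval for the discrete Fourier transform of a vector padded with zeros. The exponents i < M ≤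
N are distinct modulo N, so for i ≠ j the ratio ζ^{i-j} is a nontrivial N-th root of unity and its
powers sum to zero. -/
lemma sum_norm_sq_dft {N M : ℕ} (hN : 0 < N) (hM : M ≤ N) (c : ℕ → ℂ) :
    ∑ p ∈ Finset.range N,
        ‖∑ i ∈ Finset.range M, c i * Complex.exp (2 * Real.pi * Complex.I / N) ^ (i * p)‖ ^ 2
      = N * ∑ i ∈ Finset.range M, ‖c i‖ ^ 2 := by
  set ζ := Complex.exp (2 * Real.pi * Complex.I / N) with hζdef
  have hζ : IsPrimitiveRoot ζ N := Complex.isPrimitiveRoot_exp N hN.ne'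
  have hn : ‖ζ‖ = 1 := hζ.norm'_eq_one hN.ne'
  have h0 : ζ ≠ 0 := hζ.ne_zero hN.ne'
  have hconj : (starRingEnd ℂ) ζ = ζ⁻¹ := by
    rw [Complex.inv_def, Complex.normSq_eq_norm_sq, hn]; simp
  have key : ∀ i ∈ Finset.range M, ∀ j ∈ Finset.range M,
      ∑ p ∈ Finset.range N, ζ ^ (i * p) * (ζ⁻¹) ^ (j * p) = if i = j then (N : ℂ) else 0 := by
    intro i hi j hj
    rw [Finset.mem_range] at hi hj
    have : ∀ p, ζ ^ (i * p) * (ζ⁻¹) ^ (j * p) = (ζ ^ i * (ζ⁻¹) ^ j) ^ p := fun p => by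
      rw [mul_pow, pow_mul, pow_mul]
    simp_rw [this]
    split_ifs with hij
    · subst hij
      simp [mul_inv_cancel₀ (pow_ne_zero i h0)]
    · apply sum_pow_eq_zero_of_pow_eq_one
      · rw [mul_pow, ← pow_mul, ← pow_mul, mul_comm i, mul_comm j, pow_mul, pow_mul, inv_pow,
          hζ.pow_eq_one]; simp
      · intro h
        rw [inv_pow, mul_inv_eq_one₀ (pow_ne_zero _ h0)] at h
        exact hij (hζ.pow_inj (by omega) (by omega) h)
  have hsq : ∀ z : ℂ, ((‖z‖ ^ 2 : ℝ) : ℂ) = z * (starRingEnd ℂ) z := fun z => by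
    rw [Complex.mul_conj, Complex.normSq_eq_norm_sq]
  apply Complex.ofReal_injective
  push_cast
  simp_rw [← Complex.ofReal_pow, hsq, map_sum, map_mul, map_pow, hconj, Finset.sum_mul_sum]
  rw [Finset.sum_comm]
  rw [Finset.mul_sum]
  refine Finset.sum_congr rfl fun i hi => ?_
  rw [Finset.sum_comm]
  calc _ = ∑ j ∈ Finset.range M, c i * (starRingEnd ℂ) (c j) *
        ∑ p ∈ Finset.range N, ζ ^ (i * p) * (ζ⁻¹) ^ (j * p) := by
        refine Finset.sum_congr rfl fun j _ => ?_
        rw [Finset.mul_sum]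
        exact Finset.sum_congr rfl fun p _ => by ring
    _ = ∑ j ∈ Finset.range M, if i = j then c i * (starRingEnd ℂ) (c j) * N else 0 := by
        refine Finset.sum_congr rfl fun j hj => ?_
        rw [key i hi j hj]; split_ifs <;> simp
    _ = _ := by
        rw [Finset.sum_ite_eq, if_pos hi]; ring

/-- The inner sum is the real part of a discrete Fourier coefficient of c_i e^{iα_i}, multiplied by
e^{iβ_p}. Unimodular factors do not change the energy, and taking real parts and dropping
frequencies only lowers it. The free phases let one inequality serve sines, cosines and half-integer
frequencies. -/
lemma sum_sq_sum_mul_cos_le {N M₁ M₂ : ℕ} (hN : 0 < N) (h₁ : M₁ ≤ N) (h₂ : M₂ ≤ N)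
    (c α β : ℕ → ℝ) :
    ∑ p ∈ Finset.range M₁,
        (∑ i ∈ Finset.range M₂, c i * Real.cos (2 * Real.pi * (i * p) / N + α i + β p)) ^ 2
      ≤ N * ∑ i ∈ Finset.range M₂, c i ^ 2 := by
  set ζ := Complex.exp (2 * Real.pi * Complex.I / N) with hζdef
  have h := sum_norm_sq_dft hN h₂ (fun i => c i * Complex.exp (α i * Complex.I))
  have hnorm : ∀ i, ‖(c i : ℂ) * Complex.exp (α i * Complex.I)‖ ^ 2 = c i ^ 2 := fun i => by
    rw [norm_mul, Complex.norm_exp_ofReal_mul_I, mul_one, Complex.norm_real, Real.norm_eq_abs,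
      sq_abs]
  simp_rw [hnorm] at h
  rw [← h]
  refine (Finset.sum_le_sum fun p _ => ?_).trans
    (Finset.sum_le_sum_of_subset_of_nonneg (Finset.range_mono h₁) fun _ _ _ => by positivity)
  have hre : ∑ i ∈ Finset.range M₂, c i * Real.cos (2 * Real.pi * (i * p) / N + α i + β p)
      = (Complex.exp (β p * Complex.I) * ∑ i ∈ Finset.range M₂,
          (c i : ℂ) * Complex.exp (α i * Complex.I) * ζ ^ (i * p)).re := by
    rw [Finset.mul_sum, Complex.re_sum]
    refine Finset.sum_congr rfl fun i _ => ?_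
    rw [hζdef, ← Complex.exp_nat_mul]
    have : Complex.exp (β p * Complex.I) * ((c i : ℂ) * Complex.exp (α i * Complex.I) *
        Complex.exp ((i * p : ℕ) * (2 * Real.pi * Complex.I / N)))
        = (c i : ℂ) * Complex.exp
          (((2 * Real.pi * (i * p) / N + α i + β p : ℝ) : ℂ) * Complex.I) := by
      rw [show Complex.exp (β p * Complex.I) * ((c i : ℂ) * Complex.exp (α i * Complex.I) *
        Complex.exp ((i * p : ℕ) * (2 * Real.pi * Complex.I / N))) = c i *
        (Complex.exp (β p * Complex.I) * Complex.exp (α i * Complex.I) *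
        Complex.exp ((i * p : ℕ) * (2 * Real.pi * Complex.I / N))) by ring,
        ← Complex.exp_add, ← Complex.exp_add]
      congr 2
      push_cast
      ring
    rw [this, Complex.re_ofReal_mul, Complex.exp_ofReal_mul_I_re]
  rw [hre]
  have h2 : ‖Complex.exp (β p * Complex.I) * ∑ i ∈ Finset.range M₂,
          (c i : ℂ) * Complex.exp (α i * Complex.I) * ζ ^ (i * p)‖
      = ‖∑ i ∈ Finset.range M₂, (c i : ℂ) * Complex.exp (α i * Complex.I) * ζ ^ (i * p)‖ := by
    rw [norm_mul, Complex.norm_exp_ofReal_mul_I, one_mul]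
  rw [← h2, ← sq_abs]
  gcongr
  exact Complex.abs_re_le_norm _

/-- The entries of the discrete sine transform. -/
noncomputable def sinB (n i p : ℕ) : ℝ :=
  Real.sqrt (2 / n) * Real.sin ((i + 1) * (p + 1) * Real.pi / n)

/-- The entries of the discrete cosine transform. -/
noncomputable def cosB (n j p : ℕ) : ℝ :=
  Real.sqrt (2 / n) * Real.cos ((2 * j + 1) * (p + 1) * Real.pi / (2 * n))

lemma sum_sq_sum_mul_sinB_le {n : ℕ} (hn : 0 < n) (c : ℕ → ℝ) :
    ∑ p ∈ Finset.range (n - 1), (∑ i ∈ Finset.range (n - 1), c i * sinB n i p) ^ 2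
      ≤ 4 * ∑ i ∈ Finset.range (n - 1), c i ^ 2 := by
  have hn' : (0 : ℝ) < n := by exact_mod_cast hn
  -- The base frequency π/n corresponds to period 2n, so the constant is 2n · (2/n) = 4. The shift
  -- by π/2 turns the cosine into a sine.
  have h := sum_sq_sum_mul_cos_le (N := 2 * n) (M₁ := n - 1) (M₂ := n - 1) (by omega) (by omega)
    (by omega) (fun i => Real.sqrt (2 / n) * c i) (fun i => i * Real.pi / n)
    (fun p => (p + 1) * Real.pi / n - Real.pi / 2)
  have e1 : ∀ i, (Real.sqrt (2 / n) * c i) ^ 2 = 2 / n * c i ^ 2 := fun i => by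
    rw [mul_pow, Real.sq_sqrt (by positivity)]
  simp_rw [e1, ← Finset.mul_sum] at h
  refine le_trans (le_of_eq ?_) (h.trans (le_of_eq ?_))
  · refine Finset.sum_congr rfl fun p _ => ?_
    congr 1
    refine Finset.sum_congr rfl fun i _ => ?_
    rw [sinB, ← Real.cos_sub_pi_div_two, show ((i : ℝ) + 1) * (p + 1) * Real.pi / n - Real.pi / 2
      = 2 * Real.pi * (i * p) / (2 * n : ℕ) + i * Real.pi / n
        + ((p + 1) * Real.pi / n - Real.pi / 2) by push_cast; field_simp; ring]
    ring
  · push_cast; field_simp; ring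

lemma sum_sq_sum_mul_cosB_le {n : ℕ} (hn : 0 < n) (c : ℕ → ℝ) :
    ∑ p ∈ Finset.range (n - 1), (∑ j ∈ Finset.range n, c j * cosB n j p) ^ 2
      ≤ 4 * ∑ j ∈ Finset.range n, c j ^ 2 := by
  have hn' : (0 : ℝ) < n := by exact_mod_cast hn
  have h := sum_sq_sum_mul_cos_le (N := 2 * n) (M₁ := n - 1) (M₂ := n) (by omega) (by omega)
    (by omega) (fun i => Real.sqrt (2 / n) * c i) (fun i => i * Real.pi / n)
    (fun p => (p + 1) * Real.pi / (2 * n))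
  have e1 : ∀ i, (Real.sqrt (2 / n) * c i) ^ 2 = 2 / n * c i ^ 2 := fun i => by
    rw [mul_pow, Real.sq_sqrt (by positivity)]
  simp_rw [e1, ← Finset.mul_sum] at h
  refine le_trans (le_of_eq ?_) (h.trans (le_of_eq ?_))
  · refine Finset.sum_congr rfl fun p _ => ?_
    congr 1
    refine Finset.sum_congr rfl fun i _ => ?_
    rw [cosB, show (2 * (i : ℝ) + 1) * (p + 1) * Real.pi / (2 * n)
      = 2 * Real.pi * (i * p) / (2 * n : ℕ) + i * Real.pi / n
        + ((p + 1) * Real.pi / (2 * n)) by push_cast; field_simp]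
    ring
  · push_cast; field_simp; ring

lemma sinB_sq (n i p : ℕ) :
    sinB n i p ^ 2 = (1 - Real.cos (2 * ((i + 1) * (p + 1) * Real.pi / n))) / n := by
  rw [sinB, mul_pow, Real.sq_sqrt (by positivity), Real.cos_two_mul, Real.cos_sq']
  ring

lemma cosB_sq (n j p : ℕ) :
    cosB n j p ^ 2 = (1 + Real.cos ((2 * j + 1) * (p + 1) * Real.pi / n)) / n := by
  rw [cosB, mul_pow, Real.sq_sqrt (by positivity),
    show ((2 : ℝ) * j + 1) * (p + 1) * Real.pi / n
      = 2 * ((2 * j + 1) * (p + 1) * Real.pi / (2 * n)) by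
        rw [mul_div_assoc', mul_div_mul_left _ _ two_ne_zero], Real.cos_two_mul]
  ring

lemma sinB_sq_le (n i p : ℕ) : sinB n i p ^ 2 ≤ 2 / n := by
  rw [sinB_sq]
  gcongr
  linarith [Real.neg_one_le_cos (2 * ((i + 1) * (p + 1) * Real.pi / n))]

lemma cosB_sq_le (n j p : ℕ) : cosB n j p ^ 2 ≤ 2 / n := by
  rw [cosB_sq]
  gcongr
  linarith [Real.cos_le_one ((2 * j + 1) * (p + 1) * Real.pi / n)]

/-- Exchange the sums, apply Cauchy–Schwarz over i with the bounded b_i, and use the Bessel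
inequality for the transform of w. The gain over the trivial bound is that w enters only through its
ℓ² norm. -/
lemma sq_sum_mul_sum_cos_le {n M : ℕ} (hn : 0 < n) (hM : M ≤ n) (w b α β : ℕ → ℝ) {A : ℝ}
    (hb : ∀ i ∈ Finset.range M, |b i| ≤ A) :
    (∑ p ∈ Finset.range (n - 1), w p * ∑ i ∈ Finset.range M,
        b i * Real.cos (2 * Real.pi * (i * p) / n + α i + β p)) ^ 2
      ≤ A ^ 2 * n ^ 2 * ∑ p ∈ Finset.range (n - 1), w p ^ 2 := by
  have h := sum_sq_sum_mul_cos_le hn hM (Nat.sub_le n 1) w β α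
  have e : ∑ p ∈ Finset.range (n - 1), w p * ∑ i ∈ Finset.range M,
        b i * Real.cos (2 * Real.pi * (i * p) / n + α i + β p)
      = ∑ i ∈ Finset.range M, b i * ∑ p ∈ Finset.range (n - 1),
        w p * Real.cos (2 * Real.pi * (p * i) / n + β p + α i) := by
    simp_rw [Finset.mul_sum]
    rw [Finset.sum_comm]
    refine Finset.sum_congr rfl fun i _ => Finset.sum_congr rfl fun p _ => ?_
    rw [show 2 * Real.pi * ((i : ℝ) * p) / n + α i + β p
      = 2 * Real.pi * ((p : ℝ) * i) / n + β p + α i by ring]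
    ring
  rw [e]
  refine (Finset.sum_mul_sq_le_sq_mul_sq _ _ _).trans ?_
  have hb2 : ∑ i ∈ Finset.range M, b i ^ 2 ≤ n * A ^ 2 := by
    calc ∑ i ∈ Finset.range M, b i ^ 2 ≤ ∑ i ∈ Finset.range M, A ^ 2 :=
          Finset.sum_le_sum fun i hi => sq_le_sq' (by linarith [abs_le.1 (hb i hi)])
            (abs_le.1 (hb i hi)).2
      _ = M * A ^ 2 := by simp
      _ ≤ n * A ^ 2 := by gcongr
  calc _ ≤ (n * A ^ 2) * (n * ∑ p ∈ Finset.range (n - 1), w p ^ 2) := by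
        apply mul_le_mul hb2 h (Finset.sum_nonneg fun _ _ => sq_nonneg _) (by positivity)
    _ = _ := by ring

/-- The sine transform handles differenced noise well for this reason: consecutive sines differ by a
cosine at the midpoint, times a factor whose square is the eigenvalue λ_{p+1}. -/
lemma sqrt_mul_sin_sub_sin (n j p : ℕ) :
    Real.sqrt (2 / n) * Real.sin (j * (p + 1) * Real.pi / n)
        - Real.sqrt (2 / n) * Real.sin ((j + 1) * (p + 1) * Real.pi / n)
      = -(2 * Real.sin ((p + 1) * Real.pi / (2 * n))) * cosB n j p := by
  rw [cosB, ← mul_sub, Real.sin_sub_sin]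
  rcases Nat.eq_zero_or_pos n with rfl | hn
  · simp
  have hn' : (n : ℝ) ≠ 0 := by positivity
  rw [show ((j : ℝ) * (p + 1) * Real.pi / n - (j + 1) * (p + 1) * Real.pi / n) / 2
      = -((p + 1) * Real.pi / (2 * n)) by field_simp; ring,
    show ((j : ℝ) * (p + 1) * Real.pi / n + (j + 1) * (p + 1) * Real.pi / n) / 2
      = (2 * j + 1) * (p + 1) * Real.pi / (2 * n) by field_simp; ring, Real.sin_neg]
  ring

/-! ### Quadratic forms in independent variables -/

/-- Products of two L⁴ variables are in L²; this makes all the quadratic forms below square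
integrable. -/
instance holderTriple_four_four_two : ENNReal.HolderTriple 4 4 2 where
  inv_add_inv_eq_inv := by
    have h4 : (4 : ℝ≥0∞) = 2 * 2 := by norm_num
    rw [h4, ENNReal.mul_inv (by simp) (by simp), ← two_mul, ← mul_assoc,
      ENNReal.mul_inv_cancel (by simp) (by simp), one_mul]

/-- Independent centered variables with unit variance and fourth moments at most `M`. -/
structure IsWhite {Ω ι : Type*} [MeasurableSpace Ω] (μ : Measure Ω) (M : ℝ) (ξ : ι → Ω → ℝ) :
    Prop where
  indep : iIndepFun ξ μ
  memLp : ∀ a, MemLp (ξ a) 4 μ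
  mean : ∀ a, ∫ ω, ξ a ω ∂μ = 0
  second : ∀ a, ∫ ω, ξ a ω ^ 2 ∂μ = 1
  fourth : ∀ a, ∫ ω, ξ a ω ^ 4 ∂μ ≤ M

namespace IsWhite

variable {Ω ι : Type*} [MeasurableSpace Ω] {μ : Measure Ω} {M : ℝ}
  {ξ : ι → Ω → ℝ}

lemma aemeasurable (h : IsWhite μ M ξ) (a : ι) : AEMeasurable (ξ a) μ :=
  (h.memLp a).aestronglyMeasurable.aemeasurable

lemma memLp_sum (h : IsWhite μ M ξ) (S : Finset ι) (c : ι → ℝ) :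
    MemLp (fun ω => ∑ a ∈ S, c a * ξ a ω) 4 μ :=
  memLp_finsetSum S fun a _ => (h.memLp a).const_mul (c a)

lemma indepFun_of_notMem [DecidableEq ι] (h : IsWhite μ M ξ) {S : Finset ι} {z : ι} (hz : z ∉ S)
    {F : (S → ℝ) → ℝ} {g : ℝ → ℝ} (hF : Measurable F) (hg : Measurable g) :
    IndepFun (fun ω => F (fun i : S => ξ i ω)) (fun ω => g (ξ z ω)) μ := by
  have := h.indep.indepFun_finset₀ S {z} (by simpa using hz) h.aemeasurable
  exact this.comp hF
    (hg.comp (measurable_pi_apply (⟨z, Finset.mem_singleton_self z⟩ : ({z} : Finset ι))))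

lemma integral_eq_zero_of_notMem [DecidableEq ι] (h : IsWhite μ M ξ) {S : Finset ι} {z : ι}
    (hz : z ∉ S) {F : (S → ℝ) → ℝ} {g : ℝ → ℝ} (hF : Measurable F) (hg : Measurable g)
    (h0 : ∫ ω, g (ξ z ω) ∂μ = 0) :
    ∫ ω, F (fun i : S => ξ i ω) * g (ξ z ω) ∂μ = 0 := by
  rw [(h.indepFun_of_notMem hz hF hg).integral_fun_mul_eq_mul_integral, h0, mul_zero]
  · exact (hF.comp_aemeasurable
      (aemeasurable_pi_lambda _ fun i => h.aemeasurable i)).aestronglyMeasurable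
  · exact (hg.comp_aemeasurable (h.aemeasurable z)).aestronglyMeasurable

variable [IsProbabilityMeasure μ]

lemma integrable_sq (h : IsWhite μ M ξ) (a : ι) : Integrable (fun ω => ξ a ω ^ 2) μ :=
  ((h.memLp a).mono_exponent (by norm_num)).integrable_sq

lemma integral_sq_sum (h : IsWhite μ M ξ) (S : Finset ι) (c : ι → ℝ) :
    ∫ ω, (∑ a ∈ S, c a * ξ a ω) ^ 2 ∂μ = ∑ a ∈ S, c a ^ 2 := by
  classical
  induction S using Finset.induction_on with
  | empty => simp
  | insert z S hz ih =>
    have hS : MemLp (fun ω => ∑ a ∈ S, c a * ξ a ω) 2 μ :=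
      (h.memLp_sum S c).mono_exponent (by norm_num)
    have hz2 : MemLp (ξ z) 2 μ := (h.memLp z).mono_exponent (by norm_num)
    have hcross : ∫ ω, (∑ a ∈ S, c a * ξ a ω) * ξ z ω ∂μ = 0 := by
      have := h.integral_eq_zero_of_notMem hz (F := fun x => ∑ i : S, c i * x i) (g := id)
        (by fun_prop) measurable_id (h.mean z)
      refine Eq.trans (integral_congr_ae (ae_of_all _ fun ω => ?_)) this
      simp only [id, Finset.sum_coe_sort S (fun a => c a * ξ a ω)]
    have i1 := hS.integrable_sq
    have i2 : Integrable (fun ω => (∑ a ∈ S, c a * ξ a ω) * ξ z ω) μ := hS.integrable_mul hz2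
    have i3 := hz2.integrable_sq
    calc ∫ ω, (∑ a ∈ insert z S, c a * ξ a ω) ^ 2 ∂μ
        = ∫ ω, ((∑ a ∈ S, c a * ξ a ω) ^ 2 + 2 * c z * ((∑ a ∈ S, c a * ξ a ω) * ξ z ω)
            + c z ^ 2 * ξ z ω ^ 2) ∂μ := by
          refine integral_congr_ae (ae_of_all _ fun ω => ?_)
          simp only [Finset.sum_insert hz]
          ring
      _ = _ := by
          rw [integral_add (i1.fun_add (i2.const_mul _)) (i3.const_mul _),
            integral_add i1 (i2.const_mul _), integral_const_mul, integral_const_mul, hcross, ih,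
            h.second, Finset.sum_insert hz]
          ring

lemma integral_sq_sub_one_le (h : IsWhite μ M ξ) (a : ι) :
    MemLp (fun ω => ξ a ω ^ 2 - 1) 2 μ ∧ ∫ ω, (ξ a ω ^ 2 - 1) ^ 2 ∂μ ≤ M := by
  have h2 : MemLp (fun ω => ξ a ω ^ 2) 2 μ := by
    simp_rw [pow_two]; exact (h.memLp a).mul (h.memLp a) (r := 2)
  refine ⟨h2.sub (memLp_const 1), ?_⟩
  have i4 : Integrable (fun ω => ξ a ω ^ 4) μ := by
    simpa [← pow_mul] using h2.integrable_sq
  calc ∫ ω, (ξ a ω ^ 2 - 1) ^ 2 ∂μ = ∫ ω, (ξ a ω ^ 4 - 2 * ξ a ω ^ 2 + 1) ∂μ := by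
        congr 1; ext ω; ring
    _ = ∫ ω, ξ a ω ^ 4 ∂μ - 2 * 1 + 1 := by
        rw [integral_add (i4.sub' ((h.integrable_sq a).const_mul 2)) (integrable_const 1),
          integral_sub i4 ((h.integrable_sq a).const_mul 2), integral_const_mul, h.second]
        simp
    _ ≤ M := by linarith [h.fourth a]

lemma memLp_quad (h : IsWhite μ M ξ) (S : Finset ι) (G : ι → ι → ℝ) :
    MemLp (fun ω => ∑ a ∈ S, ∑ b ∈ S, G a b * (ξ a ω * ξ b ω) - ∑ a ∈ S, G a a) 2 μ :=
  (memLp_finsetSum S fun a _ => memLp_finsetSum S fun b _ =>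
    ((h.memLp b).mul (h.memLp a) (r := 2)).const_mul _).sub (memLp_const _)

/-- Induction over the index set. A new index z adds L ξ_z + G_zz (ξ_z² - 1) with L linear in the
earlier variables; both summands are uncorrelated with the old form Q, since ξ_z is independent of
the past and ξ_z, ξ_z² - 1 are centered. Their own second moment is at most 8 Σ_a G_za² + 2M G_zz²,
while the squared Frobenius norm grows by 2 Σ_a G_za² + G_zz². -/
lemma integral_sq_quad_le (h : IsWhite μ M ξ) (hM : 0 ≤ M) (S : Finset ι) (G : ι → ι → ℝ)
    (hG : ∀ a b, G a b = G b a) :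
    ∫ ω, (∑ a ∈ S, ∑ b ∈ S, G a b * (ξ a ω * ξ b ω) - ∑ a ∈ S, G a a) ^ 2 ∂μ
      ≤ (8 + 2 * M) * ∑ a ∈ S, ∑ b ∈ S, G a b ^ 2 := by
  classical
  induction S using Finset.induction_on with
  | empty => simp
  | insert z S hz ih =>
    set Q : Ω → ℝ := fun ω => ∑ a ∈ S, ∑ b ∈ S, G a b * (ξ a ω * ξ b ω) - ∑ a ∈ S, G a a with hQ
    set L : Ω → ℝ := fun ω => ∑ a ∈ S, (2 * G z a) * ξ a ω with hL
    have hQ2 : MemLp Q 2 μ := h.memLp_quad S G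
    have hL4 : MemLp L 4 μ := h.memLp_sum S _
    have hLz : MemLp (fun ω => L ω * ξ z ω) 2 μ := (h.memLp z).mul hL4 (r := 2)
    obtain ⟨hz2, hz4⟩ := h.integral_sq_sub_one_le z
    have hQF : ∀ ω, Q ω = (fun x : S → ℝ => ∑ i : S, ∑ j : S, G i j * (x i * x j)
        - ∑ a ∈ S, G a a) (fun i : S => ξ i ω) := fun ω => by
      simp only [hQ]
      rw [← Finset.sum_coe_sort S]
      congr 1
      refine Finset.sum_congr rfl fun i _ => ?_
      rw [← Finset.sum_coe_sort S]
    have hLF : ∀ ω, L ω = (fun x : S → ℝ => ∑ i : S, (2 * G z i) * x i)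
        (fun i : S => ξ i ω) := fun ω => by
      simp only [hL]
      rw [← Finset.sum_coe_sort S]
    have c1 : ∫ ω, Q ω * (L ω * ξ z ω) ∂μ = 0 := by
      have := h.integral_eq_zero_of_notMem hz (F := fun x => (∑ i : S, ∑ j : S, G i j * (x i * x j)
        - ∑ a ∈ S, G a a) * ∑ i : S, (2 * G z i) * x i) (g := id)
        (by fun_prop) measurable_id (h.mean z)
      refine Eq.trans (integral_congr_ae (ae_of_all _ fun ω => ?_)) this
      simp only [hQF, hLF, id, mul_assoc]
    have c2 : ∫ ω, Q ω * (ξ z ω ^ 2 - 1) ∂μ = 0 := by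
      simp_rw [hQF]
      refine h.integral_eq_zero_of_notMem hz (F := fun x => ∑ i : S, ∑ j : S, G i j * (x i * x j)
        - ∑ a ∈ S, G a a) (g := fun x => x ^ 2 - 1) (by fun_prop) (by fun_prop) ?_
      rw [integral_sub (h.integrable_sq z) (integrable_const 1), h.second]; simp
    have c3 : ∫ ω, (L ω * ξ z ω) ^ 2 ∂μ = 4 * ∑ a ∈ S, G z a ^ 2 := by
      have hi := h.indepFun_of_notMem hz (F := fun x => (∑ i : S, (2 * G z i) * x i) ^ 2)
        (g := fun x => x ^ 2) (by fun_prop) (by fun_prop)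
      have e : (fun ω => (L ω * ξ z ω) ^ 2) = fun ω => L ω ^ 2 * ξ z ω ^ 2 := by
        ext ω; ring
      rw [e]
      have hsc : ∀ ω, ∑ i : S, 2 * G z i * ξ i ω = L ω := fun ω => (hLF ω).symm
      simp_rw [hsc] at hi
      rw [hi.integral_fun_mul_eq_mul_integral]
      · rw [h.second, mul_one]
        have := h.integral_sq_sum S (fun a => 2 * G z a)
        rw [this, Finset.mul_sum]
        exact Finset.sum_congr rfl fun a _ => by ring
      · exact (hL4.aestronglyMeasurable.pow 2)
      · exact ((h.aemeasurable z).pow_const 2).aestronglyMeasurable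
    have e : ∀ ω, (∑ a ∈ insert z S, ∑ b ∈ insert z S, G a b * (ξ a ω * ξ b ω)
        - ∑ a ∈ insert z S, G a a) = Q ω + (L ω * ξ z ω + G z z * (ξ z ω ^ 2 - 1)) := fun ω => by
      simp only [hQ, hL, Finset.sum_insert hz, Finset.sum_add_distrib, Finset.sum_mul]
      have e1 : ∑ a ∈ S, G a z * (ξ a ω * ξ z ω) = ∑ a ∈ S, G z a * (ξ z ω * ξ a ω) :=
        Finset.sum_congr rfl fun a _ => by rw [hG a z]; ring
      have e2 : ∑ a ∈ S, 2 * G z a * ξ a ω * ξ z ω = 2 * ∑ a ∈ S, G z a * (ξ z ω * ξ a ω) := by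
        rw [Finset.mul_sum]; exact Finset.sum_congr rfl fun a _ => by ring
      rw [e1, e2]; ring
    have i1 := hQ2.integrable_sq
    have i2 : Integrable (fun ω => Q ω * (L ω * ξ z ω)) μ := hQ2.integrable_mul hLz
    have i3 : Integrable (fun ω => Q ω * (ξ z ω ^ 2 - 1)) μ := hQ2.integrable_mul hz2
    have i4 := hLz.integrable_sq
    have i5 := hz2.integrable_sq
    calc ∫ ω, (∑ a ∈ insert z S, ∑ b ∈ insert z S, G a b * (ξ a ω * ξ b ω)
        - ∑ a ∈ insert z S, G a a) ^ 2 ∂μ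
        ≤ ∫ ω, (Q ω ^ 2 + (2 * (Q ω * (L ω * ξ z ω)) + (2 * G z z * (Q ω * (ξ z ω ^ 2 - 1))
          + (2 * (L ω * ξ z ω) ^ 2 + 2 * G z z ^ 2 * (ξ z ω ^ 2 - 1) ^ 2)))) ∂μ := by
          refine integral_mono_of_nonneg (ae_of_all _ fun ω => sq_nonneg _) ?_
            (ae_of_all _ fun ω => ?_)
          · exact i1.add ((i2.const_mul _).add ((i3.const_mul _).add
              ((i4.const_mul _).add (i5.const_mul _))))
          · simp only [e ω]
            nlinarith [sq_nonneg (L ω * ξ z ω - G z z * (ξ z ω ^ 2 - 1))]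
      _ = ∫ ω, Q ω ^ 2 ∂μ + (2 * 0 + (2 * G z z * 0 + (2 * (4 * ∑ a ∈ S, G z a ^ 2)
          + 2 * G z z ^ 2 * ∫ ω, (ξ z ω ^ 2 - 1) ^ 2 ∂μ))) := by
          rw [integral_add i1 ((i2.const_mul _).fun_add ((i3.const_mul _).fun_add
              ((i4.const_mul _).fun_add (i5.const_mul _)))),
            integral_add (i2.const_mul _) ((i3.const_mul _).fun_add
              ((i4.const_mul _).fun_add (i5.const_mul _))),
            integral_add (i3.const_mul _) ((i4.const_mul _).fun_add (i5.const_mul _)),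
            integral_add (i4.const_mul _) (i5.const_mul _), integral_const_mul,
            integral_const_mul, integral_const_mul, integral_const_mul, c1, c2, c3]
      _ ≤ (8 + 2 * M) * ∑ a ∈ S, ∑ b ∈ S, G a b ^ 2 + (8 * ∑ a ∈ S, G z a ^ 2
          + 2 * G z z ^ 2 * M) := by
          have : 2 * G z z ^ 2 * ∫ ω, (ξ z ω ^ 2 - 1) ^ 2 ∂μ ≤ 2 * G z z ^ 2 * M := by gcongr
          linarith
      _ ≤ _ := by
          simp only [Finset.sum_insert hz, Finset.sum_add_distrib]
          have e1 : ∑ a ∈ S, G a z ^ 2 = ∑ a ∈ S, G z a ^ 2 :=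
            Finset.sum_congr rfl fun a _ => by rw [hG a z]
          have hn : 0 ≤ ∑ a ∈ S, G z a ^ 2 := Finset.sum_nonneg fun _ _ => sq_nonneg _
          rw [e1]
          nlinarith [mul_nonneg hM hn, sq_nonneg (G z z)]

/-- Mean and variance of a weighted sum of squares of linear forms. -/
lemma integral_sq_sum_sq_sub_le [Fintype ι] (h : IsWhite μ M ξ) (hM : 0 ≤ M) (P : Finset ℕ)
    (w : ℕ → ℝ) (B : ι → ℕ → ℝ) :
    MemLp (fun ω => ∑ p ∈ P, w p * (∑ a, B a p * ξ a ω) ^ 2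
        - ∑ p ∈ P, w p * ∑ a, B a p ^ 2) 2 μ ∧
    ∫ ω, (∑ p ∈ P, w p * (∑ a, B a p * ξ a ω) ^ 2
        - ∑ p ∈ P, w p * ∑ a, B a p ^ 2) ^ 2 ∂μ
      ≤ (8 + 2 * M) * ∑ p ∈ P, ∑ q ∈ P, w p * w q * (∑ a, B a p * B a q) ^ 2 := by
  set G : ι → ι → ℝ := fun a b => ∑ p ∈ P, w p * (B a p * B b p) with hGdef
  have e : ∀ ω, ∑ p ∈ P, w p * (∑ a, B a p * ξ a ω) ^ 2 - ∑ p ∈ P, w p * ∑ a, B a p ^ 2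
      = ∑ a, ∑ b, G a b * (ξ a ω * ξ b ω) - ∑ a, G a a := fun ω => by
    congr 1
    · simp_rw [pow_two, Finset.sum_mul_sum, Finset.mul_sum, hGdef, Finset.sum_mul]
      rw [Finset.sum_comm]
      refine Finset.sum_congr rfl fun a _ => ?_
      rw [Finset.sum_comm]
      exact Finset.sum_congr rfl fun b _ => Finset.sum_congr rfl fun p _ => by ring
    · simp_rw [hGdef, Finset.mul_sum]
      rw [Finset.sum_comm]
      exact Finset.sum_congr rfl fun b _ => Finset.sum_congr rfl fun p _ => by ring
  have e2 : ∑ p ∈ P, ∑ q ∈ P, w p * w q * (∑ a, B a p * B a q) ^ 2 = ∑ a, ∑ b, G a b ^ 2 := by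
    have r : ∀ a b, G a b ^ 2
        = ∑ p ∈ P, ∑ q ∈ P, w p * w q * ((B a p * B a q) * (B b p * B b q)) := fun a b => by
      simp only [hGdef]
      rw [pow_two, Finset.sum_mul_sum]
      exact Finset.sum_congr rfl fun p _ => Finset.sum_congr rfl fun q _ => by ring
    calc ∑ p ∈ P, ∑ q ∈ P, w p * w q * (∑ a, B a p * B a q) ^ 2
        = ∑ p ∈ P, ∑ q ∈ P, ∑ a, ∑ b, w p * w q * ((B a p * B a q) * (B b p * B b q)) := by
          simp_rw [pow_two, Finset.sum_mul_sum, Finset.mul_sum]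
      _ = ∑ p ∈ P, ∑ a, ∑ b, ∑ q ∈ P, w p * w q * ((B a p * B a q) * (B b p * B b q)) := by
          refine Finset.sum_congr rfl fun p _ => ?_
          rw [Finset.sum_comm]
          exact Finset.sum_congr rfl fun a _ => Finset.sum_comm
      _ = _ := by
          rw [Finset.sum_comm]
          refine Finset.sum_congr rfl fun a _ => ?_
          rw [Finset.sum_comm]
          exact Finset.sum_congr rfl fun b _ => (r a b).symm
  simp_rw [e, e2]
  exact ⟨h.memLp_quad Finset.univ G, h.integral_sq_quad_le hM Finset.univ G fun a b => by
    simp only [hGdef]; exact Finset.sum_congr rfl fun p _ => by ring⟩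

end IsWhite

lemma iIndepFun_sumElim {Ω ι κ : Type*} [MeasurableSpace Ω] {μ : Measure Ω} {ξ : ι → Ω → ℝ}
    {η : κ → Ω → ℝ} (hξ : iIndepFun ξ μ) (hη : iIndepFun η μ)
    (h : IndepFun (fun ω i => ξ i ω) (fun ω j => η j ω) μ) :
    iIndepFun (fun a : ι ⊕ κ => Sum.elim ξ η a) μ := by
  classical
  rw [iIndepFun_iff_measure_inter_preimage_eq_mul] at hξ hη ⊢
  intro S sets hsets
  have e : ∏ a ∈ S, μ (Sum.elim ξ η a ⁻¹' sets a)
      = (∏ i ∈ S.toLeft, μ (ξ i ⁻¹' sets (Sum.inl i)))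
        * ∏ i ∈ S.toRight, μ (η i ⁻¹' sets (Sum.inr i)) := by
    conv_lhs => rw [← Finset.toLeft_disjSum_toRight (u := S)]
    rw [Finset.prod_disjSum]; rfl
  rw [e, ← hξ S.toLeft (sets := fun i => sets (Sum.inl i)) fun i hi => hsets _ (by simpa using hi),
    ← hη S.toRight (sets := fun i => sets (Sum.inr i)) fun i hi => hsets _ (by simpa using hi)]
  have h2 := h.measure_inter_preimage_eq_mul
    {x : ι → ℝ | ∀ i ∈ S.toLeft, x i ∈ sets (Sum.inl i)}
    {x : κ → ℝ | ∀ i ∈ S.toRight, x i ∈ sets (Sum.inr i)}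
    (by
      have : {x : ι → ℝ | ∀ i ∈ S.toLeft, x i ∈ sets (Sum.inl i)}
        = ⋂ i ∈ S.toLeft, (fun x : ι → ℝ => x i) ⁻¹' sets (Sum.inl i) := by ext; simp
      rw [this]
      exact Finset.measurableSet_biInter _ fun i hi =>
        measurable_pi_apply i (hsets _ (by simpa using hi)))
    (by
      have : {x : κ → ℝ | ∀ i ∈ S.toRight, x i ∈ sets (Sum.inr i)}
        = ⋂ i ∈ S.toRight, (fun x : κ → ℝ => x i) ⁻¹' sets (Sum.inr i) := by ext; simp
      rw [this]
      exact Finset.measurableSet_biInter _ fun i hi =>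
        measurable_pi_apply i (hsets _ (by simpa using hi)))
  convert h2 using 2
  · ext ω; simp
  · congr 1; ext ω; simp
  · congr 1; ext ω; simp

/-! ### Weighted spectral sums of the observed increments -/

lemma IsWhite.precomp {Ω ι κ : Type*} [MeasurableSpace Ω] {μ : Measure Ω} {M : ℝ}
    {ξ : ι → Ω → ℝ} (h : IsWhite μ M ξ) {g : κ → ι} (hg : g.Injective) :
    IsWhite μ M (fun a => ξ (g a)) :=
  ⟨h.indep.precomp hg, fun _ => h.memLp _, fun _ => h.mean _, fun _ => h.second _,
    fun _ => h.fourth _⟩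

/-- Frobenius norm of the quadratic form, computed on the spectral side. Bound w_q by v, apply the
Bessel inequality in q to the coefficients c_i φ_ip, use φ² ≤ 2/n for what remains, and then sum
over p; the constant is 4 · 2. -/
lemma sum_sum_weight_mul_sq_le {n m : ℕ} {φ : ℕ → ℕ → ℝ} (hmn : m ≤ n)
    (hφ : ∀ c : ℕ → ℝ, ∑ p ∈ Finset.range (n - 1), (∑ i ∈ Finset.range m, c i * φ i p) ^ 2
      ≤ 4 * ∑ i ∈ Finset.range m, c i ^ 2)
    (hφ2 : ∀ i p, φ i p ^ 2 ≤ 2 / n) {w : ℕ → ℝ} (hw : ∀ p, 0 ≤ w p) {v V C : ℝ}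
    (hv : ∀ p ∈ Finset.range (n - 1), w p ≤ v) (hv0 : 0 ≤ v)
    (hV : ∑ p ∈ Finset.range (n - 1), w p ≤ V)
    {c : ℕ → ℝ} (hc : ∀ i ∈ Finset.range m, c i ^ 2 ≤ C) (hC : 0 ≤ C) :
    ∑ p ∈ Finset.range (n - 1), ∑ q ∈ Finset.range (n - 1),
      w p * w q * (∑ i ∈ Finset.range m, c i * (φ i p * φ i q)) ^ 2 ≤ 8 * v * V * C := by
  have h2 : ∀ p, ∑ i ∈ Finset.range m, (c i * φ i p) ^ 2 ≤ 2 * C := fun p => by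
    calc ∑ i ∈ Finset.range m, (c i * φ i p) ^ 2
        ≤ ∑ i ∈ Finset.range m, C * (2 / n) := by
          refine Finset.sum_le_sum fun i hi => ?_
          rw [mul_pow]
          exact mul_le_mul (hc i hi) (hφ2 i p) (sq_nonneg _) hC
      _ = 2 * C * (m / n) := by simp; ring
      _ ≤ 2 * C * 1 := by
          gcongr
          exact div_le_one_of_le₀ (by exact_mod_cast hmn) (by positivity)
      _ = 2 * C := mul_one _
  have h1 : ∀ p ∈ Finset.range (n - 1), ∑ q ∈ Finset.range (n - 1),
      w p * w q * (∑ i ∈ Finset.range m, c i * (φ i p * φ i q)) ^ 2 ≤ w p * (8 * v * C) := by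
    intro p _
    calc ∑ q ∈ Finset.range (n - 1),
          w p * w q * (∑ i ∈ Finset.range m, c i * (φ i p * φ i q)) ^ 2
        ≤ ∑ q ∈ Finset.range (n - 1),
          w p * v * (∑ i ∈ Finset.range m, (c i * φ i p) * φ i q) ^ 2 := by
          refine Finset.sum_le_sum fun q hq => ?_
          simp_rw [mul_assoc (c _)]
          gcongr
          · exact hw p
          · exact hv q hq
      _ = w p * v * ∑ q ∈ Finset.range (n - 1),
          (∑ i ∈ Finset.range m, (c i * φ i p) * φ i q) ^ 2 := by rw [Finset.mul_sum]
      _ ≤ w p * v * (4 * (2 * C)) := by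
          have := hw p
          gcongr
          exact (hφ _).trans (by gcongr; exact h2 p)
      _ = _ := by ring
  refine (Finset.sum_le_sum h1).trans ?_
  rw [← Finset.sum_mul]
  calc _ ≤ V * (8 * v * C) := by gcongr
    _ = _ := by ring

/-- The difference of the product f g is split so that g is differenced against an unchanged f,
which is the main term, and the variation of f is collected separately as an error term. -/
lemma sum_mul_sub_by_parts (m : ℕ) (f g x : ℕ → ℝ) (h0 : g 0 = 0) :
    ∑ i ∈ Finset.range m, (x (i + 1) - x i) * (f (i + 1) * g (i + 1))
      = ∑ j ∈ Finset.range (m + 1), x j * f (j + 1) * (g j - g (j + 1))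
        + ∑ i ∈ Finset.range m, (f (i + 1) - f (i + 2)) * x (i + 1) * g (i + 1)
        + x m * f (m + 1) * g (m + 1) := by
  induction m with
  | zero => simp [h0]
  | succ m ih =>
    simp only [Finset.sum_range_succ] at ih ⊢
    linarith

/-- The conditions on a weight under which the spectral sum concentrates at rate `n^{-1/4}`. -/
structure IsGoodWeight (n : ℕ) (w : ℕ → ℝ) : Prop where
  nonneg : ∀ p, 0 ≤ w p
  le_sqrt : ∀ p ∈ Finset.range (n - 1), w p ≤ Real.sqrt n
  sum_le : ∑ p ∈ Finset.range (n - 1), w p ≤ n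
  eig_le : ∀ p ∈ Finset.range (n - 1), w p * eigLam n (p + 1) ≤ 40 / Real.sqrt n
  sum_eig_le : ∑ p ∈ Finset.range (n - 1), w p * eigLam n (p + 1) ≤ 40

/-- The weighted sum of squared sine coefficients of `z i * f (i + 1)`. -/
noncomputable def specSum (n : ℕ) (w f z : ℕ → ℝ) : ℝ :=
  ∑ p ∈ Finset.range (n - 1),
    w p * (∑ i ∈ Finset.range (n - 1), z i * f (i + 1) * sinB n i p) ^ 2

/-- The asymptotic mean of the spectral sum. -/
noncomputable def specMean (n : ℕ) (w f s b : ℕ → ℝ) : ℝ :=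
  (∑ p ∈ Finset.range (n - 1), w p) / n * ∑ i ∈ Finset.range (n - 1), s i ^ 2 * f (i + 1) ^ 2
    + (∑ p ∈ Finset.range (n - 1), w p * eigLam n (p + 1)) / n
      * ∑ j ∈ Finset.range n, b j ^ 2 * f (j + 1) ^ 2

lemma eigLam_nonneg (n i : ℕ) : 0 ≤ eigLam n i := by unfold eigLam; positivity

lemma IsGoodWeight.eig_nonneg {n : ℕ} {w : ℕ → ℝ} (hw : IsGoodWeight n w) (p : ℕ) :
    0 ≤ w p * eigLam n (p + 1) := mul_nonneg (hw.nonneg p) (eigLam_nonneg _ _)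

/-- The exact mean of the spectral sum of the leading part of the increments. -/
noncomputable def specMeanExact (n : ℕ) (w f s b : ℕ → ℝ) : ℝ :=
  ∑ p ∈ Finset.range (n - 1),
    w p * (∑ i ∈ Finset.range (n - 1), s i ^ 2 * f (i + 1) ^ 2 * sinB n i p ^ 2
      + eigLam n (p + 1) * ∑ j ∈ Finset.range n, b j ^ 2 * f (j + 1) ^ 2 * cosB n j p ^ 2)

lemma sum_sq_weight_le {n : ℕ} {w : ℕ → ℝ} (hw : ∀ p, 0 ≤ w p) {v V : ℝ}
    (hv : ∀ p ∈ Finset.range (n - 1), w p ≤ v) (hv0 : 0 ≤ v)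
    (hV : ∑ p ∈ Finset.range (n - 1), w p ≤ V) :
    ∑ p ∈ Finset.range (n - 1), w p ^ 2 ≤ v * V := by
  calc ∑ p ∈ Finset.range (n - 1), w p ^ 2 ≤ ∑ p ∈ Finset.range (n - 1), v * w p :=
        Finset.sum_le_sum fun p hp => by
          rw [pow_two]; exact mul_le_mul_of_nonneg_right (hv p hp) (hw p)
    _ ≤ v * V := by rw [← Finset.mul_sum]; gcongr

/-! ### The mean of the spectral sum -/

section deterministic

variable {n : ℕ} {w f s b : ℕ → ℝ} {A : ℝ}

lemma mul_le_of_sq_le_two {x y B : ℝ} (hx0 : 0 ≤ x) (hx : x ≤ B) (hy : y ^ 2 ≤ 2) :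
    x * y ^ 2 ≤ 2 * B := by
  nlinarith [sq_nonneg y, mul_nonneg hx0 (sub_nonneg.2 hy)]

/-- By sin² = (1 - cos)/2 and cos² = (1 + cos)/2, the difference consists of two oscillating double
sums T1/n and T2/n. Each is bounded through the ℓ² norm of its weights, w or wλ, and sup times sum
gives √n · n for Σ w² and 1600/√n for Σ (wλ)². -/
lemma sq_specMeanExact_sub_le (hn : 0 < n) (hw : IsGoodWeight n w) (hf : ∀ i, f i ^ 2 ≤ 2)
    (hs : ∀ i ∈ Finset.range (n - 1), s i ^ 2 ≤ A / n) (hb : ∀ j ∈ Finset.range n, b j ^ 2 ≤ A) :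
    (specMeanExact n w f s b - specMean n w f s b) ^ 2 ≤ 13000 * A ^ 2 / Real.sqrt n := by
  have hn' : (0 : ℝ) < n := by exact_mod_cast hn
  have hr : 0 < Real.sqrt n := Real.sqrt_pos.2 hn'
  have hrr : Real.sqrt n * Real.sqrt n = n := Real.mul_self_sqrt hn'.le
  set c : ℕ → ℝ := fun i => s i ^ 2 * f (i + 1) ^ 2 with hc
  set d : ℕ → ℝ := fun j => b j ^ 2 * f (j + 1) ^ 2 with hd
  have hc2 : ∀ i ∈ Finset.range (n - 1), |c i| ≤ 2 * (A / n) := fun i hi => by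
    rw [abs_of_nonneg (by positivity)]
    exact mul_le_of_sq_le_two (sq_nonneg _) (hs i hi) (hf _)
  have hd2 : ∀ j ∈ Finset.range n, |d j| ≤ 2 * A := fun j hj => by
    rw [abs_of_nonneg (by positivity)]
    exact mul_le_of_sq_le_two (sq_nonneg _) (hb j hj) (hf _)
  set T1 := ∑ p ∈ Finset.range (n - 1), w p * ∑ i ∈ Finset.range (n - 1),
    c i * Real.cos (2 * Real.pi * (i * p) / n + 2 * i * Real.pi / n + 2 * (p + 1) * Real.pi / n)
    with hT1
  set T2 := ∑ p ∈ Finset.range (n - 1), (w p * eigLam n (p + 1)) * ∑ j ∈ Finset.range n,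
    d j * Real.cos (2 * Real.pi * (j * p) / n + 2 * j * Real.pi / n + (p + 1) * Real.pi / n)
    with hT2
  have b1 := sq_sum_mul_sum_cos_le hn (Nat.sub_le n 1) w c (fun i => 2 * i * Real.pi / n)
    (fun p => 2 * (p + 1) * Real.pi / n) hc2
  have b2 := sq_sum_mul_sum_cos_le hn le_rfl (fun p => w p * eigLam n (p + 1)) d
    (fun i => 2 * i * Real.pi / n) (fun p => (p + 1) * Real.pi / n) hd2
  rw [← hT1] at b1
  rw [← hT2] at b2
  have w1 := sum_sq_weight_le hw.nonneg hw.le_sqrt hr.le hw.sum_le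
  have w2 := sum_sq_weight_le hw.eig_nonneg hw.eig_le (by positivity) hw.sum_eig_le
  have e : specMeanExact n w f s b - specMean n w f s b = -(T1 / n) + T2 / n := by
    have e1 : T1 = ∑ p ∈ Finset.range (n - 1), w p * ∑ i ∈ Finset.range (n - 1),
        (c i - n * (s i ^ 2 * f (i + 1) ^ 2 * sinB n i p ^ 2)) := by
      refine Finset.sum_congr rfl fun p _ => ?_
      congr 1
      refine Finset.sum_congr rfl fun i _ => ?_
      rw [sinB_sq, show 2 * (((i : ℝ) + 1) * (p + 1) * Real.pi / n)
        = 2 * Real.pi * (i * p) / n + 2 * i * Real.pi / n + 2 * (p + 1) * Real.pi / n by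
          field_simp]
      simp only [hc]; field_simp; ring
    have e2 : T2 = ∑ p ∈ Finset.range (n - 1), (w p * eigLam n (p + 1)) * ∑ j ∈ Finset.range n,
        (n * (b j ^ 2 * f (j + 1) ^ 2 * cosB n j p ^ 2) - d j) := by
      refine Finset.sum_congr rfl fun p _ => ?_
      congr 1
      refine Finset.sum_congr rfl fun j _ => ?_
      rw [cosB_sq, show (2 * (j : ℝ) + 1) * (p + 1) * Real.pi / n
        = 2 * Real.pi * (j * p) / n + 2 * j * Real.pi / n + (p + 1) * Real.pi / n by
          field_simp]
      simp only [hd]; field_simp; ring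
    rw [e1, e2]
    simp only [Finset.sum_sub_distrib, mul_sub, ← Finset.mul_sum, ← Finset.sum_mul]
    rw [specMeanExact, specMean]
    simp only [mul_add, Finset.sum_add_distrib]
    have e3 : ∑ p ∈ Finset.range (n - 1), w p * ((n : ℝ) * ∑ i ∈ Finset.range (n - 1),
        s i ^ 2 * f (i + 1) ^ 2 * sinB n i p ^ 2) = n * ∑ p ∈ Finset.range (n - 1),
        w p * ∑ i ∈ Finset.range (n - 1), s i ^ 2 * f (i + 1) ^ 2 * sinB n i p ^ 2 := by
      rw [Finset.mul_sum]; exact Finset.sum_congr rfl fun p _ => by ring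
    have e4 : ∑ p ∈ Finset.range (n - 1), w p * eigLam n (p + 1) * ((n : ℝ) *
        ∑ j ∈ Finset.range n, b j ^ 2 * f (j + 1) ^ 2 * cosB n j p ^ 2)
        = n * ∑ p ∈ Finset.range (n - 1), w p * (eigLam n (p + 1) *
        ∑ j ∈ Finset.range n, b j ^ 2 * f (j + 1) ^ 2 * cosB n j p ^ 2) := by
      rw [Finset.mul_sum]; exact Finset.sum_congr rfl fun p _ => by ring
    rw [e3, e4]
    field_simp
    ring
  rw [e]
  have k1 : (T1 / n) ^ 2 ≤ 4 * A ^ 2 / Real.sqrt n := by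
    rw [div_pow, div_le_div_iff₀ (by positivity) hr]
    calc T1 ^ 2 * Real.sqrt n ≤ ((2 * (A / n)) ^ 2 * n ^ 2 * (Real.sqrt n * n)) * Real.sqrt n := by
          gcongr; exact b1.trans (by gcongr)
      _ = 4 * A ^ 2 * (n * (Real.sqrt n * Real.sqrt n)) := by field_simp; ring
      _ = _ := by rw [hrr]; ring
  have k2 : (T2 / n) ^ 2 ≤ 6400 * A ^ 2 / Real.sqrt n := by
    rw [div_pow, div_le_div_iff₀ (by positivity) hr]
    calc T2 ^ 2 * Real.sqrt n
        ≤ ((2 * A) ^ 2 * n ^ 2 * (40 / Real.sqrt n * 40)) * Real.sqrt n := by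
          gcongr; exact b2.trans (by gcongr)
      _ = 6400 * A ^ 2 * n ^ 2 := by field_simp; ring
  have k3 : (0 : ℝ) ≤ A ^ 2 / Real.sqrt n := by positivity
  rw [mul_div_assoc] at k1 k2 ⊢
  nlinarith [sq_nonneg (T1 / n + T2 / n)]

lemma specMean_nonneg (hw : IsGoodWeight n w) : 0 ≤ specMean n w f s b := by
  unfold specMean
  have h1 : 0 ≤ ∑ p ∈ Finset.range (n - 1), w p := Finset.sum_nonneg fun p _ => hw.nonneg p
  have h2 : 0 ≤ ∑ p ∈ Finset.range (n - 1), w p * eigLam n (p + 1) :=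
    Finset.sum_nonneg fun p _ => hw.eig_nonneg p
  have h3 : 0 ≤ ∑ i ∈ Finset.range (n - 1), s i ^ 2 * f (i + 1) ^ 2 :=
    Finset.sum_nonneg fun _ _ => by positivity
  have h4 : 0 ≤ ∑ i ∈ Finset.range n, b i ^ 2 * f (i + 1) ^ 2 :=
    Finset.sum_nonneg fun _ _ => by positivity
  positivity

lemma sum_signal_le (hn : 0 < n) (hf : ∀ i, f i ^ 2 ≤ 2)
    (hs : ∀ i ∈ Finset.range (n - 1), s i ^ 2 ≤ A / n) (hA : 0 ≤ A) :
    ∑ i ∈ Finset.range (n - 1), s i ^ 2 * f (i + 1) ^ 2 ≤ 2 * A := by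
  have hn' : (0 : ℝ) < n := by exact_mod_cast hn
  calc ∑ i ∈ Finset.range (n - 1), s i ^ 2 * f (i + 1) ^ 2
      ≤ ∑ i ∈ Finset.range (n - 1), 2 * (A / n) :=
        Finset.sum_le_sum fun i hi => mul_le_of_sq_le_two (sq_nonneg _) (hs i hi) (hf _)
    _ ≤ n * (2 * (A / n)) := by
        simp only [Finset.sum_const, Finset.card_range, nsmul_eq_mul]
        gcongr; omega
    _ = 2 * A := by field_simp

lemma sum_noise_le (hf : ∀ i, f i ^ 2 ≤ 2) (hb : ∀ j ∈ Finset.range n, b j ^ 2 ≤ A) :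
    ∑ j ∈ Finset.range n, b j ^ 2 * f (j + 1) ^ 2 ≤ n * (2 * A) := by
  calc ∑ j ∈ Finset.range n, b j ^ 2 * f (j + 1) ^ 2 ≤ ∑ j ∈ Finset.range n, 2 * A :=
        Finset.sum_le_sum fun i hi => mul_le_of_sq_le_two (sq_nonneg _) (hb i hi) (hf _)
    _ = n * (2 * A) := by simp

lemma specMean_le (hn : 0 < n) (hw : IsGoodWeight n w) (hf : ∀ i, f i ^ 2 ≤ 2)
    (hs : ∀ i ∈ Finset.range (n - 1), s i ^ 2 ≤ A / n) (hb : ∀ j ∈ Finset.range n, b j ^ 2 ≤ A)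
    (hA : 0 ≤ A) : specMean n w f s b ≤ 82 * A := by
  have hn' : (0 : ℝ) < n := by exact_mod_cast hn
  have h2 : 0 ≤ ∑ p ∈ Finset.range (n - 1), w p * eigLam n (p + 1) :=
    Finset.sum_nonneg fun p _ => hw.eig_nonneg p
  have k1 : (∑ p ∈ Finset.range (n - 1), w p) / n *
      ∑ i ∈ Finset.range (n - 1), s i ^ 2 * f (i + 1) ^ 2 ≤ 1 * (2 * A) :=
    mul_le_mul (div_le_one_of_le₀ hw.sum_le hn'.le) (sum_signal_le hn hf hs hA)
      (Finset.sum_nonneg fun _ _ => by positivity) zero_le_one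
  have k2 : (∑ p ∈ Finset.range (n - 1), w p * eigLam n (p + 1)) / n
      * ∑ j ∈ Finset.range n, b j ^ 2 * f (j + 1) ^ 2 ≤ 40 / n * (n * (2 * A)) :=
    mul_le_mul (by gcongr; exact hw.sum_eig_le) (sum_noise_le hf hb)
      (Finset.sum_nonneg fun _ _ => by positivity) (by positivity)
  have k3 : 40 / (n : ℝ) * (n * (2 * A)) = 80 * A := by field_simp; ring
  unfold specMean
  linarith

end deterministic

/-- The leading part of the sine coefficients of the increments. -/
noncomputable def leadCoef (n : ℕ) (f s b ξ η : ℕ → ℝ) (p : ℕ) : ℝ :=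
  ∑ i ∈ Finset.range (n - 1), s i * f (i + 1) * sinB n i p * ξ i
    + ∑ j ∈ Finset.range n,
      -(2 * Real.sin ((p + 1) * Real.pi / (2 * n))) * (b j * f (j + 1)) * cosB n j p * η j

/-- The negligible part of the sine coefficients of the increments. -/
noncomputable def restCoef (n : ℕ) (f b η ρ : ℕ → ℝ) (p : ℕ) : ℝ :=
  ∑ i ∈ Finset.range (n - 1), ρ i * f (i + 1) * sinB n i p
    + ∑ i ∈ Finset.range (n - 1), (f (i + 1) - f (i + 2)) * (b (i + 1) * η (i + 1)) * sinB n i p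

/-- Summation by parts against g_j, the sine at node j: its differences give the cosines of the
leading part, and the differences of f give the second sum of the rest. -/
lemma sum_increment_eq (n : ℕ) (hn : 0 < n) (f s b ξ η ρ : ℕ → ℝ) (p : ℕ) :
    ∑ i ∈ Finset.range (n - 1),
        (s i * ξ i + ρ i + (b (i + 1) * η (i + 1) - b i * η i)) * f (i + 1) * sinB n i p
      = leadCoef n f s b ξ η p + restCoef n f b η ρ p := by
  have hn' : (n : ℝ) ≠ 0 := by exact_mod_cast hn.ne'
  set g : ℕ → ℝ := fun j => Real.sqrt (2 / n) * Real.sin (j * (p + 1) * Real.pi / n) with hg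
  have hgS : ∀ i, g (i + 1) = sinB n i p := fun i => by simp [hg, sinB]
  have key := sum_mul_sub_by_parts (n - 1) f g (fun j => b j * η j) (by simp [hg])
  -- The sine also vanishes at the right end j = n, so no boundary term remains.
  have hgn : g (n - 1 + 1) = 0 := by
    rw [Nat.sub_add_cancel hn]
    simp only [hg]
    rw [show (n : ℝ) * (p + 1) * Real.pi / n = ((p + 1 : ℕ) : ℝ) * Real.pi by
      push_cast; field_simp, Real.sin_nat_mul_pi, mul_zero]
  rw [hgn, mul_zero, add_zero, Nat.sub_add_cancel hn] at key
  have e1 : ∀ j ∈ Finset.range n, b j * η j * f (j + 1) * (g j - g (j + 1))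
      = -(2 * Real.sin ((p + 1) * Real.pi / (2 * n))) * (b j * f (j + 1)) * cosB n j p * η j := by
    intro j _
    have := sqrt_mul_sin_sub_sin n j p
    simp only [hg]
    push_cast
    rw [this]; ring
  rw [Finset.sum_congr rfl e1] at key
  simp only [hgS] at key
  unfold leadCoef restCoef
  have e2 : ∑ i ∈ Finset.range (n - 1),
        (s i * ξ i + ρ i + (b (i + 1) * η (i + 1) - b i * η i)) * f (i + 1) * sinB n i p
      = ∑ i ∈ Finset.range (n - 1), s i * f (i + 1) * sinB n i p * ξ i
        + ∑ i ∈ Finset.range (n - 1), ρ i * f (i + 1) * sinB n i p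
        + ∑ i ∈ Finset.range (n - 1),
          (b (i + 1) * η (i + 1) - b i * η i) * (f (i + 1) * sinB n i p) := by
    rw [← Finset.sum_add_distrib, ← Finset.sum_add_distrib]
    exact Finset.sum_congr rfl fun i _ => by ring
  rw [e2, key]
  ring

/-! ### Fluctuations of the spectral sum -/

section

variable {Ω : Type*} [MeasurableSpace Ω] {μ : Measure Ω} {M A : ℝ}
  {n : ℕ} {w f s b : ℕ → ℝ} {ξ η ρ : ℕ → Ω → ℝ}

lemma memLp_leadCoef
    (h : IsWhite μ M (Sum.elim (fun i : Fin (n - 1) => ξ i) (fun j : Fin n => η j))) (p : ℕ) :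
    MemLp (fun ω => leadCoef n f s b (ξ · ω) (η · ω) p) 4 μ :=
  (memLp_finsetSum _ fun i hi => (h.memLp (Sum.inl ⟨i, Finset.mem_range.1 hi⟩)).const_mul _).add
    (memLp_finsetSum _ fun j hj => (h.memLp (Sum.inr ⟨j, Finset.mem_range.1 hj⟩)).const_mul _)

/-- The covariance of the coefficients p and q is a sine sum plus m_p m_q times a cosine sum, with
m_p² = λ_{p+1}. Splitting the square separates signal and noise, the weights of the latter becoming
wλ. Both contributions are of order n^{-1/2}: √n · n · n^{-2} for the signal, and sup times sum of
wλ for the noise. -/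
lemma integral_sq_leadCoef_sub_le [IsProbabilityMeasure μ] (hn : 0 < n) (hM : 0 ≤ M)
    (hw : IsGoodWeight n w) (hf : ∀ i, f i ^ 2 ≤ 2)
    (hs : ∀ i ∈ Finset.range (n - 1), s i ^ 2 ≤ A / n) (hb : ∀ j ∈ Finset.range n, b j ^ 2 ≤ A)
    (h : IsWhite μ M (Sum.elim (fun i : Fin (n - 1) => ξ i) (fun j : Fin n => η j))) :
    MemLp (fun ω => ∑ p ∈ Finset.range (n - 1), w p * leadCoef n f s b (ξ · ω) (η · ω) p ^ 2
      - specMeanExact n w f s b) 2 μ ∧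
    ∫ ω, (∑ p ∈ Finset.range (n - 1), w p * leadCoef n f s b (ξ · ω) (η · ω) p ^ 2
      - specMeanExact n w f s b) ^ 2 ∂μ ≤ (8 + 2 * M) * (110000 * A ^ 2 / Real.sqrt n) := by
  have hn' : (0 : ℝ) < n := by exact_mod_cast hn
  have hr : 0 < Real.sqrt n := Real.sqrt_pos.2 hn'
  have hrr : Real.sqrt n * Real.sqrt n = n := Real.mul_self_sqrt hn'.le
  set m : ℕ → ℝ := fun p => 2 * Real.sin ((p + 1) * Real.pi / (2 * n)) with hm
  have hm2 : ∀ p, m p ^ 2 = eigLam n (p + 1) := fun p => by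
    simp only [hm, eigLam]; push_cast; ring
  set B : Fin (n - 1) ⊕ Fin n → ℕ → ℝ := fun a p =>
    Sum.elim (fun i : Fin (n - 1) => s i * f (i + 1) * sinB n i p)
      (fun j : Fin n => -m p * (b j * f (j + 1)) * cosB n j p) a with hB
  have hV : ∀ ω p, ∑ a, B a p * Sum.elim (fun i : Fin (n - 1) => ξ i) (fun j : Fin n => η j) a ω
      = leadCoef n f s b (ξ · ω) (η · ω) p := fun ω p => by
    rw [leadCoef, Fintype.sum_sum_type, Finset.sum_range, Finset.sum_range]
    rfl
  have hmean : ∀ p, ∑ a, B a p ^ 2 = ∑ i ∈ Finset.range (n - 1), s i ^ 2 * f (i + 1) ^ 2 * sinB n i p ^ 2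
      + eigLam n (p + 1) * ∑ j ∈ Finset.range n, b j ^ 2 * f (j + 1) ^ 2 * cosB n j p ^ 2 :=
    fun p => by
      rw [Fintype.sum_sum_type, Finset.sum_range, Finset.sum_range, Finset.mul_sum]
      simp only [hB, Sum.elim_inl, Sum.elim_inr]
      congr 1
      · exact Finset.sum_congr rfl fun i _ => by ring
      · exact Finset.sum_congr rfl fun i _ => by rw [← hm2]; ring
  have hcov : ∀ p q, ∑ a, B a p * B a q
      = ∑ i ∈ Finset.range (n - 1), (s i ^ 2 * f (i + 1) ^ 2) * (sinB n i p * sinB n i q)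
        + m p * m q * ∑ j ∈ Finset.range n, (b j ^ 2 * f (j + 1) ^ 2) * (cosB n j p * cosB n j q) :=
    fun p q => by
      rw [Fintype.sum_sum_type, Finset.sum_range, Finset.sum_range, Finset.mul_sum]
      simp only [hB, Sum.elim_inl, Sum.elim_inr]
      congr 1
      · exact Finset.sum_congr rfl fun i _ => by ring
      · exact Finset.sum_congr rfl fun i _ => by ring
  have main := h.integral_sq_sum_sq_sub_le hM (Finset.range (n - 1)) w B
  simp_rw [hV, hmean] at main
  refine ⟨main.1, main.2.trans ?_⟩
  gcongr
  have k1 := sum_sum_weight_mul_sq_le (m := n - 1) (φ := sinB n) (Nat.sub_le n 1)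
    (sum_sq_sum_mul_sinB_le hn) (sinB_sq_le n) hw.nonneg hw.le_sqrt hr.le hw.sum_le
    (c := fun i => s i ^ 2 * f (i + 1) ^ 2) (C := (2 * (A / n)) ^ 2) (fun i hi => by
      have := mul_le_of_sq_le_two (sq_nonneg _) (hs i hi) (hf (i + 1))
      gcongr) (by positivity)
  have k2 := sum_sum_weight_mul_sq_le (m := n) (φ := cosB n) le_rfl
    (sum_sq_sum_mul_cosB_le hn) (cosB_sq_le n) hw.eig_nonneg hw.eig_le (by positivity)
    hw.sum_eig_le
    (c := fun i => b i ^ 2 * f (i + 1) ^ 2) (C := (2 * A) ^ 2) (fun i hi => by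
      have := mul_le_of_sq_le_two (sq_nonneg _) (hb i hi) (hf (i + 1))
      gcongr) (by positivity)
  calc ∑ p ∈ Finset.range (n - 1), ∑ q ∈ Finset.range (n - 1), w p * w q * (∑ a, B a p * B a q) ^ 2
      ≤ ∑ p ∈ Finset.range (n - 1), ∑ q ∈ Finset.range (n - 1), (2 * (w p * w q *
          (∑ i ∈ Finset.range (n - 1), (s i ^ 2 * f (i + 1) ^ 2) * (sinB n i p * sinB n i q)) ^ 2)
          + 2 * (w p * eigLam n (p + 1) * (w q * eigLam n (q + 1)) * (∑ j ∈ Finset.range n,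
            (b j ^ 2 * f (j + 1) ^ 2) * (cosB n j p * cosB n j q)) ^ 2)) := by
        refine Finset.sum_le_sum fun p _ => Finset.sum_le_sum fun q _ => ?_
        rw [hcov, ← hm2, ← hm2]
        have hww := mul_nonneg (hw.nonneg p) (hw.nonneg q)
        set X := ∑ i ∈ Finset.range (n - 1),
          (s i ^ 2 * f (i + 1) ^ 2) * (sinB n i p * sinB n i q)
        set Y := ∑ j ∈ Finset.range n, (b j ^ 2 * f (j + 1) ^ 2) * (cosB n j p * cosB n j q)
        have : (X + m p * m q * Y) ^ 2 ≤ 2 * X ^ 2 + 2 * (m p * m q * Y) ^ 2 := by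
          nlinarith [sq_nonneg (X - m p * m q * Y)]
        calc _ ≤ w p * w q * (2 * X ^ 2 + 2 * (m p * m q * Y) ^ 2) := by gcongr
          _ = _ := by ring
    _ ≤ 2 * (8 * Real.sqrt n * n * (2 * (A / n)) ^ 2)
        + 2 * (8 * (40 / Real.sqrt n) * 40 * (2 * A) ^ 2) := by
        simp only [Finset.sum_add_distrib, ← Finset.mul_sum]
        linarith
    _ = 102464 * A ^ 2 / Real.sqrt n := by
        have : (2 * (A / n)) ^ 2 = 4 * A ^ 2 / (n * (Real.sqrt n * Real.sqrt n)) := by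
          rw [hrr]; field_simp; ring
        rw [this]; field_simp; ring
    _ ≤ _ := by gcongr; norm_num

lemma memLp_restCoef
    (h : IsWhite μ M (Sum.elim (fun i : Fin (n - 1) => ξ i) (fun j : Fin n => η j)))
    (hρ : ∀ i ∈ Finset.range (n - 1), MemLp (ρ i) 4 μ) (p : ℕ) :
    MemLp (fun ω => restCoef n f b (η · ω) (ρ · ω) p) 4 μ := by
  refine (memLp_finsetSum _ fun i hi => ?_).add (memLp_finsetSum _ fun i hi => ?_)
  · exact ((hρ i hi).mul_const _).mul_const _
  · rw [Finset.mem_range] at hi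
    have := h.memLp (Sum.inr ⟨i + 1, by omega⟩)
    exact ((this.const_mul _).const_mul _).mul_const _

lemma memLp_sum_weight_sq {P : Finset ℕ} {V : ℕ → Ω → ℝ} (w : ℕ → ℝ)
    (hV : ∀ p ∈ P, MemLp (V p) 4 μ) : MemLp (fun ω => ∑ p ∈ P, w p * V p ω ^ 2) 2 μ := by
  refine memLp_finsetSum _ fun p hp => ?_
  simp_rw [pow_two]
  exact ((hV p hp).mul (hV p hp) (r := 2)).const_mul _

/-- For the ρ part, w ≤ √n and Bessel reduce the squared form to 64 n² Σ ρ_i⁴, whose mean is O(1/n).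
The noise part is again a white quadratic form, with coefficients (f_{i+1} - f_{i+2}) b_{i+1} of
squared size O(n^{-3/2}); its mean is O(n^{-1/2}) and its variance O(1/n). -/
lemma integral_sq_restCoef_le [IsProbabilityMeasure μ] (hn : 0 < n) (hM : 0 ≤ M) (hA : 0 ≤ A)
    (hw : IsGoodWeight n w) (hf : ∀ i, f i ^ 2 ≤ 2)
    (hfd : ∀ i, (f (i + 1) - f (i + 2)) ^ 2 ≤ 5 / (n * Real.sqrt n))
    (hb : ∀ j ∈ Finset.range n, b j ^ 2 ≤ A)
    (h : IsWhite μ M (Sum.elim (fun i : Fin (n - 1) => ξ i) (fun j : Fin n => η j)))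
    (hρ : ∀ i ∈ Finset.range (n - 1), MemLp (ρ i) 4 μ)
    (hρ4 : ∀ i ∈ Finset.range (n - 1), ∫ ω, ρ i ω ^ 4 ∂μ ≤ A / n ^ 4) :
    ∫ ω, (∑ p ∈ Finset.range (n - 1), w p * restCoef n f b (η · ω) (ρ · ω) p ^ 2) ^ 2 ∂μ
      ≤ (512 * A + 16 * (8 + 2 * M) * 200 * A ^ 2 + 1600 * A ^ 2) / n := by
  have hn' : (0 : ℝ) < n := by exact_mod_cast hn
  have hn1 : (1 : ℝ) ≤ n := by exact_mod_cast hn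
  have hr : 0 < Real.sqrt n := Real.sqrt_pos.2 hn'
  have hr1 : 1 ≤ Real.sqrt n := Real.one_le_sqrt.2 hn1
  have hrr : Real.sqrt n * Real.sqrt n = n := Real.mul_self_sqrt hn'.le
  set κ : ℝ := 5 / (n * Real.sqrt n) with hκ
  have hκ0 : 0 ≤ κ := by positivity
  set c : ℕ → ℝ := fun i => (f (i + 1) - f (i + 2)) * b (i + 1) with hc
  have hc2 : ∀ i ∈ Finset.range (n - 1), c i ^ 2 ≤ κ * A := fun i hi => by
    rw [Finset.mem_range] at hi
    simp only [hc]
    rw [mul_pow]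
    exact mul_le_mul (hfd i) (hb (i + 1) (Finset.mem_range.2 (by omega))) (sq_nonneg _) hκ0
  -- the noise part
  set E : ℕ → Ω → ℝ := fun p ω => ∑ i : Fin (n - 1), (c i * sinB n i p) * η (i + 1) ω with hE
  -- The by-parts error only involves η_1, …, η_{n-1}, hence the shift of the index.
  have hη : IsWhite μ M (fun i : Fin (n - 1) => η (i + 1)) := by
    have := h.precomp (g := fun i : Fin (n - 1) =>
      (Sum.inr ⟨i + 1, by omega⟩ : Fin (n - 1) ⊕ Fin n)) (fun i j hij => by
        simp only [Sum.inr.injEq, Fin.mk.injEq] at hij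
        exact Fin.ext (by omega))
    exact this
  obtain ⟨q1, q2⟩ := hη.integral_sq_sum_sq_sub_le hM (Finset.range (n - 1)) w
    (fun i p => c i * sinB n i p)
  set mE := ∑ p ∈ Finset.range (n - 1), w p * ∑ i : Fin (n - 1), (c i * sinB n i p) ^ 2 with hmE
  have hcov : ∀ p q, ∑ i : Fin (n - 1), (c i * sinB n i p) * (c i * sinB n i q)
      = ∑ i ∈ Finset.range (n - 1), c i ^ 2 * (sinB n i p * sinB n i q) := fun p q => by
    rw [Finset.sum_range]; exact Finset.sum_congr rfl fun i _ => by ring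
  simp_rw [hcov] at q2
  have k1 := sum_sum_weight_mul_sq_le (m := n - 1) (φ := sinB n) (Nat.sub_le n 1)
    (sum_sq_sum_mul_sinB_le hn) (sinB_sq_le n) hw.nonneg hw.le_sqrt hr.le hw.sum_le
    (c := fun i => c i ^ 2) (C := (κ * A) ^ 2) (fun i hi => by
      have := hc2 i hi
      gcongr) (by positivity)
  have hmE0 : 0 ≤ mE := Finset.sum_nonneg fun p _ =>
    mul_nonneg (hw.nonneg p) (Finset.sum_nonneg fun _ _ => sq_nonneg _)
  have hmE1 : mE ≤ n * (2 * (κ * A)) := by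
    calc mE ≤ ∑ p ∈ Finset.range (n - 1), w p * (2 * (κ * A)) := by
          refine Finset.sum_le_sum fun p _ => mul_le_mul_of_nonneg_left ?_ (hw.nonneg p)
          calc ∑ i : Fin (n - 1), (c i * sinB n i p) ^ 2 ≤ ∑ i : Fin (n - 1), κ * A * (2 / n) := by
                refine Finset.sum_le_sum fun i _ => ?_
                rw [mul_pow]
                exact mul_le_mul (hc2 i (Finset.mem_range.2 i.2)) (sinB_sq_le n i p) (sq_nonneg _)
                  (by positivity)
            _ ≤ n * (κ * A * (2 / n)) := by
                simp only [Finset.sum_const, Finset.card_univ, Fintype.card_fin, nsmul_eq_mul]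
                gcongr; omega
            _ = 2 * (κ * A) := by field_simp
      _ ≤ _ := by rw [← Finset.sum_mul]; gcongr; exact hw.sum_le
  have hmE2 : mE ^ 2 ≤ 100 * A ^ 2 / n := by
    calc mE ^ 2 ≤ (n * (2 * (κ * A))) ^ 2 := by gcongr
      _ = 100 * A ^ 2 / (Real.sqrt n * Real.sqrt n) := by simp only [hκ]; field_simp; ring
      _ = _ := by rw [hrr]
  have k3 : 8 * Real.sqrt n * n * (κ * A) ^ 2 ≤ 200 * A ^ 2 / n := by
    have : 8 * Real.sqrt n * n * (κ * A) ^ 2 = 200 * A ^ 2 / n / Real.sqrt n := by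
      simp only [hκ]; field_simp; ring
    rw [this]
    exact div_le_self (by positivity) hr1
  set QE : Ω → ℝ := fun ω => ∑ p ∈ Finset.range (n - 1), w p * E p ω ^ 2 with hQE
  -- the signal part
  set D : Ω → ℝ := fun ω => ∑ i ∈ Finset.range (n - 1), ρ i ω ^ 4 with hD
  have hρ2 : ∀ i ∈ Finset.range (n - 1), MemLp (fun ω => ρ i ω ^ 2) 2 μ := fun i hi => by
    simp_rw [pow_two]; exact (hρ i hi).mul (hρ i hi) (r := 2)
  have hρi : ∀ i ∈ Finset.range (n - 1), Integrable (fun ω => ρ i ω ^ 4) μ := fun i hi => by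
    simpa [← pow_mul] using (hρ2 i hi).integrable_sq
  have hDi : Integrable D μ := integrable_finsetSum _ hρi
  have hDint : ∫ ω, D ω ∂μ ≤ A / n ^ 3 := by
    simp only [hD]
    rw [integral_finsetSum _ hρi]
    calc _ ≤ ∑ i ∈ Finset.range (n - 1), A / (n : ℝ) ^ 4 := Finset.sum_le_sum hρ4
      _ ≤ n * (A / n ^ 4) := by
          simp only [Finset.sum_const, Finset.card_range, nsmul_eq_mul]
          gcongr; omega
      _ = _ := by field_simp
  have hX : ∀ ω, (∑ p ∈ Finset.range (n - 1), w p *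
      (∑ i ∈ Finset.range (n - 1), ρ i ω * f (i + 1) * sinB n i p) ^ 2) ^ 2
      ≤ 64 * n ^ 2 * D ω := fun ω => by
    have a1 : ∑ p ∈ Finset.range (n - 1), w p *
      (∑ i ∈ Finset.range (n - 1), ρ i ω * f (i + 1) * sinB n i p) ^ 2
      ≤ Real.sqrt n * (8 * ∑ i ∈ Finset.range (n - 1), ρ i ω ^ 2) := by
      calc _ ≤ ∑ p ∈ Finset.range (n - 1), Real.sqrt n *
            (∑ i ∈ Finset.range (n - 1), ρ i ω * f (i + 1) * sinB n i p) ^ 2 :=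
            Finset.sum_le_sum fun p hp =>
              mul_le_mul_of_nonneg_right (hw.le_sqrt p hp) (sq_nonneg _)
        _ ≤ Real.sqrt n * (4 * ∑ i ∈ Finset.range (n - 1), (ρ i ω * f (i + 1)) ^ 2) := by
            rw [← Finset.mul_sum]
            gcongr
            exact sum_sq_sum_mul_sinB_le hn _
        _ ≤ _ := by
            refine mul_le_mul_of_nonneg_left ?_ hr.le
            rw [Finset.mul_sum, Finset.mul_sum]
            refine Finset.sum_le_sum fun i _ => ?_
            rw [mul_pow]
            nlinarith [mul_nonneg (sq_nonneg (ρ i ω)) (sub_nonneg.2 (hf (i + 1)))]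
    have a0 : 0 ≤ ∑ p ∈ Finset.range (n - 1), w p *
      (∑ i ∈ Finset.range (n - 1), ρ i ω * f (i + 1) * sinB n i p) ^ 2 :=
      Finset.sum_nonneg fun p _ => mul_nonneg (hw.nonneg p) (sq_nonneg _)
    have a2 : (∑ i ∈ Finset.range (n - 1), ρ i ω ^ 2) ^ 2 ≤ n * D ω := by
      refine (sq_sum_le_card_mul_sum_sq).trans ?_
      simp only [Finset.card_range, ← pow_mul]
      have : 0 ≤ D ω := Finset.sum_nonneg fun _ _ => by positivity
      calc _ = ((n - 1 : ℕ) : ℝ) * D ω := rfl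
        _ ≤ _ := by gcongr; omega
    calc _ ≤ (Real.sqrt n * (8 * ∑ i ∈ Finset.range (n - 1), ρ i ω ^ 2)) ^ 2 := by gcongr
      _ = 64 * (Real.sqrt n * Real.sqrt n) * (∑ i ∈ Finset.range (n - 1), ρ i ω ^ 2) ^ 2 := by ring
      _ ≤ 64 * n * (n * D ω) := by rw [hrr]; gcongr
      _ = _ := by ring
  -- combination
  have hpt : ∀ ω, (∑ p ∈ Finset.range (n - 1), w p * restCoef n f b (η · ω) (ρ · ω) p ^ 2) ^ 2
      ≤ 512 * n ^ 2 * D ω + (16 * (QE ω - mE) ^ 2 + 16 * mE ^ 2) := fun ω => by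
    have hEr : ∀ p, ∑ i ∈ Finset.range (n - 1), (f (i + 1) - f (i + 2)) *
        (b (i + 1) * η (i + 1) ω) * sinB n i p = E p ω := fun p => by
      simp only [hE]
      rw [Finset.sum_range]
      exact Finset.sum_congr rfl fun i _ => by simp only [hc]; ring
    set QX := ∑ p ∈ Finset.range (n - 1), w p *
      (∑ i ∈ Finset.range (n - 1), ρ i ω * f (i + 1) * sinB n i p) ^ 2 with hQX
    have b1 : ∑ p ∈ Finset.range (n - 1), w p * restCoef n f b (η · ω) (ρ · ω) p ^ 2
        ≤ 2 * QX + 2 * QE ω := by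
      simp only [hQX, hQE, restCoef, hEr]
      rw [Finset.mul_sum, Finset.mul_sum, ← Finset.sum_add_distrib]
      refine Finset.sum_le_sum fun p _ => ?_
      nlinarith [mul_nonneg (hw.nonneg p)
        (sq_nonneg (∑ i ∈ Finset.range (n - 1), ρ i ω * f (i + 1) * sinB n i p - E p ω))]
    have b0 : 0 ≤ ∑ p ∈ Finset.range (n - 1), w p * restCoef n f b (η · ω) (ρ · ω) p ^ 2 :=
      Finset.sum_nonneg fun p _ => mul_nonneg (hw.nonneg p) (sq_nonneg _)
    have b2 : (∑ p ∈ Finset.range (n - 1), w p * restCoef n f b (η · ω) (ρ · ω) p ^ 2) ^ 2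
        ≤ (2 * QX + 2 * QE ω) ^ 2 := by gcongr
    nlinarith [hX ω, sq_nonneg (2 * QX - 2 * QE ω), sq_nonneg ((QE ω - mE) - mE)]
  calc _ ≤ ∫ ω, (512 * n ^ 2 * D ω + (16 * (QE ω - mE) ^ 2 + 16 * mE ^ 2)) ∂μ :=
        integral_mono_of_nonneg (ae_of_all _ fun ω => sq_nonneg _)
          ((hDi.const_mul _).fun_add ((q1.integrable_sq.const_mul _).fun_add
            (integrable_const _))) (ae_of_all _ hpt)
    _ = 512 * n ^ 2 * ∫ ω, D ω ∂μ + (16 * ∫ ω, (QE ω - mE) ^ 2 ∂μ + 16 * mE ^ 2) := by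
        rw [integral_add (hDi.const_mul _) ((q1.integrable_sq.const_mul _).fun_add
          (integrable_const _)), integral_add (q1.integrable_sq.const_mul _) (integrable_const _),
          integral_const_mul, integral_const_mul]
        simp only [integral_const, probReal_univ, one_smul]
        rfl
    _ ≤ 512 * n ^ 2 * (A / n ^ 3) + (16 * ((8 + 2 * M) * (200 * A ^ 2 / n))
        + 16 * (100 * A ^ 2 / n)) := by
        have : ∫ ω, (QE ω - mE) ^ 2 ∂μ ≤ (8 + 2 * M) * (200 * A ^ 2 / n) :=
          q2.trans (by gcongr; exact k1.trans k3)
        gcongr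
    _ = _ := by field_simp; ring

/-- Here V2 and R2 are the energies of the leading and the remaining part and C is their cross term.
In the inequality 2 V2 R2 ≤ V2²/r + r R2², the choice r = √n is the right one: V2 is of order 1 and
R2² of order 1/n, so both terms are of order n^{-1/2}. -/
lemma sq_add_sub_le {X V2 R2 C m c r : ℝ} (hr : 1 ≤ r)
    (hC : C ^ 2 ≤ V2 * R2) (hX : X = V2 - m) :
    (V2 + 2 * C + R2 - c) ^ 2
      ≤ 20 * X ^ 2 + (4 * (m - c) ^ 2 + 16 * m ^ 2 / r) + 12 * r * R2 ^ 2 := by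
  have hr0 : 0 < r := by linarith
  have h1 : 4 * C ^ 2 ≤ 2 * (V2 ^ 2 / r + r * R2 ^ 2) := by
    have : 2 * (V2 * R2) ≤ V2 ^ 2 / r + r * R2 ^ 2 := by
      rw [div_add' _ _ _ hr0.ne', le_div_iff₀ hr0]
      nlinarith [sq_nonneg (V2 - r * R2)]
    linarith
  have h2 : V2 ^ 2 / r ≤ 2 * X ^ 2 + 2 * m ^ 2 / r := by
    have : V2 ^ 2 / r ≤ (2 * X ^ 2 + 2 * m ^ 2) / r := by
      gcongr
      rw [hX]; nlinarith [sq_nonneg (V2 - 2 * m)]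
    rw [add_div] at this
    have h3 : 2 * X ^ 2 / r ≤ 2 * X ^ 2 := div_le_self (by positivity) hr
    linarith
  have h3 : (V2 + 2 * C + R2 - c) ^ 2 ≤ 4 * (X ^ 2 + (m - c) ^ 2 + 4 * C ^ 2 + R2 ^ 2) := by
    rw [show V2 + 2 * C + R2 - c = X + (m - c) + 2 * C + R2 by rw [hX]; ring]
    nlinarith [sq_nonneg (X - (m - c)), sq_nonneg (X - 2 * C), sq_nonneg (X - R2),
      sq_nonneg (m - c - 2 * C), sq_nonneg (m - c - R2), sq_nonneg (2 * C - R2)]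
  have h4 : R2 ^ 2 ≤ r * R2 ^ 2 := le_mul_of_one_le_left (sq_nonneg _) hr
  have h5 : 16 * m ^ 2 / r = 8 * (2 * m ^ 2 / r) := by ring
  linarith

lemma integral_sq_specSum_sub_le [IsProbabilityMeasure μ] (hn : 0 < n) (hM : 0 ≤ M) (hA : 0 ≤ A)
    (hw : IsGoodWeight n w) (hf : ∀ i, f i ^ 2 ≤ 2)
    (hfd : ∀ i, (f (i + 1) - f (i + 2)) ^ 2 ≤ 5 / (n * Real.sqrt n))
    (hs : ∀ i ∈ Finset.range (n - 1), s i ^ 2 ≤ A / n)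
    (hb : ∀ j ∈ Finset.range n, b j ^ 2 ≤ A)
    (h : IsWhite μ M (Sum.elim (fun i : Fin (n - 1) => ξ i) (fun j : Fin n => η j)))
    (hρ : ∀ i ∈ Finset.range (n - 1), MemLp (ρ i) 4 μ)
    (hρ4 : ∀ i ∈ Finset.range (n - 1), ∫ ω, ρ i ω ^ 4 ∂μ ≤ A / n ^ 4) :
    MemLp (fun ω => specSum n w f (fun i => s i * ξ i ω + ρ i ω
      + (b (i + 1) * η (i + 1) ω - b i * η i ω)) - specMean n w f s b) 2 μ ∧
    ∫ ω, (specSum n w f (fun i => s i * ξ i ω + ρ i ω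
      + (b (i + 1) * η (i + 1) ω - b i * η i ω)) - specMean n w f s b) ^ 2 ∂μ
      ≤ (20 * ((8 + 2 * M) * (110000 * A ^ 2)) + (4 * (13000 * A ^ 2)
          + 16 * (26000 * A ^ 2 + 2 * (82 * A) ^ 2))
        + 12 * (512 * A + 16 * (8 + 2 * M) * 200 * A ^ 2 + 1600 * A ^ 2)) / Real.sqrt n := by
  have hn' : (0 : ℝ) < n := by exact_mod_cast hn
  have hn1 : (1 : ℝ) ≤ n := by exact_mod_cast hn
  have hr : 0 < Real.sqrt n := Real.sqrt_pos.2 hn'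
  have hr1 : 1 ≤ Real.sqrt n := Real.one_le_sqrt.2 hn1
  have hrr : Real.sqrt n * Real.sqrt n = n := Real.mul_self_sqrt hn'.le
  obtain ⟨l1, l2⟩ := integral_sq_leadCoef_sub_le hn hM hw hf hs hb h
  have r2 := integral_sq_restCoef_le hn hM hA hw hf hfd hb h hρ hρ4
  have d1 := sq_specMeanExact_sub_le hn hw hf hs hb
  have d2 := specMean_le hn hw hf hs hb hA
  have d3 := specMean_nonneg (f := f) (s := s) (b := b) hw
  set m := specMeanExact n w f s b
  set c := specMean n w f s b
  set V : ℕ → Ω → ℝ := fun p ω => leadCoef n f s b (ξ · ω) (η · ω) p with hV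
  set R : ℕ → Ω → ℝ := fun p ω => restCoef n f b (η · ω) (ρ · ω) p with hR
  have hV4 : ∀ p, MemLp (V p) 4 μ := memLp_leadCoef h
  have hR4 : ∀ p, MemLp (R p) 4 μ := memLp_restCoef h hρ
  set QR : Ω → ℝ := fun ω => ∑ p ∈ Finset.range (n - 1), w p * R p ω ^ 2 with hQR
  set X : Ω → ℝ := fun ω => ∑ p ∈ Finset.range (n - 1), w p * V p ω ^ 2 - m with hX
  have hQR2 : MemLp QR 2 μ := memLp_sum_weight_sq w fun p _ => hR4 p
  have hX2 : MemLp X 2 μ := l1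
  have e : ∀ ω, specSum n w f (fun i => s i * ξ i ω + ρ i ω
      + (b (i + 1) * η (i + 1) ω - b i * η i ω))
      = ∑ p ∈ Finset.range (n - 1), w p * (V p ω + R p ω) ^ 2 := fun ω => by
    rw [specSum]
    refine Finset.sum_congr rfl fun p _ => ?_
    rw [sum_increment_eq n hn f s b (ξ · ω) (η · ω) (ρ · ω) p]
  simp_rw [e]
  have hpt : ∀ ω, (∑ p ∈ Finset.range (n - 1), w p * (V p ω + R p ω) ^ 2 - c) ^ 2
      ≤ 20 * X ω ^ 2 + (4 * (m - c) ^ 2 + 16 * m ^ 2 / Real.sqrt n)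
        + 12 * Real.sqrt n * QR ω ^ 2 := fun ω => by
    have e2 : ∑ p ∈ Finset.range (n - 1), w p * (V p ω + R p ω) ^ 2
        = ∑ p ∈ Finset.range (n - 1), w p * V p ω ^ 2
          + 2 * ∑ p ∈ Finset.range (n - 1), w p * (V p ω * R p ω) + QR ω := by
      simp only [hQR]
      rw [Finset.mul_sum, ← Finset.sum_add_distrib, ← Finset.sum_add_distrib]
      exact Finset.sum_congr rfl fun p _ => by ring
    rw [e2]
    refine sq_add_sub_le hr1 ?_ rfl
    exact Finset.sum_sq_le_sum_mul_sum_of_sq_le_mul _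
      (fun p _ => mul_nonneg (hw.nonneg p) (sq_nonneg _))
      (fun p _ => mul_nonneg (hw.nonneg p) (sq_nonneg _)) fun p _ => le_of_eq (by ring)
  refine ⟨(memLp_sum_weight_sq w fun p _ => (hV4 p).add (hR4 p)).sub (memLp_const _), ?_⟩
  have m2 : m ^ 2 ≤ 26000 * A ^ 2 + 2 * (82 * A) ^ 2 := by
    have a1 : 13000 * A ^ 2 / Real.sqrt n ≤ 13000 * A ^ 2 := div_le_self (by positivity) hr1
    have a2 : c ^ 2 ≤ (82 * A) ^ 2 := by gcongr
    nlinarith [sq_nonneg (m - c - c)]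
  have i1 : Integrable (fun ω => 20 * X ω ^ 2 + (4 * (m - c) ^ 2 + 16 * m ^ 2 / Real.sqrt n)) μ :=
    (hX2.integrable_sq.const_mul _).fun_add (integrable_const _)
  have i2 : Integrable (fun ω => 12 * Real.sqrt n * QR ω ^ 2) μ := hQR2.integrable_sq.const_mul _
  calc _ ≤ ∫ ω, (20 * X ω ^ 2 + (4 * (m - c) ^ 2 + 16 * m ^ 2 / Real.sqrt n)
        + 12 * Real.sqrt n * QR ω ^ 2) ∂μ :=
        integral_mono_of_nonneg (ae_of_all _ fun ω => sq_nonneg _) (i1.fun_add i2)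
          (ae_of_all _ hpt)
    _ = 20 * ∫ ω, X ω ^ 2 ∂μ + (4 * (m - c) ^ 2 + 16 * m ^ 2 / Real.sqrt n)
        + 12 * Real.sqrt n * ∫ ω, QR ω ^ 2 ∂μ := by
        rw [integral_add i1 i2, integral_add (hX2.integrable_sq.const_mul _) (integrable_const _),
          integral_const_mul, integral_const_mul]
        simp only [integral_const, probReal_univ, one_smul]
    _ ≤ 20 * ((8 + 2 * M) * (110000 * A ^ 2 / Real.sqrt n))
        + (4 * (13000 * A ^ 2 / Real.sqrt n)
          + 16 * (26000 * A ^ 2 + 2 * (82 * A) ^ 2) / Real.sqrt n)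
        + 12 * Real.sqrt n * ((512 * A + 16 * (8 + 2 * M) * 200 * A ^ 2 + 1600 * A ^ 2) / n) := by
        gcongr
    _ = _ := by
        have hk : ∀ x : ℝ, Real.sqrt n * (x / n) = x / Real.sqrt n := fun x => by
          rw [mul_div_assoc', div_eq_div_iff hn'.ne' hr.ne']
          linear_combination x * hrr
        rw [mul_assoc 12, hk]
        ring

end

/-! ### The two filters -/

/-- The diagonal of `filterTau n`. -/
noncomputable def weightTau (n p : ℕ) : ℝ :=
  if ⌊(n : ℝ) / Real.logb 2 n⌋₊ ≤ p + 1 then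
    ((n : ℝ) - (n : ℝ) / Real.logb 2 n)⁻¹ * (eigLam n (p + 1))⁻¹
  else 0

/-- The diagonal of `filterSigma n`. -/
noncomputable def weightSigma (n p : ℕ) : ℝ :=
  if ⌊Real.sqrt n⌋₊ + 1 ≤ p + 1 ∧ p + 1 ≤ 2 * ⌊Real.sqrt n⌋₊ then Real.sqrt n else 0

lemma dotProduct_dst_mul_diagonal (n k : ℕ) (w : ℕ → ℝ) (y : ℕ → ℝ) :
    diffVec n k y ⬝ᵥ ((dst n * Matrix.diagonal (fun i : Fin (n - 1) => w i) * (dst n)ᵀ)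
      *ᵥ diffVec n k y)
      = specSum n w (fun i => halfCos k ((i : ℝ) / n)) (fun i => y (i + 2) - y (i + 1)) := by
  rw [← Matrix.mulVec_mulVec, ← Matrix.mulVec_mulVec, Matrix.dotProduct_mulVec,
    ← Matrix.mulVec_transpose]
  set x := (dst n)ᵀ *ᵥ diffVec n k y with hx
  rw [specSum, Finset.sum_range]
  simp only [dotProduct, Matrix.mulVec_diagonal]
  refine Finset.sum_congr rfl fun p _ => ?_
  have : x p = ∑ i ∈ Finset.range (n - 1), (y (i + 2) - y (i + 1))
      * halfCos k (((i + 1 : ℕ) : ℝ) / n) * sinB n i p := by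
    rw [Finset.sum_range, hx, Matrix.mulVec, dotProduct]
    refine Finset.sum_congr rfl fun i _ => ?_
    simp only [Matrix.transpose_apply, dst, Matrix.of_apply, diffVec, sinB]
    push_cast
    ring
  rw [this]
  ring

lemma tHat_eq_specSum (n k : ℕ) (y : ℕ → ℝ) :
    tHat n k y = specSum n (weightTau n) (fun i => halfCos k ((i : ℝ) / n))
      (fun i => y (i + 2) - y (i + 1)) := by
  rw [← dotProduct_dst_mul_diagonal]; rfl

lemma sHat_eq_specSum (n k : ℕ) (y : ℕ → ℝ) :
    sHat n k y = specSum n (weightSigma n) (fun i => halfCos k ((i : ℝ) / n))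
      (fun i => y (i + 2) - y (i + 1)) - 7 * Real.pi ^ 2 / 3 * tHat n k y := by
  rw [← dotProduct_dst_mul_diagonal, sHat, mul_div_right_comm]; rfl

lemma sum_weightSigma_mul {n : ℕ} (h : 2 * ⌊Real.sqrt n⌋₊ ≤ n - 1) (g : ℕ → ℝ) :
    ∑ p ∈ Finset.range (n - 1), weightSigma n p * g p
      = Real.sqrt n * ∑ p ∈ Finset.Ico ⌊Real.sqrt n⌋₊ (2 * ⌊Real.sqrt n⌋₊), g p := by
  have : Finset.Ico ⌊Real.sqrt n⌋₊ (2 * ⌊Real.sqrt n⌋₊) = (Finset.range (n - 1)).filter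
      (fun p => ⌊Real.sqrt n⌋₊ + 1 ≤ p + 1 ∧ p + 1 ≤ 2 * ⌊Real.sqrt n⌋₊) := by
    ext p; simp only [Finset.mem_Ico, Finset.mem_filter, Finset.mem_range]; omega
  rw [this, Finset.sum_filter, Finset.mul_sum]
  refine Finset.sum_congr rfl fun p _ => ?_
  unfold weightSigma
  split_ifs <;> simp

/-- The leading coefficient 14/6 = 7/3 is the source of the constant 7π²/3 in the bias correction.
-/
lemma sum_Ico_sq (m : ℕ) :
    ∑ p ∈ Finset.Ico m (2 * m), ((p : ℝ) + 1) ^ 2 = (14 * (m : ℝ) ^ 3 + 9 * m ^ 2 + m) / 6 := by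
  have h : ∀ k : ℕ, ∑ p ∈ Finset.range k, ((p : ℝ) + 1) ^ 2
      = (k : ℝ) * (k + 1) * (2 * k + 1) / 6 := by
    intro k
    induction k with
    | zero => simp
    | succ k ih => rw [Finset.sum_range_succ, ih]; push_cast; ring
  rw [Finset.sum_Ico_eq_sub _ (by omega), h, h]
  push_cast; ring

lemma eigLam_le (n i : ℕ) : eigLam n i ≤ (i * Real.pi / n) ^ 2 := by
  have h : Real.sin (i * Real.pi / (2 * n)) ^ 2 ≤ (i * Real.pi / (2 * n)) ^ 2 := by
    have := Real.abs_sin_le_abs (x := i * Real.pi / (2 * n))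
    exact sq_le_sq.2 this
  unfold eigLam
  calc _ ≤ 4 * (i * Real.pi / (2 * n)) ^ 2 := by gcongr
    _ = _ := by ring

/-- Squaring sin y ≥ y - y³/6 shows that λ agrees with (iπ/n)² up to fourth order. -/
lemma le_eigLam_of_le {n i : ℕ} (h : i * Real.pi / (2 * n) ≤ 1) :
    (i * Real.pi / n) ^ 2 - 2 * (i * Real.pi / (2 * n)) ^ 4 ≤ eigLam n i := by
  set y := i * Real.pi / (2 * n) with hy
  have hy0 : 0 ≤ y := by have := Real.pi_pos; positivity
  have e : (i * Real.pi / n) ^ 2 = 4 * y ^ 2 := by rw [hy]; ring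
  rw [e, eigLam]
  rcases hy0.eq_or_lt with h0 | h0
  · rw [← h0]; simp only [ne_eq, OfNat.ofNat_ne_zero, not_false_eq_true, zero_pow]; simp; positivity
  have h1 := Real.sin_gt_sub_cube h0
  have h2 : 0 ≤ y - y ^ 3 / 6 := by
    nlinarith [mul_nonneg hy0 (sub_nonneg.2 (pow_le_one₀ (n := 2) hy0 h))]
  have h3 : (y - y ^ 3 / 6) ^ 2 ≤ Real.sin y ^ 2 := by gcongr
  change 4 * y ^ 2 - 2 * y ^ 4 ≤ 4 * Real.sin y ^ 2
  nlinarith [pow_nonneg hy0 6, pow_nonneg hy0 4]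

/-- Jordan's inequality sin y ≥ 2y/π on [0, π/2]; unlike the expansion at the origin it is valid up
to the highest frequency. -/
lemma four_mul_sq_div_le_eigLam {n i : ℕ} (h : i ≤ n) : 4 * ((i : ℝ) / n) ^ 2 ≤ eigLam n i := by
  rcases Nat.eq_zero_or_pos n with rfl | hn
  · simp [eigLam]
  have hn' : (0 : ℝ) < n := by exact_mod_cast hn
  have hin : (i : ℝ) ≤ n := by exact_mod_cast h
  have h1 := Real.mul_le_sin (x := i * Real.pi / (2 * n)) (by have := Real.pi_pos; positivity) (by
    rw [div_le_div_iff₀ (by positivity) two_pos]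
    nlinarith [Real.pi_pos])
  have e : 2 / Real.pi * (i * Real.pi / (2 * n)) = i / n := by
    have := Real.pi_ne_zero; field_simp
  rw [e] at h1
  unfold eigLam
  gcongr

/-- The sums of the weights converge at rate `n^{-1/4}`. -/
structure WeightLimits (n : ℕ) (w : ℕ → ℝ) (S E : ℝ) : Prop where
  sum : ((∑ p ∈ Finset.range (n - 1), w p) / n - S) ^ 2 ≤ 1 / Real.sqrt n
  sum_eig : (∑ p ∈ Finset.range (n - 1), w p * eigLam n (p + 1) - E) ^ 2 ≤ 10000 / Real.sqrt n

lemma two_mul_floor_sqrt_le {n : ℕ} (hn : 100 ≤ n) : 2 * ⌊Real.sqrt n⌋₊ ≤ n - 1 := by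
  have hn1 : (100 : ℝ) ≤ n := by exact_mod_cast hn
  have hn' : (0 : ℝ) < n := by linarith
  set r := Real.sqrt n with hr
  have hrr : r * r = n := Real.mul_self_sqrt hn'.le
  have hr4 : 10 ≤ r := by rw [hr]; exact Real.le_sqrt_of_sq_le (by linarith)
  have hr0 : 0 < r := by linarith
  set m := ⌊r⌋₊ with hm
  have hmr : (m : ℝ) ≤ r := Nat.floor_le hr0.le
  have hmr1 : r < m + 1 := Nat.lt_floor_add_one r
  have : (2 * m + 1 : ℝ) ≤ n := by nlinarith
  have : 2 * m + 1 ≤ n := by exact_mod_cast this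
  omega

/-- With λ_i ≤ (iπ/n)² and ⌊√n⌋ ≤ √n, the sum of squares has leading term (7/3) n^{3/2}; together
with the prefactor √n π²/n² this gives 7π²/3. The lower order terms cost at most 10π²/(6√n). -/
lemma sqrt_mul_sum_eigLam_le {n : ℕ} (hn : 100 ≤ n) :
    Real.sqrt n * ∑ p ∈ Finset.Ico ⌊Real.sqrt n⌋₊ (2 * ⌊Real.sqrt n⌋₊), eigLam n (p + 1)
      ≤ 7 * Real.pi ^ 2 / 3 + 90 / Real.sqrt n := by
  have hn1 : (100 : ℝ) ≤ n := by exact_mod_cast hn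
  have hn' : (0 : ℝ) < n := by linarith
  set r := Real.sqrt n with hr
  have hrr : r * r = n := Real.mul_self_sqrt hn'.le
  have hr4 : 10 ≤ r := by rw [hr]; exact Real.le_sqrt_of_sq_le (by linarith)
  have hr0 : 0 < r := by linarith
  set m := ⌊r⌋₊ with hm
  have hmr : (m : ℝ) ≤ r := Nat.floor_le hr0.le
  have hmr1 : r < m + 1 := Nat.lt_floor_add_one r
  have hpi : Real.pi < 3.15 := Real.pi_lt_d2
  have hpi0 := Real.pi_pos
  have hpi2 : Real.pi ^ 2 ≤ 10 := by nlinarith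
  have hE1 : ∑ p ∈ Finset.Ico m (2 * m), eigLam n (p + 1)
      ≤ Real.pi ^ 2 / n ^ 2 * ((14 * (m : ℝ) ^ 3 + 9 * m ^ 2 + m) / 6) := by
    rw [← sum_Ico_sq, Finset.mul_sum]
    refine Finset.sum_le_sum fun p _ => (eigLam_le _ _).trans (le_of_eq ?_)
    push_cast; ring
  have h1 : r * ∑ p ∈ Finset.Ico m (2 * m), eigLam n (p + 1) - 7 * Real.pi ^ 2 / 3 ≤ 90 / r := by
    have a : r * ∑ p ∈ Finset.Ico m (2 * m), eigLam n (p + 1)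
        ≤ r * (Real.pi ^ 2 / n ^ 2 * ((14 * (m : ℝ) ^ 3 + 9 * m ^ 2 + m) / 6)) := by gcongr
    have b : (14 * (m : ℝ) ^ 3 + 9 * m ^ 2 + m) / 6 ≤ (14 * r ^ 3 + 9 * r ^ 2 + r * r) / 6 := by
      have : (m : ℝ) ≤ r * r := by nlinarith
      gcongr
    have c : r * (Real.pi ^ 2 / n ^ 2 * ((14 * r ^ 3 + 9 * r ^ 2 + r * r) / 6))
        = 7 * Real.pi ^ 2 / 3 + Real.pi ^ 2 * (10 / 6) / r := by
      rw [← hrr]; field_simp; ring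
    have d : Real.pi ^ 2 * (10 / 6) / r ≤ 90 / r := by gcongr; linarith
    have : r * (Real.pi ^ 2 / n ^ 2 * ((14 * (m : ℝ) ^ 3 + 9 * m ^ 2 + m) / 6))
      ≤ r * (Real.pi ^ 2 / n ^ 2 * ((14 * r ^ 3 + 9 * r ^ 2 + r * r) / 6)) := by gcongr
    linarith
  linarith

lemma le_sqrt_mul_sum_eigLam {n : ℕ} (hn : 100 ≤ n) :
    7 * Real.pi ^ 2 / 3 - 90 / Real.sqrt n
      ≤ Real.sqrt n * ∑ p ∈ Finset.Ico ⌊Real.sqrt n⌋₊ (2 * ⌊Real.sqrt n⌋₊), eigLam n (p + 1) := by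
  have hn1 : (100 : ℝ) ≤ n := by exact_mod_cast hn
  have hn' : (0 : ℝ) < n := by linarith
  set r := Real.sqrt n with hr
  have hrr : r * r = n := Real.mul_self_sqrt hn'.le
  have hr4 : 10 ≤ r := by rw [hr]; exact Real.le_sqrt_of_sq_le (by linarith)
  have hr0 : 0 < r := by linarith
  set m := ⌊r⌋₊ with hm
  have hmr : (m : ℝ) ≤ r := Nat.floor_le hr0.le
  have hmr1 : r < m + 1 := Nat.lt_floor_add_one r
  have hpi : Real.pi < 3.15 := Real.pi_lt_d2
  have hpi0 := Real.pi_pos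
  have hpi2 : Real.pi ^ 2 ≤ 10 := by nlinarith
  have hy : ∀ p ∈ Finset.Ico m (2 * m), ((p + 1 : ℕ) : ℝ) * Real.pi / (2 * n) ≤ Real.pi / r := by
    intro p hp
    have : ((p + 1 : ℕ) : ℝ) ≤ 2 * m := by
      have := (Finset.mem_Ico.1 hp).2
      exact_mod_cast this
    rw [div_le_div_iff₀ (by positivity) hr0, ← hrr]
    have : ((p + 1 : ℕ) : ℝ) ≤ 2 * r := by linarith
    nlinarith [mul_le_mul_of_nonneg_left this (mul_pos hpi0 hr0).le]
  have hE2 : Real.pi ^ 2 / n ^ 2 * ((14 * (m : ℝ) ^ 3 + 9 * m ^ 2 + m) / 6)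
      - m * (2 * (Real.pi / r) ^ 4) ≤ ∑ p ∈ Finset.Ico m (2 * m), eigLam n (p + 1) := by
    have hc : (m : ℝ) * (2 * (Real.pi / r) ^ 4)
        = ∑ p ∈ Finset.Ico m (2 * m), 2 * (Real.pi / r) ^ 4 := by
      simp only [Finset.sum_const, Nat.card_Ico, nsmul_eq_mul]
      congr 2; omega
    rw [← sum_Ico_sq, Finset.mul_sum, hc, ← Finset.sum_sub_distrib]
    refine Finset.sum_le_sum fun p hp => le_trans ?_ (le_eigLam_of_le ((hy p hp).trans ?_))
    · have h1 := hy p hp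
      have h2 : (((p + 1 : ℕ) : ℝ) * Real.pi / (2 * n)) ^ 4 ≤ (Real.pi / r) ^ 4 := by gcongr
      have h3 : Real.pi ^ 2 / n ^ 2 * ((p : ℝ) + 1) ^ 2 = (((p + 1 : ℕ) : ℝ) * Real.pi / n) ^ 2 := by
        push_cast; ring
      rw [h3]; linarith
    · rw [div_le_one hr0]; linarith
  have h2 : -(90 / r) ≤ r * ∑ p ∈ Finset.Ico m (2 * m), eigLam n (p + 1)
      - 7 * Real.pi ^ 2 / 3 := by
    have a : r * (Real.pi ^ 2 / n ^ 2 * ((14 * (m : ℝ) ^ 3 + 9 * m ^ 2 + m) / 6)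
        - m * (2 * (Real.pi / r) ^ 4))
        ≤ r * ∑ p ∈ Finset.Ico m (2 * m), eigLam n (p + 1) := by gcongr
    -- Replacing ⌊r⌋ by r - 1 in the cubic term loses 3r², hence 42 = 14 · 3.
    have b : (14 * r ^ 3 - 42 * r ^ 2) / 6 ≤ (14 * (m : ℝ) ^ 3 + 9 * m ^ 2 + m) / 6 := by
      have h3 : r ^ 3 - 3 * r ^ 2 ≤ (m : ℝ) ^ 3 := by
        have h4 : (r - 1) ^ 3 ≤ (m : ℝ) ^ 3 := by
          have : 0 ≤ r - 1 := by linarith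
          have : r - 1 ≤ m := by linarith
          gcongr
        nlinarith
      have : (0 : ℝ) ≤ m := by positivity
      nlinarith
    have c : r * (Real.pi ^ 2 / n ^ 2 * ((14 * r ^ 3 - 42 * r ^ 2) / 6)
        - r * (2 * (Real.pi / r) ^ 4))
        = 7 * Real.pi ^ 2 / 3 - (7 * Real.pi ^ 2 + 2 * (Real.pi ^ 2) ^ 2 / r) / r := by
      rw [← hrr]; field_simp; ring
    have d : (7 * Real.pi ^ 2 + 2 * (Real.pi ^ 2) ^ 2 / r) / r ≤ 90 / r := by
      gcongr
      have : 2 * (Real.pi ^ 2) ^ 2 / r ≤ 2 * (Real.pi ^ 2) ^ 2 / 10 := by gcongr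
      nlinarith
    have f : r * (Real.pi ^ 2 / n ^ 2 * ((14 * r ^ 3 - 42 * r ^ 2) / 6)
        - r * (2 * (Real.pi / r) ^ 4)) ≤ r * (Real.pi ^ 2 / n ^ 2 *
          ((14 * (m : ℝ) ^ 3 + 9 * m ^ 2 + m) / 6) - m * (2 * (Real.pi / r) ^ 4)) := by gcongr
    linarith
  linarith

/-- About √n weights of height √n near frequency √n: their total is about n, and each λ there is at
most 4π²/n ≤ 40/n, which is where the constant 40 comes from. -/
lemma weightSigma_spec {n : ℕ} (hn : 100 ≤ n) :
    IsGoodWeight n (weightSigma n) ∧ WeightLimits n (weightSigma n) 1 (7 * Real.pi ^ 2 / 3) := by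
  have hn1 : (100 : ℝ) ≤ n := by exact_mod_cast hn
  have hn' : (0 : ℝ) < n := by linarith
  set r := Real.sqrt n with hr
  have hrr : r * r = n := Real.mul_self_sqrt hn'.le
  have hr4 : 10 ≤ r := by rw [hr]; exact Real.le_sqrt_of_sq_le (by linarith)
  have hr0 : 0 < r := by linarith
  set m := ⌊r⌋₊ with hm
  have hmr : (m : ℝ) ≤ r := Nat.floor_le hr0.le
  have hmr1 : r < m + 1 := Nat.lt_floor_add_one r
  have hm2 : 2 * m ≤ n - 1 := two_mul_floor_sqrt_le hn
  have hpi : Real.pi < 3.15 := Real.pi_lt_d2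
  have hpi0 := Real.pi_pos
  have hpi2 : Real.pi ^ 2 ≤ 10 := by nlinarith
  have S : ∑ p ∈ Finset.range (n - 1), weightSigma n p = r * m := by
    have := sum_weightSigma_mul hm2 (fun _ => 1)
    simp only [mul_one, ← hr, ← hm] at this
    rw [this]; simp only [Finset.sum_const, Nat.card_Ico, nsmul_eq_mul, mul_one]
    congr 2; omega
  have E := sum_weightSigma_mul hm2 (fun p => eigLam n (p + 1))
  rw [← hr, ← hm] at E
  have hlim : WeightLimits n (weightSigma n) 1 (7 * Real.pi ^ 2 / 3) := by
    constructor
    · rw [S, ← hr, ← hrr]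
      have e : r * m / (r * r) - 1 = (m - r) / r := by field_simp
      rw [e, div_pow, div_le_div_iff₀ (by positivity) hr0]
      have : ((m : ℝ) - r) ^ 2 ≤ 1 := by nlinarith
      nlinarith
    · rw [E, ← hr]
      have h1 := sqrt_mul_sum_eigLam_le hn
      have h2 := le_sqrt_mul_sum_eigLam hn
      rw [← hr, ← hm] at h1 h2
      have h3 : (r * ∑ p ∈ Finset.Ico m (2 * m), eigLam n (p + 1) - 7 * Real.pi ^ 2 / 3) ^ 2
          ≤ (90 / r) ^ 2 :=
        sq_le_sq' (by linarith) (by linarith)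
      refine h3.trans ?_
      rw [div_pow, div_le_div_iff₀ (by positivity) hr0]
      nlinarith
  have heig : ∀ p ∈ Finset.range (n - 1), weightSigma n p * eigLam n (p + 1) ≤ 40 / r := by
    intro p _
    unfold weightSigma
    split_ifs with h
    · have h1 : ((p + 1 : ℕ) : ℝ) ≤ 2 * r := by
        have h2 : ((p + 1 : ℕ) : ℝ) ≤ 2 * m := by exact_mod_cast h.2
        linarith
      calc r * eigLam n (p + 1) ≤ r * (2 * r * Real.pi / n) ^ 2 := by
            refine mul_le_mul_of_nonneg_left ((eigLam_le _ _).trans ?_) hr0.le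
            gcongr
        _ = 4 * Real.pi ^ 2 / r := by rw [← hrr]; field_simp; ring
        _ ≤ 40 / r := by gcongr; linarith
    · rw [zero_mul]; positivity
  refine ⟨⟨fun p => ?_, fun p _ => ?_, ?_, heig, ?_⟩, hlim⟩
  · unfold weightSigma; split_ifs <;> positivity
  · unfold weightSigma; split_ifs
    · exact le_rfl
    · positivity
  · rw [S, ← hrr]; gcongr
  · rw [E]
    have h5 : ∑ p ∈ Finset.Ico m (2 * m), eigLam n (p + 1) ≤ m * (40 / (r * r)) := by
      have hc : (m : ℝ) * (40 / (r * r)) = ∑ p ∈ Finset.Ico m (2 * m), 40 / (r * r) := by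
        simp only [Finset.sum_const, Nat.card_Ico, nsmul_eq_mul]
        congr 2; omega
      rw [hc]
      refine Finset.sum_le_sum fun p hp => ?_
      have hp' := Finset.mem_Ico.1 hp
      have := heig p (Finset.mem_range.2 (by omega))
      unfold weightSigma at this
      rw [← hr, ← hm, if_pos (by omega)] at this
      rw [← div_div, le_div_iff₀' hr0]
      exact this
    calc r * ∑ p ∈ Finset.Ico m (2 * m), eigLam n (p + 1) ≤ r * (r * (40 / (r * r))) := by
          refine mul_le_mul_of_nonneg_left (h5.trans ?_) hr0.le
          gcongr
      _ = 40 := by field_simp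

/-- On its range wλ is the constant (n - n/l)^{-1}, with l the binary logarithm of n, so Σ wλ = 1 +
O(1/n), the error being the rounding of n/l. On that range λ ≥ l^{-2}, hence w ≤ 2l²/n and Σ w ≤
2l²: the signal contributes at most 2l²/n, and the growth hypothesis on l makes this at most
n^{-1/4}. -/
lemma weightTau_spec {n : ℕ} (hl2 : 2 ≤ Real.logb 2 n)
    (hl : 2 * Real.logb 2 n ^ 2 ≤ (n : ℝ) ^ (3 / 4 : ℝ)) (hn : 16 ≤ n) :
    IsGoodWeight n (weightTau n) ∧ WeightLimits n (weightTau n) 0 1 := by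
  have hn1 : (16 : ℝ) ≤ n := by exact_mod_cast hn
  have hn' : (0 : ℝ) < n := by linarith
  set l := Real.logb 2 n with hldef
  set x := (n : ℝ) / l with hx
  have hl0 : 0 < l := by linarith
  have hr1 : 1 ≤ Real.sqrt n := Real.one_le_sqrt.2 (by linarith)
  have hr0 : 0 < Real.sqrt n := by linarith
  have hrr : Real.sqrt n * Real.sqrt n = n := Real.mul_self_sqrt hn'.le
  have h34 : (n : ℝ) ^ (3 / 4 : ℝ) ≤ n := by
    calc (n : ℝ) ^ (3 / 4 : ℝ) ≤ (n : ℝ) ^ (1 : ℝ) :=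
          Real.rpow_le_rpow_of_exponent_le (by linarith) (by norm_num)
      _ = n := Real.rpow_one _
  have hln : 2 * l ^ 2 ≤ n := hl.trans h34
  have hx2 : x ≤ n / 2 := by rw [hx]; gcongr
  have hx1 : 2 ≤ x := by rw [hx, le_div_iff₀ hl0]; nlinarith
  set q := ⌊x⌋₊ with hq
  have hqx : (q : ℝ) ≤ x := Nat.floor_le (by linarith)
  have hqx1 : x < q + 1 := Nat.lt_floor_add_one x
  have hq1 : 1 ≤ q := Nat.le_floor (by norm_num; linarith)
  have hqn : q ≤ n := by
    have : (q : ℝ) ≤ n := by linarith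
    exact_mod_cast this
  have hnx : n / 2 ≤ n - x := by linarith
  have hnx0 : 0 < n - x := by linarith
  have heig : ∀ p ∈ Finset.range (n - 1), weightTau n p * eigLam n (p + 1)
      = if q ≤ p + 1 then (n - x)⁻¹ else 0 := by
    intro p hp
    rw [Finset.mem_range] at hp
    have hpos : 0 < eigLam n (p + 1) := lt_of_lt_of_le (by positivity)
      (four_mul_sq_div_le_eigLam (n := n) (i := p + 1) (by omega))
    unfold weightTau
    split_ifs
    · exact inv_mul_cancel_right₀ hpos.ne' _
    · simp
  have hinv : (n - x)⁻¹ ≤ 2 / n := by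
    rw [inv_le_comm₀ hnx0 (by positivity), inv_div]; exact hnx
  have hE : ∑ p ∈ Finset.range (n - 1), weightTau n p * eigLam n (p + 1)
      = (n - q) * (n - x)⁻¹ := by
    rw [Finset.sum_congr rfl heig, ← Finset.sum_filter]
    have : (Finset.range (n - 1)).filter (fun p => q ≤ p + 1) = Finset.Ico (q - 1) (n - 1) := by
      ext p; simp only [Finset.mem_Ico, Finset.mem_filter, Finset.mem_range]; omega
    rw [this]
    simp only [Finset.sum_const, Nat.card_Ico, nsmul_eq_mul]
    rw [show n - 1 - (q - 1) = n - q by omega, Nat.cast_sub hqn]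
  have hE1 : ∑ p ∈ Finset.range (n - 1), weightTau n p * eigLam n (p + 1) - 1
      = (x - q) * (n - x)⁻¹ := by
    rw [hE]; field_simp; ring
  have hE2 : 0 ≤ (x - q) * (n - x)⁻¹ := mul_nonneg (by linarith) (by positivity)
  have hE3 : (x - q) * (n - x)⁻¹ ≤ 1 * (2 / n) :=
    mul_le_mul (by linarith) hinv (by positivity) zero_le_one
  have h2n : 2 / (n : ℝ) ≤ 1 := by rw [div_le_one hn']; linarith
  have hw : ∀ p ∈ Finset.range (n - 1), weightTau n p ≤ 2 * l ^ 2 / n := by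
    intro p hp
    rw [Finset.mem_range] at hp
    unfold weightTau
    split_ifs with h
    -- The rounding ⌊x⌋ > x - 1 costs at most half of x, as x ≥ 2.
    · have h1 : x / 2 ≤ ((p + 1 : ℕ) : ℝ) := by
        have : (q : ℝ) ≤ ((p + 1 : ℕ) : ℝ) := by exact_mod_cast h
        linarith
      have h2 : (l ^ 2)⁻¹ ≤ eigLam n (p + 1) := by
        refine le_trans ?_ (four_mul_sq_div_le_eigLam (n := n) (i := p + 1) (by omega))
        calc (l ^ 2)⁻¹ = 4 * ((x / 2) / n) ^ 2 := by rw [hx]; field_simp; norm_num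
          _ ≤ _ := by gcongr
      have h3 : (eigLam n (p + 1))⁻¹ ≤ l ^ 2 := inv_le_of_inv_le₀ (by positivity) h2
      calc _ ≤ 2 / n * l ^ 2 := mul_le_mul hinv h3 (inv_nonneg.2 (eigLam_nonneg _ _))
            (by positivity)
        _ = _ := by ring
    · positivity
  have hw0 : ∀ p, 0 ≤ weightTau n p := fun p => by
    unfold weightTau
    split_ifs
    · exact mul_nonneg (inv_nonneg.2 hnx0.le) (inv_nonneg.2 (eigLam_nonneg _ _))
    · exact le_rfl
  have hS : ∑ p ∈ Finset.range (n - 1), weightTau n p ≤ 2 * l ^ 2 := by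
    calc _ ≤ ∑ p ∈ Finset.range (n - 1), 2 * l ^ 2 / n := Finset.sum_le_sum hw
      _ ≤ n * (2 * l ^ 2 / n) := by
          simp only [Finset.sum_const, Finset.card_range, nsmul_eq_mul]
          gcongr; omega
      _ = _ := by field_simp
  have hS0 : 0 ≤ ∑ p ∈ Finset.range (n - 1), weightTau n p := Finset.sum_nonneg fun p _ => hw0 p
  have h2r : 2 / (n : ℝ) ≤ 40 / Real.sqrt n := by
    rw [div_le_div_iff₀ hn' hr0]; nlinarith
  refine ⟨⟨hw0, fun p hp => ?_, hS.trans hln, fun p hp => ?_, ?_⟩, ⟨?_, ?_⟩⟩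
  · refine (hw p hp).trans (le_trans ?_ hr1)
    rw [div_le_one hn']; exact hln
  · rw [heig p hp]
    split_ifs
    · exact hinv.trans h2r
    · positivity
  · linarith
  · rw [sub_zero, div_pow]
    have h1 : (∑ p ∈ Finset.range (n - 1), weightTau n p) ^ 2 ≤ ((n : ℝ) ^ (3 / 4 : ℝ)) ^ 2 := by
      gcongr; exact hS.trans hl
    have h2 : ((n : ℝ) ^ (3 / 4 : ℝ)) ^ 2 = n * Real.sqrt n := by
      rw [← Real.rpow_natCast, ← Real.rpow_mul hn'.le, Real.sqrt_eq_rpow, ← Real.rpow_one_add' hn'.le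
        (by norm_num)]
      norm_num
    rw [h2] at h1
    rw [div_le_div_iff₀ (by positivity) hr0, one_mul]
    calc _ ≤ (n * Real.sqrt n) * Real.sqrt n := by gcongr
      _ = (n : ℝ) ^ 2 := by rw [mul_assoc, hrr]; ring
  · rw [hE1]
    have h1 : ((x - q) * (n - x)⁻¹) ^ 2 ≤ (1 * (2 / n)) ^ 2 := by gcongr
    refine h1.trans ?_
    rw [one_mul]
    calc (2 / (n : ℝ)) ^ 2 ≤ 2 / n := by rw [pow_two]; exact mul_le_of_le_one_right (by positivity) h2n
      _ ≤ 40 / Real.sqrt n := h2r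
      _ ≤ _ := by gcongr; norm_num

lemma eventually_weight_spec : ∀ᶠ n : ℕ in atTop,
    (IsGoodWeight n (weightSigma n) ∧ WeightLimits n (weightSigma n) 1 (7 * Real.pi ^ 2 / 3)) ∧
      (IsGoodWeight n (weightTau n) ∧ WeightLimits n (weightTau n) 0 1) := by
  have h1 : ∀ᶠ n : ℕ in atTop, 2 * Real.logb 2 n ^ 2 ≤ (n : ℝ) ^ (3 / 4 : ℝ) := by
    -- The logarithm is compared with n^{3/8}, whose square is the required n^{3/4}.
    have h := (isLittleO_log_rpow_atTop (r := 3 / 8) (by norm_num)).bound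
      (c := Real.log 2 / 2) (by positivity)
    have h' := tendsto_natCast_atTop_atTop (R := ℝ) |>.eventually h
    filter_upwards [h', eventually_ge_atTop 1] with n hn hn1
    have hn1' : (1 : ℝ) ≤ n := by exact_mod_cast hn1
    have hl0 : 0 ≤ Real.log n := Real.log_nonneg hn1'
    rw [Real.norm_of_nonneg hl0, Real.norm_of_nonneg (by positivity)] at hn
    have h2 : Real.logb 2 n ≤ (n : ℝ) ^ (3 / 8 : ℝ) / 2 := by
      rw [Real.logb, div_le_iff₀ (by positivity)]
      linarith
    have h3 : 0 ≤ Real.logb 2 n := div_nonneg hl0 (Real.log_nonneg (by norm_num))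
    have h4 : (n : ℝ) ^ (3 / 4 : ℝ) = ((n : ℝ) ^ (3 / 8 : ℝ)) ^ 2 := by
      rw [← Real.rpow_natCast, ← Real.rpow_mul (by positivity)]; norm_num
    rw [h4]
    have : Real.logb 2 n ^ 2 ≤ ((n : ℝ) ^ (3 / 8 : ℝ) / 2) ^ 2 := by gcongr
    nlinarith [sq_nonneg ((n : ℝ) ^ (3 / 8 : ℝ))]
  have h2 : ∀ᶠ n : ℕ in atTop, 2 ≤ Real.logb 2 n :=
    ((Real.tendsto_logb_atTop (by norm_num)).comp tendsto_natCast_atTop_atTop).eventually_ge_atTop 2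
  filter_upwards [h1, h2, eventually_ge_atTop 100] with n a b c
  exact ⟨weightSigma_spec c, weightTau_spec b a (by omega)⟩

/-! ### Mean squared error of the Fourier coefficients -/

lemma cosBasis_sq (k : ℕ) (t : ℝ) :
    cosBasis k t ^ 2 = if k = 0 then 1 else 1 + Real.cos (2 * (k * Real.pi * t)) := by
  unfold cosBasis
  split_ifs
  · norm_num
  · rw [mul_pow, Real.sq_sqrt (by norm_num), Real.cos_two_mul]; ring

lemma halfCos_sq (k : ℕ) (x : ℝ) :
    halfCos k x ^ 2 = if k = 0 then 1 else 1 + Real.cos (k * Real.pi * x) := by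
  rw [halfCos, cosBasis_sq, show 2 * ((k : ℝ) * Real.pi * (x / 2)) = k * Real.pi * x by ring]

lemma halfCos_sq_le (k : ℕ) (x : ℝ) : halfCos k x ^ 2 ≤ 2 := by
  rw [halfCos_sq]
  split_ifs
  · norm_num
  · linarith [Real.cos_le_one (k * Real.pi * x)]

/-- A step of length 1/n changes f_k by at most a multiple of k/n, and k² ≤ √n. The restriction k⁴ ≤
n makes the variation of f_k harmless here. -/
lemma sq_halfCos_sub_le {n k : ℕ} (hn : 0 < n) (hk : (k : ℝ) ^ 4 ≤ n) (x : ℝ) :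
    (halfCos k (x / n) - halfCos k ((x + 1) / n)) ^ 2 ≤ 5 / (n * Real.sqrt n) := by
  have hn' : (0 : ℝ) < n := by exact_mod_cast hn
  have hr : 0 < Real.sqrt n := Real.sqrt_pos.2 hn'
  have hrr : Real.sqrt n * Real.sqrt n = n := Real.mul_self_sqrt hn'.le
  unfold halfCos cosBasis
  split_ifs with h
  · simp; positivity
  have hk2 : (k : ℝ) ^ 2 ≤ Real.sqrt n := Real.le_sqrt_of_sq_le (by rw [← pow_mul]; exact hk)
  have hpi : Real.pi < 3.15 := Real.pi_lt_d2
  have hpi2 : Real.pi ^ 2 ≤ 10 := by nlinarith [Real.pi_pos]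
  have hl : (Real.cos (k * Real.pi * (x / n / 2)) - Real.cos (k * Real.pi * ((x + 1) / n / 2))) ^ 2
      ≤ (k * Real.pi / (2 * n)) ^ 2 := by
    rw [sq_le_sq]
    have := Real.abs_cos_sub_cos_le (k * Real.pi * (x / n / 2)) (k * Real.pi * ((x + 1) / n / 2))
    refine this.trans (le_of_eq ?_)
    rw [show (k : ℝ) * Real.pi * (x / n / 2) - k * Real.pi * ((x + 1) / n / 2)
      = -(k * Real.pi / (2 * n)) by field_simp; ring, abs_neg]
  rw [← mul_sub, mul_pow, Real.sq_sqrt (by norm_num)]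
  calc _ ≤ 2 * (k * Real.pi / (2 * n)) ^ 2 := by gcongr
    _ = (k : ℝ) ^ 2 * Real.pi ^ 2 / (2 * n ^ 2) := by ring
    _ ≤ Real.sqrt n * 10 / (2 * n ^ 2) := by gcongr
    _ = 5 / (n * Real.sqrt n) := by
        rw [div_eq_div_iff (by positivity) (by positivity)]
        linear_combination 10 * n * hrr

/-- The increments of `y` are `s i ξ i + b (i+1) η (i+1) - b i η i` with white `ξ, η`, up to a
remainder of order `1 / n` in `L⁴`. -/
def HasNoisyIncrements {Ω : Type*} [MeasurableSpace Ω] (μ : Measure Ω) (M A : ℝ) (n : ℕ)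
    (y : ℕ → Ω → ℝ) (s b : ℕ → ℝ) : Prop :=
  ∃ ξ η ρ : ℕ → Ω → ℝ,
    IsWhite μ M (Sum.elim (fun i : Fin (n - 1) => ξ i) (fun j : Fin n => η j)) ∧
    (∀ i ∈ Finset.range (n - 1), MemLp (ρ i) 4 μ) ∧
    (∀ i ∈ Finset.range (n - 1), ∫ ω, ρ i ω ^ 4 ∂μ ≤ A / n ^ 4) ∧
    ∀ i ∈ Finset.range (n - 1), (fun ω => y (i + 2) ω - y (i + 1) ω)
      =ᵐ[μ] fun ω => s i * ξ i ω + ρ i ω + (b (i + 1) * η (i + 1) ω - b i * η i ω)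

lemma specSum_congr {n : ℕ} {w f z z' : ℕ → ℝ} (h : ∀ i ∈ Finset.range (n - 1), z i = z' i) :
    specSum n w f z = specSum n w f z' := by
  unfold specSum
  refine Finset.sum_congr rfl fun p _ => ?_
  rw [Finset.sum_congr rfl fun i hi => by rw [h i hi]]

/-- The noise averages enter with factor E_S - c E_T, which tends to c - c · 1 = 0, and the signal
with factor Σ w_S/n - c Σ w_T/n, which tends to 1. The four terms correspond to the four weight
limits. The bound 600 is a numerical bound for (7π²/3)². -/
lemma sq_specMean_combination_le {n : ℕ} {wS wT f s b : ℕ → ℝ} {A c : ℝ} (hn : 0 < n) (hA : 0 ≤ A)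
    (hc : c ^ 2 ≤ 600) (hf : ∀ i, f i ^ 2 ≤ 2)
    (hs : ∀ i ∈ Finset.range (n - 1), s i ^ 2 ≤ A / n) (hb : ∀ j ∈ Finset.range n, b j ^ 2 ≤ A)
    (hS : WeightLimits n wS 1 c) (hT : WeightLimits n wT 0 1) :
    (specMean n wS f s b - c * specMean n wT f s b
        - ∑ i ∈ Finset.range (n - 1), s i ^ 2 * f (i + 1) ^ 2) ^ 2
      ≤ 160000000 * A ^ 2 / Real.sqrt n := by
  have hn' : (0 : ℝ) < n := by exact_mod_cast hn
  have hr : 0 < Real.sqrt n := Real.sqrt_pos.2 hn'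
  obtain ⟨s1, s2⟩ := hS
  obtain ⟨t1, t2⟩ := hT
  rw [sub_zero] at t1
  have u1 := sum_signal_le hn hf hs hA
  have u2 := sum_noise_le hf hb
  have u10 : 0 ≤ ∑ i ∈ Finset.range (n - 1), s i ^ 2 * f (i + 1) ^ 2 :=
    Finset.sum_nonneg fun _ _ => by positivity
  have u20 : 0 ≤ ∑ j ∈ Finset.range n, b j ^ 2 * f (j + 1) ^ 2 :=
    Finset.sum_nonneg fun _ _ => by positivity
  unfold specMean
  set σ := ∑ i ∈ Finset.range (n - 1), s i ^ 2 * f (i + 1) ^ 2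
  set τ := ∑ j ∈ Finset.range n, b j ^ 2 * f (j + 1) ^ 2
  set Ss := ∑ p ∈ Finset.range (n - 1), wS p
  set St := ∑ p ∈ Finset.range (n - 1), wT p
  set Es := ∑ p ∈ Finset.range (n - 1), wS p * eigLam n (p + 1)
  set Et := ∑ p ∈ Finset.range (n - 1), wT p * eigLam n (p + 1)
  have hτ0 : 0 ≤ τ / n := by positivity
  have hτ : τ / n ≤ 2 * A := by rw [div_le_iff₀' hn']; exact u2
  have e : Ss / n * σ + Es / n * τ - c * (St / n * σ + Et / n * τ) - σ
      = (Ss / n - 1) * σ + (Es - c) * (τ / n) - c * (Et - 1) * (τ / n) - c * (St / n) * σ := by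
    field_simp; ring
  rw [e]
  have hσ2 : σ ^ 2 ≤ (2 * A) ^ 2 := by gcongr
  have hτ2 : (τ / n) ^ 2 ≤ (2 * A) ^ 2 := by gcongr
  have k1 : ((Ss / n - 1) * σ) ^ 2 ≤ 1 / Real.sqrt n * (2 * A) ^ 2 := by
    rw [mul_pow]; gcongr
  have k2 : ((Es - c) * (τ / n)) ^ 2 ≤ 10000 / Real.sqrt n * (2 * A) ^ 2 := by
    rw [mul_pow]; gcongr
  have k3 : (c * (Et - 1) * (τ / n)) ^ 2 ≤ 600 * (10000 / Real.sqrt n) * (2 * A) ^ 2 := by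
    rw [mul_pow, mul_pow]; gcongr
  have k4 : (c * (St / n) * σ) ^ 2 ≤ 600 * (1 / Real.sqrt n) * (2 * A) ^ 2 := by
    rw [mul_pow, mul_pow]; gcongr
  have k5 : ∀ x y z w : ℝ, (x + y - z - w) ^ 2 ≤ 4 * (x ^ 2 + y ^ 2 + z ^ 2 + w ^ 2) :=
    fun x y z w => by
      nlinarith [sq_nonneg (x - y), sq_nonneg (x + z), sq_nonneg (x + w), sq_nonneg (y + z),
        sq_nonneg (y + w), sq_nonneg (z - w)]
  refine (k5 _ _ _ _).trans ?_
  have k6 : (0 : ℝ) ≤ A ^ 2 / Real.sqrt n := by positivity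
  have r1 : 1 / Real.sqrt n * (2 * A) ^ 2 = 4 * (A ^ 2 / Real.sqrt n) := by ring
  have r2 : 10000 / Real.sqrt n * (2 * A) ^ 2 = 40000 * (A ^ 2 / Real.sqrt n) := by ring
  have r3 : 600 * (10000 / Real.sqrt n) * (2 * A) ^ 2 = 24000000 * (A ^ 2 / Real.sqrt n) := by ring
  have r4 : 600 * (1 / Real.sqrt n) * (2 * A) ^ 2 = 2400 * (A ^ 2 / Real.sqrt n) := by ring
  rw [mul_div_assoc]
  linarith

/-- K and the threshold for n depend only on M and A and not on k, y, s, b; this uniformity is what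
permits the supremum over the classes and N growing with n. -/
lemma eventually_integral_sq_sHat_sub_le {Ω : Type*} [MeasurableSpace Ω] (μ : Measure Ω)
    [IsProbabilityMeasure μ] {M A : ℝ} (hM : 0 ≤ M) (hA : 0 ≤ A) :
    ∃ K : ℝ, 0 ≤ K ∧ ∀ᶠ n : ℕ in atTop, ∀ (k : ℕ) (y : ℕ → Ω → ℝ) (s b : ℕ → ℝ),
      (k : ℝ) ^ 4 ≤ n → HasNoisyIncrements μ M A n y s b →
      (∀ i ∈ Finset.range (n - 1), s i ^ 2 ≤ A / n) → (∀ j ∈ Finset.range n, b j ^ 2 ≤ A) →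
      MemLp (fun ω => sHat n k (fun i => y i ω)
        - ∑ i ∈ Finset.range (n - 1), s i ^ 2 * halfCos k ((i + 1 : ℕ) / n) ^ 2) 2 μ ∧
      ∫ ω, (sHat n k (fun i => y i ω)
        - ∑ i ∈ Finset.range (n - 1), s i ^ 2 * halfCos k ((i + 1 : ℕ) / n) ^ 2) ^ 2 ∂μ
        ≤ K / Real.sqrt n := by
  set K₀ := 20 * ((8 + 2 * M) * (110000 * A ^ 2)) + (4 * (13000 * A ^ 2)
          + 16 * (26000 * A ^ 2 + 2 * (82 * A) ^ 2))
        + 12 * (512 * A + 16 * (8 + 2 * M) * 200 * A ^ 2 + 1600 * A ^ 2) with hK₀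
  have hK₀0 : 0 ≤ K₀ := by positivity
  refine ⟨3 * K₀ + 3 * (600 * K₀) + 3 * (160000000 * A ^ 2), by positivity, ?_⟩
  filter_upwards [eventually_weight_spec, eventually_ge_atTop 1] with n hw hn k y s b hk hy hs hb
  obtain ⟨⟨gS, lS⟩, ⟨gT, lT⟩⟩ := hw
  obtain ⟨ξ, η, ρ, hwhite, hρ, hρ4, hyz⟩ := hy
  set f : ℕ → ℝ := fun i => halfCos k ((i : ℝ) / n) with hf
  have hf2 : ∀ i, f i ^ 2 ≤ 2 := fun i => halfCos_sq_le _ _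
  have hfd : ∀ i, (f (i + 1) - f (i + 2)) ^ 2 ≤ 5 / (n * Real.sqrt n) := fun i => by
    have := sq_halfCos_sub_le hn hk ((i + 1 : ℕ) : ℝ)
    simp only [hf]
    convert this using 4
    push_cast; ring
  obtain ⟨a1, a2⟩ := integral_sq_specSum_sub_le hn hM hA gS hf2 hfd hs hb hwhite hρ hρ4
  obtain ⟨b1, b2⟩ := integral_sq_specSum_sub_le hn hM hA gT hf2 hfd hs hb hwhite hρ hρ4
  rw [← hK₀] at a2 b2
  set c := 7 * Real.pi ^ 2 / 3 with hc
  have hpi : Real.pi < 3.15 := Real.pi_lt_d2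
  have hpi2 : Real.pi ^ 2 ≤ 10 := by nlinarith [Real.pi_pos]
  have hc2 : c ^ 2 ≤ 600 := by
    have h1 : c ≤ 70 / 3 := by rw [hc]; linarith
    have h0 : 0 ≤ c := by rw [hc]; positivity
    nlinarith
  have d := sq_specMean_combination_le hn hA hc2 hf2 hs hb lS lT
  set z : Ω → ℕ → ℝ := fun ω i => s i * ξ i ω + ρ i ω + (b (i + 1) * η (i + 1) ω - b i * η i ω)
    with hz
  set U : Ω → ℝ := fun ω => specSum n (weightSigma n) f (z ω) - specMean n (weightSigma n) f s b
    with hU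
  set V : Ω → ℝ := fun ω => specSum n (weightTau n) f (z ω) - specMean n (weightTau n) f s b
    with hV
  set δ := specMean n (weightSigma n) f s b - c * specMean n (weightTau n) f s b
        - ∑ i ∈ Finset.range (n - 1), s i ^ 2 * f (i + 1) ^ 2 with hδ
  have hae : (fun ω => U ω - c * V ω + δ) =ᵐ[μ] fun ω => sHat n k (fun i => y i ω)
        - ∑ i ∈ Finset.range (n - 1), s i ^ 2 * halfCos k ((i + 1 : ℕ) / n) ^ 2 := by
    have : ∀ᵐ ω ∂μ, ∀ i : Finset.range (n - 1), y (i + 2) ω - y (i + 1) ω = z ω i :=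
      ae_all_iff.2 fun i => hyz i i.2
    filter_upwards [this] with ω hω
    have hω' : ∀ i ∈ Finset.range (n - 1), z ω i = y (i + 2) ω - y (i + 1) ω :=
      fun i hi => (hω ⟨i, hi⟩).symm
    rw [sHat_eq_specSum, tHat_eq_specSum]
    simp only [hU, hV, hδ]
    rw [specSum_congr hω', specSum_congr hω']
    ring
  have hU2 : MemLp U 2 μ := a1
  have hV2 : MemLp V 2 μ := b1
  have hmem : MemLp (fun ω => U ω - c * V ω + δ) 2 μ :=
    (hU2.sub (hV2.const_mul c)).add (memLp_const δ)
  refine ⟨hmem.ae_eq hae, ?_⟩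
  have i1 : Integrable (fun ω => 3 * U ω ^ 2 + 3 * c ^ 2 * V ω ^ 2) μ :=
    (hU2.integrable_sq.const_mul _).fun_add (hV2.integrable_sq.const_mul _)
  calc _ = ∫ ω, (U ω - c * V ω + δ) ^ 2 ∂μ :=
        integral_congr_ae (hae.symm.mono fun ω hω => by simp only [hω])
    _ ≤ ∫ ω, (3 * U ω ^ 2 + 3 * c ^ 2 * V ω ^ 2 + 3 * δ ^ 2) ∂μ := by
        refine integral_mono_of_nonneg (ae_of_all _ fun ω => sq_nonneg _)
          (i1.fun_add (integrable_const _)) (ae_of_all _ fun ω => ?_)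
        dsimp only
        nlinarith [sq_nonneg (U ω + c * V ω), sq_nonneg (U ω - δ), sq_nonneg (c * V ω + δ)]
    _ = 3 * ∫ ω, U ω ^ 2 ∂μ + 3 * c ^ 2 * ∫ ω, V ω ^ 2 ∂μ + 3 * δ ^ 2 := by
        rw [integral_add i1 (integrable_const _),
          integral_add (hU2.integrable_sq.const_mul _) (hV2.integrable_sq.const_mul _),
          integral_const_mul, integral_const_mul]
        simp only [integral_const, probReal_univ, one_smul]
    _ ≤ 3 * (K₀ / Real.sqrt n) + 3 * 600 * (K₀ / Real.sqrt n)
        + 3 * (160000000 * A ^ 2 / Real.sqrt n) := by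
        gcongr
    _ = _ := by ring

/-! ### Wiener integrals -/

lemma MeasureTheory.Lp.coeFn_sum_smul {α ι : Type*} [MeasurableSpace α] {μ : Measure α}
    (s : Finset ι) (c : ι → ℝ) (f : ι → Lp ℝ 2 μ) :
    ⇑(∑ i ∈ s, c i • f i) =ᵐ[μ] fun x => ∑ i ∈ s, c i * f i x := by
  classical
  induction s using Finset.induction_on with
  | empty =>
    simp only [Finset.sum_empty]
    exact Lp.coeFn_zero ℝ 2 μ
  | insert a s ha ih =>
    rw [Finset.sum_insert ha]
    filter_upwards [Lp.coeFn_add (c a • f a) (∑ i ∈ s, c i • f i), Lp.coeFn_smul (c a) (f a), ih]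
      with x h1 h2 h3
    rw [h1, Pi.add_apply, h2, h3, Finset.sum_insert ha]
    rfl

lemma MeasureTheory.L2.inner_toLp_toLp {α : Type*} [MeasurableSpace α] {μ : Measure α}
    {f g : α → ℝ} (hf : MemLp f 2 μ) (hg : MemLp g 2 μ) :
    inner ℝ (hf.toLp f) (hg.toLp g) = ∫ x, f x * g x ∂μ := by
  rw [L2.inner_def]
  refine integral_congr_ae ?_
  filter_upwards [hf.coeFn_toLp, hg.coeFn_toLp] with x h1 h2
  rw [h1, h2]
  simp [mul_comm]

section Wiener

variable {Ω : Type*} [MeasurableSpace Ω] {μ : Measure Ω} {W : ℝ≥0 → Ω → ℝ}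

lemma ProbabilityTheory.IsPreBrownianReal.memLp_two (hW : IsPreBrownianReal W μ) (t : ℝ≥0) :
    MemLp (W t) 2 μ := (hW.isGaussianProcess.hasGaussianLaw_eval t).memLp_two

lemma ProbabilityTheory.IsPreBrownianReal.integral_mul (hW : IsPreBrownianReal W μ) (s t : ℝ≥0) :
    ∫ ω, W s ω * W t ω ∂μ = min s t := by
  have := hW.isGaussianProcess.isProbabilityMeasure
  have h := hW.covariance_eval s t
  rw [covariance_eq_sub (hW.memLp_two s) (hW.memLp_two t), hW.integral_eval, zero_mul,
    sub_zero] at h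
  exact h

/-- The pair of the indicator of `(0, t]` and of `W t`. -/
noncomputable def wienerGen (hW : IsPreBrownianReal W μ) (t : ℝ≥0) :
    Lp ℝ 2 (volume : Measure ℝ) × Lp ℝ 2 μ :=
  (indicatorConstLp 2 (measurableSet_Ioc (a := (0 : ℝ)) (b := (t : ℝ))) (by simp) 1,
    (hW.memLp_two t).toLp (W t))

/-- The pairs of a square integrable function on `(0, 1]` and its Wiener integral: the graph of
the Wiener integral. -/
noncomputable def wienerGraph (hW : IsPreBrownianReal W μ) :
    Submodule ℝ (Lp ℝ 2 (volume : Measure ℝ) × Lp ℝ 2 μ) :=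
  (Submodule.span ℝ (Set.range fun t : Set.Iic (1 : ℝ≥0) => wienerGen hW t)).topologicalClosure

lemma wienerGen_mem (hW : IsPreBrownianReal W μ) {t : ℝ≥0} (ht : t ≤ 1) :
    wienerGen hW t ∈ wienerGraph hW :=
  Submodule.le_topologicalClosure _ (Submodule.subset_span ⟨⟨t, ht⟩, rfl⟩)

lemma inner_wienerGen_fst (hW : IsPreBrownianReal W μ) (s t : ℝ≥0) :
    inner ℝ (wienerGen hW s).1 (wienerGen hW t).1 = ((min s t : ℝ≥0) : ℝ) := by
  simp only [wienerGen]
  rw [L2.real_inner_indicatorConstLp_one_indicatorConstLp_one _ _ (by simp) (by simp),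
    Set.Ioc_inter_Ioc, Real.volume_real_Ioc_of_le (by simp)]
  simp

lemma inner_wienerGen_snd (hW : IsPreBrownianReal W μ) (s t : ℝ≥0) :
    inner ℝ (wienerGen hW s).2 (wienerGen hW t).2 = ((min s t : ℝ≥0) : ℝ) := by
  simp only [wienerGen]
  rw [L2.inner_toLp_toLp, hW.integral_mul]

/-- A finite combination of the W_t is Gaussian, and since the two components of the generators have
the same Gram matrix min(s,t), its variance is the squared norm of the integrand (the Itô isometry).
-/
lemma wienerGraph_span_spec [IsProbabilityMeasure μ] (hW : IsPreBrownianReal W μ)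
    {z : Lp ℝ 2 (volume : Measure ℝ) × Lp ℝ 2 μ}
    (hz : z ∈ Submodule.span ℝ (Set.range fun t : Set.Iic (1 : ℝ≥0) => wienerGen hW t)) :
    (∃ F : (Set.Iic (1 : ℝ≥0) → ℝ) → ℝ, Measurable F ∧ z.2 =ᵐ[μ] fun ω => F fun t => W t ω) ∧
      μ.map z.2 = gaussianReal 0 (‖z.1‖ ^ 2).toNNReal := by
  obtain ⟨c, rfl⟩ := Finsupp.mem_span_range_iff_exists_finsupp.1 hz
  set z := c.sum fun t a => a • wienerGen hW t with hzdef
  have h1 : z.1 = ∑ t ∈ c.support, c t • (wienerGen hW t).1 := by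
    rw [hzdef, Finsupp.sum, Prod.fst_sum]; rfl
  have h2 : z.2 = ∑ t ∈ c.support, c t • (wienerGen hW t).2 := by
    rw [hzdef, Finsupp.sum, Prod.snd_sum]; rfl
  have hae : z.2 =ᵐ[μ] fun ω => ∑ t ∈ c.support, c t * W t ω := by
    rw [h2]
    refine (Lp.coeFn_sum_smul c.support c fun t => (wienerGen hW t).2).trans ?_
    have : ∀ᵐ ω ∂μ, ∀ t : c.support, (wienerGen hW t).2 ω = W t ω :=
      ae_all_iff.2 fun t => (hW.memLp_two t).coeFn_toLp
    filter_upwards [this] with ω hω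
    exact Finset.sum_congr rfl fun t ht => by rw [hω ⟨t, ht⟩]
  refine ⟨⟨fun x => ∑ t ∈ c.support, c t * x t, by fun_prop, hae⟩, ?_⟩
  have hg : HasGaussianLaw (fun ω => ∑ t ∈ c.support, c t * W t ω) μ :=
    ((hW.isGaussianProcess.comp_right (fun t : Set.Iic (1 : ℝ≥0) => (t : ℝ≥0))).smul
      (fun t => c t)).hasGaussianLaw_fun_sum (I := c.support)
  have hint : ∀ t : Set.Iic (1 : ℝ≥0), Integrable (fun ω => c t * W t ω) μ := fun t =>
    (hW.integrable_eval t).const_mul _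
  have hmean : ∫ ω, ∑ t ∈ c.support, c t * W t ω ∂μ = 0 := by
    rw [integral_finsetSum _ fun t _ => hint t]
    exact Finset.sum_eq_zero fun t _ => by rw [integral_const_mul, hW.integral_eval, mul_zero]
  have hnorm : ‖z.2‖ ^ 2 = ‖z.1‖ ^ 2 := by
    rw [← real_inner_self_eq_norm_sq, ← real_inner_self_eq_norm_sq, h1, h2]
    simp only [sum_inner, inner_sum, real_inner_smul_left, real_inner_smul_right,
      inner_wienerGen_fst, inner_wienerGen_snd]
  have hvar : Var[fun ω => ∑ t ∈ c.support, c t * W t ω; μ] = ‖z.1‖ ^ 2 := by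
    rw [variance_of_integral_eq_zero hg.aemeasurable hmean, ← hnorm,
      ← real_inner_self_eq_norm_sq, L2.inner_def]
    refine integral_congr_ae (hae.symm.mono fun ω hω => ?_)
    simp only [hω]
    simp [pow_two]
  rw [Measure.map_congr hae, hg.map_eq_gaussianReal, hmean, hvar]

/-- Both properties survive L² limits: along a subsequence the second components converge almost
surely, which preserves being a functional of the path and gives convergence of characteristic
functions, while the norms of the first components converge. -/
lemma wienerGraph_spec [IsProbabilityMeasure μ] (hW : IsPreBrownianReal W μ)
    {z : Lp ℝ 2 (volume : Measure ℝ) × Lp ℝ 2 μ} (hz : z ∈ wienerGraph hW) :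
    (∃ F : (Set.Iic (1 : ℝ≥0) → ℝ) → ℝ, Measurable F ∧ z.2 =ᵐ[μ] fun ω => F fun t => W t ω) ∧
      μ.map z.2 = gaussianReal 0 (‖z.1‖ ^ 2).toNNReal := by
  rw [wienerGraph, ← SetLike.mem_coe, Submodule.topologicalClosure_coe,
    mem_closure_iff_seq_limit] at hz
  obtain ⟨x, hx, hxz⟩ := hz
  have hx1 : Tendsto (fun k => (x k).1) atTop (𝓝 z.1) := (continuous_fst.tendsto z).comp hxz
  have hx2 : Tendsto (fun k => (x k).2) atTop (𝓝 z.2) := (continuous_snd.tendsto z).comp hxz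
  obtain ⟨ns, hns, hae⟩ := (tendstoInMeasure_of_tendsto_Lp hx2).exists_seq_tendsto_ae
  choose hF hG using fun k => wienerGraph_span_spec hW (hx k)
  choose F hFm hFe using hF
  constructor
  -- The limsup is measurable on the whole path space and equals the limit wherever that exists.
  · refine ⟨fun w => limsup (fun k => F (ns k) w) atTop,
      Measurable.limsup fun k => hFm (ns k), ?_⟩
    have : ∀ᵐ ω ∂μ, ∀ k, (x k).2 ω = F k fun t => W t ω := ae_all_iff.2 hFe
    filter_upwards [hae, this] with ω h1 h2
    simp only [h2] at h1
    exact h1.limsup_eq.symm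
  · have hm : ∀ k, AEMeasurable (x k).2 μ := fun k => (Lp.aestronglyMeasurable _).aemeasurable
    have hmz : AEMeasurable z.2 μ := (Lp.aestronglyMeasurable _).aemeasurable
    have : IsProbabilityMeasure (μ.map z.2) := Measure.isProbabilityMeasure_map hmz
    refine Measure.ext_of_charFun ?_
    ext u
    have hlim1 : Tendsto (fun k => charFun (μ.map (x (ns k)).2) u) atTop
        (𝓝 (charFun (μ.map z.2) u)) := by
      have e : ∀ Z : Ω → ℝ, AEMeasurable Z μ →
          charFun (μ.map Z) u = ∫ ω, Complex.exp (u * Z ω * Complex.I) ∂μ := fun Z hZ => by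
        rw [charFun_apply_real, integral_map hZ]
        exact Continuous.aestronglyMeasurable (by fun_prop)
      rw [e _ hmz]
      simp_rw [fun k => e _ (hm (ns k))]
      refine tendsto_integral_of_dominated_convergence (fun _ => 1) (fun k => ?_)
        (integrable_const _) (fun k => ae_of_all _ fun ω => ?_) ?_
      · exact (show Continuous fun y : ℝ => Complex.exp (u * y * Complex.I) by
          fun_prop).comp_aestronglyMeasurable (Lp.aestronglyMeasurable _)
      · rw [← Complex.ofReal_mul, Complex.norm_exp_ofReal_mul_I]
      · filter_upwards [hae] with ω hω
        exact ((show Continuous fun y : ℝ => Complex.exp (u * y * Complex.I) by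
          fun_prop).tendsto _).comp hω
    have hlim2 : Tendsto (fun k => charFun (μ.map (x (ns k)).2) u) atTop
        (𝓝 (charFun (gaussianReal 0 (‖z.1‖ ^ 2).toNNReal) u)) := by
      simp_rw [hG, charFun_gaussianReal]
      have hc : Continuous fun y : Lp ℝ 2 (volume : Measure ℝ) =>
          Complex.exp (u * (0 : ℝ) * Complex.I - ((‖y‖ ^ 2).toNNReal : ℝ≥0) * (u : ℂ) ^ 2 / 2) := by
        have h1 : Continuous fun y : Lp ℝ 2 (volume : Measure ℝ) =>
          (((‖y‖ ^ 2).toNNReal : ℝ≥0) : ℝ) := by fun_prop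
        have h2 : Continuous fun y : Lp ℝ 2 (volume : Measure ℝ) =>
          ((((‖y‖ ^ 2).toNNReal : ℝ≥0) : ℝ) : ℂ) := Complex.continuous_ofReal.comp h1
        exact Complex.continuous_exp.comp (continuous_const.sub ((h2.mul continuous_const).div_const _))
      exact (hc.tendsto z.1).comp (hx1.comp hns.tendsto_atTop)
    exact tendsto_nhds_unique hlim1 hlim2

end Wiener

/-! ### Step functions, and independence from orthogonality -/

section WienerIntegral

variable {Ω : Type*} [MeasurableSpace Ω] {μ : Measure Ω} {W : ℝ≥0 → Ω → ℝ}

lemma coeFn_wienerGen_fst (hW : IsPreBrownianReal W μ) (t : ℝ≥0) :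
    (wienerGen hW t).1 =ᵐ[volume] (Set.Ioc (0 : ℝ) t).indicator fun _ => 1 :=
  indicatorConstLp_coeFn (hs := measurableSet_Ioc) (hμs := by simp)

lemma coeFn_wienerGen_snd (hW : IsPreBrownianReal W μ) (t : ℝ≥0) :
    (wienerGen hW t).2 =ᵐ[μ] W t := (hW.memLp_two t).coeFn_toLp

namespace StepIntegrand

variable {t : ℝ≥0}

lemma p_le (g : StepIntegrand t) {j : ℕ} (hj : j ≤ g.m) : g.p j ≤ t :=
  (g.mono hj).trans_eq g.p_last

lemma eval_eq_zero (g : StepIntegrand t) {s : ℝ} (hs : s ∉ Set.Ioc (0 : ℝ) t) : g.eval s = 0 := by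
  refine Finset.sum_eq_zero fun j hj => Set.indicator_of_notMem (fun h => hs ?_) _
  have hj' : j + 1 ≤ g.m := Finset.mem_range.1 hj
  exact ⟨(g.p j).2.trans_lt h.1, h.2.trans (by exact_mod_cast g.p_le hj')⟩

/-- The step function and its elementary integral as a pair of square integrable functions. -/
noncomputable def toGraph (g : StepIntegrand t) (hW : IsPreBrownianReal W μ) :
    Lp ℝ 2 (volume : Measure ℝ) × Lp ℝ 2 μ :=
  ∑ j ∈ Finset.range g.m, g.c j • (wienerGen hW (g.p (j + 1)) - wienerGen hW (g.p j))

lemma toGraph_mem (g : StepIntegrand t) (hW : IsPreBrownianReal W μ) (ht : t ≤ 1) :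
    g.toGraph hW ∈
      Submodule.span ℝ (Set.range fun t : Set.Iic (1 : ℝ≥0) => wienerGen hW t) := by
  refine Submodule.sum_mem _ fun j hj => Submodule.smul_mem _ _ (Submodule.sub_mem _ ?_ ?_)
  · exact Submodule.subset_span ⟨⟨_, (g.p_le (Finset.mem_range.1 hj)).trans ht⟩, rfl⟩
  · exact Submodule.subset_span ⟨⟨_, (g.p_le (Finset.mem_range.1 hj).le).trans ht⟩, rfl⟩

lemma coeFn_toGraph_fst (g : StepIntegrand t) (hW : IsPreBrownianReal W μ) :
    (g.toGraph hW).1 =ᵐ[volume] g.eval := by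
  have h : (g.toGraph hW).1 = ∑ j ∈ Finset.range g.m,
      g.c j • ((wienerGen hW (g.p (j + 1))).1 - (wienerGen hW (g.p j)).1) := by
    rw [toGraph, Prod.fst_sum]; rfl
  rw [h]
  refine (Lp.coeFn_sum_smul _ _ _).trans ?_
  have h1 : ∀ᵐ s ∂volume, ∀ j, ((wienerGen hW (g.p (j + 1))).1 - (wienerGen hW (g.p j)).1 :
      Lp ℝ 2 (volume : Measure ℝ)) s
      = (wienerGen hW (g.p (j + 1))).1 s - (wienerGen hW (g.p j)).1 s :=
    ae_all_iff.2 fun j => Lp.coeFn_sub _ _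
  have h2 : ∀ᵐ s ∂volume, ∀ j, (wienerGen hW (g.p j)).1 s
      = (Set.Ioc (0 : ℝ) (g.p j)).indicator (fun _ => 1) s :=
    ae_all_iff.2 fun j => coeFn_wienerGen_fst hW _
  filter_upwards [h1, h2] with s h1 h2
  refine Finset.sum_congr rfl fun j _ => ?_
  rw [h1, h2, h2]
  have hm : (g.p j : ℝ) ≤ g.p (j + 1) := by exact_mod_cast g.mono j.le_succ
  have h0 : (0 : ℝ) ≤ g.p j := (g.p j).2
  simp only [Set.indicator_apply, Set.mem_Ioc]
  split_ifs <;> grind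

lemma coeFn_toGraph_snd (g : StepIntegrand t) (hW : IsPreBrownianReal W μ) :
    (g.toGraph hW).2 =ᵐ[μ] g.integral W := by
  have h : (g.toGraph hW).2 = ∑ j ∈ Finset.range g.m,
      g.c j • ((wienerGen hW (g.p (j + 1))).2 - (wienerGen hW (g.p j)).2) := by
    rw [toGraph, Prod.snd_sum]; rfl
  rw [h]
  refine (Lp.coeFn_sum_smul _ _ _).trans ?_
  have h1 : ∀ᵐ s ∂μ, ∀ j, ((wienerGen hW (g.p (j + 1))).2 - (wienerGen hW (g.p j)).2 :
      Lp ℝ 2 μ) s = (wienerGen hW (g.p (j + 1))).2 s - (wienerGen hW (g.p j)).2 s :=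
    ae_all_iff.2 fun j => Lp.coeFn_sub _ _
  have h2 : ∀ᵐ s ∂μ, ∀ j, (wienerGen hW (g.p j)).2 s = W (g.p j) s :=
    ae_all_iff.2 fun j => coeFn_wienerGen_snd hW _
  filter_upwards [h1, h2] with s h1 h2
  exact Finset.sum_congr rfl fun j _ => by rw [h1, h2, h2]

end StepIntegrand

/-- The approximating step functions with their elementary integrals lie in the span, and their
distance to (f 1_{(0,t]}, X) in the product metric is at most the prescribed error. Square
integrability of X comes from a single approximant. -/
lemma IsWienerIntegral.exists_mem_wienerGraph (hW : IsPreBrownianReal W μ) {f : ℝ → ℝ} {t : ℝ≥0}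
    (ht : t ≤ 1) {X : Ω → ℝ} (h : IsWienerIntegral μ W f t X)
    (hf : MemLp f 2 (volume.restrict (Set.Ioc (0 : ℝ) t))) :
    ∃ z ∈ wienerGraph hW, z.1 =ᵐ[volume] (Set.Ioc (0 : ℝ) t).indicator f ∧ z.2 =ᵐ[μ] X := by
  have hX : MemLp X 2 μ := by
    obtain ⟨g, -, hg⟩ := h.2 1 one_pos
    have hgi : MemLp (g.integral W) 2 μ :=
      (Lp.memLp (g.toGraph hW).2).ae_eq (g.coeFn_toGraph_snd hW)
    have : MemLp (fun ω => X ω - g.integral W ω) 2 μ :=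
      ⟨h.1.sub hgi.1, hg.trans_lt ENNReal.ofReal_lt_top⟩
    exact (this.add hgi).ae_eq (ae_of_all _ fun ω => by simp)
  have hf' : MemLp ((Set.Ioc (0 : ℝ) t).indicator f) 2 volume :=
    (memLp_indicator_iff_restrict measurableSet_Ioc).2 hf
  refine ⟨(hf'.toLp _, hX.toLp _), ?_, hf'.coeFn_toLp, hX.coeFn_toLp⟩
  rw [wienerGraph, ← SetLike.mem_coe, Submodule.topologicalClosure_coe, Metric.mem_closure_iff]
  intro δ hδ
  obtain ⟨g, hg1, hg2⟩ := h.2 (δ / 2) (by positivity)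
  refine ⟨g.toGraph hW, g.toGraph_mem hW ht, ?_⟩
  rw [Prod.dist_eq, max_lt_iff, Lp.dist_def, Lp.dist_def]
  constructor
  · refine (ENNReal.toReal_le_of_le_ofReal (by positivity) (le_trans (le_of_eq ?_) hg1)).trans_lt
      (half_lt_self hδ)
    rw [← eLpNorm_indicator_eq_eLpNorm_restrict measurableSet_Ioc]
    refine eLpNorm_congr_ae ?_
    filter_upwards [hf'.coeFn_toLp, g.coeFn_toGraph_fst hW] with s h1 h2
    rw [Pi.sub_apply, h1, h2]
    by_cases hs : s ∈ Set.Ioc (0 : ℝ) t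
    · simp [hs]
    · simp [hs, g.eval_eq_zero hs]
  · refine (ENNReal.toReal_le_of_le_ofReal (by positivity) (le_trans (le_of_eq ?_) hg2)).trans_lt
      (half_lt_self hδ)
    refine eLpNorm_congr_ae ?_
    filter_upwards [hX.coeFn_toLp, g.coeFn_toGraph_snd hW] with s h1 h2
    rw [Pi.sub_apply, h1, h2]

/-- A Cramér–Wold argument: Σ a_i z_i is again in the closed span, so its second component is
centered Gaussian with variance |a|² by orthonormality. Hence the joint characteristic function at a
is the product of standard normal ones. -/
lemma iIndepFun_of_mem_wienerGraph [IsProbabilityMeasure μ] (hW : IsPreBrownianReal W μ)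
    {ι : Type*} [Fintype ι] {z : ι → Lp ℝ 2 (volume : Measure ℝ) × Lp ℝ 2 μ}
    (hz : ∀ i, z i ∈ wienerGraph hW) (ho : Orthonormal ℝ fun i => (z i).1) :
    iIndepFun (fun i => ⇑(z i).2) μ ∧ ∀ i, μ.map (z i).2 = gaussianReal 0 1 := by
  have hg : ∀ i, μ.map (z i).2 = gaussianReal 0 1 := fun i => by
    rw [(wienerGraph_spec hW (hz i)).2, ho.1 i]; simp
  have hm : ∀ i, AEMeasurable (z i).2 μ := fun i => (Lp.aestronglyMeasurable _).aemeasurable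
  refine ⟨(iIndepFun_iff_charFun_pi hm).2 fun a => ?_, hg⟩
  have hs := wienerGraph_spec hW (Submodule.sum_mem _ fun i (_ : i ∈ Finset.univ) =>
    Submodule.smul_mem _ (a i) (hz i))
  have h1 : (∑ i, a i • z i).1 = ∑ i, a i • (z i).1 := by rw [Prod.fst_sum]; rfl
  have h2 : (∑ i, a i • z i).2 = ∑ i, a i • (z i).2 := by rw [Prod.snd_sum]; rfl
  have hnorm : ‖∑ i, a i • (z i).1‖ ^ 2 = ∑ i, a i ^ 2 := by
    rw [← real_inner_self_eq_norm_sq, ho.inner_sum]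
    simp [pow_two]
  -- The joint characteristic function at the vector a is the one of the linear combination at 1.
  have h3 := congrArg (fun ν => charFun ν 1) hs.2
  simp only [h1, h2, hnorm, charFun_gaussianReal] at h3
  rw [Measure.map_congr (Lp.coeFn_sum_smul _ _ _), charFun_apply_real, integral_map
    (by fun_prop) (Continuous.aestronglyMeasurable (by fun_prop))] at h3
  rw [charFun_apply, integral_map (by fun_prop) (Continuous.aestronglyMeasurable (by fun_prop))]
  simp only [hg, charFun_gaussianReal]
  rw [← Complex.exp_sum]
  convert h3 using 1
  · refine integral_congr_ae (ae_of_all _ fun ω => ?_)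
    simp [PiLp.inner_apply]
  · congr 1
    rw [Real.coe_toNNReal _ (by positivity)]
    push_cast
    simp [Finset.sum_div]

end WienerIntegral

/-! ### The observation models as noisy increments -/

section Models

variable {Ω : Type*} [MeasurableSpace Ω] {μ : Measure Ω} {W : ℝ≥0 → Ω → ℝ}

lemma memLp_of_map_eq_gaussianReal {Z : Ω → ℝ} {v : ℝ≥0} (hZ : AEMeasurable Z μ)
    (h : μ.map Z = gaussianReal 0 v) : MemLp Z 4 μ := by
  have h4 : MemLp id 4 (μ.map Z) := h ▸ memLp_id_gaussianReal' 4 (by simp)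
  exact (memLp_map_measure_iff aestronglyMeasurable_id hZ).1 h4

lemma integral_pow_four_of_map_eq_gaussianReal {Z : Ω → ℝ} {v : ℝ≥0} (hZ : AEMeasurable Z μ)
    (h : μ.map Z = gaussianReal 0 v) :
    ∫ ω, Z ω ^ 4 ∂μ = v ^ 2 * ∫ x, x ^ 4 ∂gaussianReal 0 1 := by
  have h1 : gaussianReal 0 v = (gaussianReal 0 1).map (√(v : ℝ) * ·) := by
    rw [gaussianReal_map_const_mul]
    congr 1
    · simp
    · ext; simp
  have h2 : ∫ ω, Z ω ^ 4 ∂μ = ∫ x, x ^ 4 ∂μ.map Z :=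
    (integral_map (f := fun x : ℝ => x ^ 4) hZ
      (Continuous.aestronglyMeasurable (by fun_prop))).symm
  rw [h2, h, h1, integral_map (by fun_prop) (Continuous.aestronglyMeasurable (by fun_prop)),
    ← integral_const_mul]
  refine integral_congr_ae (ae_of_all _ fun x => ?_)
  have : √(v : ℝ) ^ 2 = v := Real.sq_sqrt v.2
  calc (√(v : ℝ) * x) ^ 4 = (√(v : ℝ) ^ 2) ^ 2 * x ^ 4 := by ring
    _ = _ := by rw [this]

lemma integral_pow_four_gaussianReal_nonneg : 0 ≤ ∫ x, x ^ 4 ∂gaussianReal 0 1 :=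
  integral_nonneg fun x => by positivity

lemma IsMicroNoise.exists_integral_pow_four_le {ε : ℕ → ℕ → Ω → ℝ} (hε : IsMicroNoise μ W ε) :
    ∃ M : ℝ, 0 ≤ M ∧ ∀ n, ∀ i ∈ Finset.Icc 1 n, MemLp (ε n i) 4 μ ∧ ∫ ω, ε n i ω ^ 4 ∂μ ≤ M := by
  obtain ⟨M, hM⟩ := hε.fourth
  refine ⟨M, M.2, fun n i hi => ?_⟩
  have hm := (hε.aemeasurable n i hi).aestronglyMeasurable
  have hlt : ∫⁻ ω, ‖ε n i ω‖ₑ ^ 4 ∂μ < ∞ := (hM n i hi).trans_lt ENNReal.coe_lt_top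
  refine ⟨⟨hm, ?_⟩, ?_⟩
  · refine (eLpNorm_lt_top_iff_lintegral_rpow_enorm_lt_top (by simp) (by simp)).2 ?_
    simpa using hlt
  · rw [integral_eq_lintegral_of_nonneg_ae (ae_of_all _ fun ω => by positivity) (by fun_prop)]
    refine ENNReal.toReal_le_of_le_ofReal M.2 ?_
    rw [ENNReal.ofReal_coe_nnreal]
    refine le_trans (le_of_eq (lintegral_congr fun ω => ?_)) (hM n i hi)
    rw [Real.enorm_eq_ofReal_abs, ← ENNReal.ofReal_pow (abs_nonneg _), Even.pow_abs (by decide)]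

variable [IsProbabilityMeasure μ]

/-- The Wiener part consists of functionals of the path on [0,1], so it is independent of the noise
vector jointly, and the two independent families merge into one. M has to dominate the fourth
moments of both the noise and the standard normal law. -/
lemma isWhite_sumElim {ε : ℕ → ℕ → Ω → ℝ} (hW : IsPreBrownianReal W μ) (hε : IsMicroNoise μ W ε)
    {n : ℕ} {M : ℝ} (hM : ∀ i ∈ Finset.Icc 1 n, MemLp (ε n i) 4 μ ∧ ∫ ω, ε n i ω ^ 4 ∂μ ≤ M)
    (hM' : ∫ x, x ^ 4 ∂gaussianReal 0 1 ≤ M) {ι : Type*} [Fintype ι]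
    {z : ι → Lp ℝ 2 (volume : Measure ℝ) × Lp ℝ 2 μ}
    (hz : ∀ i, z i ∈ wienerGraph hW) (ho : Orthonormal ℝ fun i => (z i).1) :
    IsWhite μ M (Sum.elim (fun i => ⇑(z i).2) fun j : Fin n => ε n (j + 1)) := by
  obtain ⟨hi, hg⟩ := iIndepFun_of_mem_wienerGraph hW hz ho
  have hm : ∀ i, AEMeasurable (z i).2 μ := fun i => (Lp.aestronglyMeasurable _).aemeasurable
  have hmem : ∀ j : Fin n, (j : ℕ) + 1 ∈ Finset.Icc 1 n := fun j => by
    simp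
  refine ⟨?_, ?_, ?_, ?_, ?_⟩
  · have hη : iIndepFun (fun j : Fin n => ε n (j + 1)) μ :=
      (hε.indep n).precomp (g := fun j : Fin n => (⟨j + 1, hmem j⟩ : Finset.Icc 1 n))
        fun a b h => by simpa [Fin.ext_iff] using h
    have hind : IndepFun (fun ω i => (z i).2 ω) (fun ω (j : Fin n) => ε n (j + 1) ω) μ := by
      choose F hF hFe using fun i => (wienerGraph_spec hW (hz i)).1
      have h := (hε.indep_brownian n).comp (φ := fun w i => F i w)
        (ψ := fun e (j : Fin n) => e ⟨j + 1, hmem j⟩) (by fun_prop) (by fun_prop)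
      refine h.congr ?_ EventuallyEq.rfl
      filter_upwards [ae_all_iff.2 hFe] with ω hω
      exact funext fun i => (hω i).symm
    have := iIndepFun_sumElim hi hη hind
    convert this using 1
  · rintro (i | j)
    · exact memLp_of_map_eq_gaussianReal (hm i) (hg i)
    · exact (hM _ (hmem j)).1
  · rintro (i | j)
    · have h := integral_map (f := fun x : ℝ => x) (hm i) aestronglyMeasurable_id
      rw [hg i, integral_id_gaussianReal] at h
      exact h.symm
    · exact hε.mean n _ (hmem j)
  · rintro (i | j)
    · have h := integral_map (f := fun x : ℝ => x ^ 2) (hm i)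
        (Continuous.aestronglyMeasurable (by fun_prop))
      have h2 : ∫ x, x ^ 2 ∂gaussianReal 0 1 = 1 := by
        have := variance_id_gaussianReal (μ := 0) (v := 1)
        rw [variance_of_integral_eq_zero aemeasurable_id (by simp)] at this
        simpa using this
      rw [hg i, h2] at h
      exact h.symm
    · exact hε.second n _ (hmem j)
  · rintro (i | j)
    · refine le_trans (le_of_eq ?_) hM'
      refine (integral_pow_four_of_map_eq_gaussianReal (hm i) (hg i)).trans ?_
      simp
    · exact (hM _ (hmem j)).2

/-- Integrands restricted to disjoint cells are orthogonal, and division by √v_i normalizes them.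
The general f covers both models: f = σ for the Wiener integral and f = 1 for Brownian motion
itself. -/
lemma exists_isWhite_increments {ε : ℕ → ℕ → Ω → ℝ} (hW : IsPreBrownianReal W μ)
    (hε : IsMicroNoise μ W ε) {n : ℕ} {M : ℝ}
    (hM : ∀ i ∈ Finset.Icc 1 n, MemLp (ε n i) 4 μ ∧ ∫ ω, ε n i ω ^ 4 ∂μ ≤ M)
    (hM' : ∫ x, x ^ 4 ∂gaussianReal 0 1 ≤ M)
    {z : ℕ → Lp ℝ 2 (volume : Measure ℝ) × Lp ℝ 2 μ} {f : ℝ → ℝ} {v : ℕ → ℝ}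
    (hz : ∀ i ∈ Finset.Icc 1 n, z i ∈ wienerGraph hW)
    (hzf : ∀ i ∈ Finset.Icc 1 n,
      (z i).1 =ᵐ[volume] (Set.Ioc (0 : ℝ) ((i : ℝ) / n)).indicator f)
    (hv : ∀ i ∈ Finset.range (n - 1),
      ∫ x in ((i + 1 : ℕ) : ℝ) / n..((i + 2 : ℕ) : ℝ) / n, f x ^ 2 = v i)
    (hv0 : ∀ i ∈ Finset.range (n - 1), 0 < v i) :
    ∃ ξ : ℕ → Ω → ℝ,
      IsWhite μ M (Sum.elim (fun i : Fin (n - 1) => ξ i) fun j : Fin n => ε n (j + 1)) ∧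
      ∀ i ∈ Finset.range (n - 1),
        (fun ω => (z (i + 2)).2 ω - (z (i + 1)).2 ω) =ᵐ[μ] fun ω => √(v i) * ξ i ω := by
  set y : ℕ → Lp ℝ 2 (volume : Measure ℝ) × Lp ℝ 2 μ := fun i =>
    (√(v i))⁻¹ • (z (i + 2) - z (i + 1)) with hy
  have hmem : ∀ i ∈ Finset.range (n - 1), i + 1 ∈ Finset.Icc 1 n ∧ i + 2 ∈ Finset.Icc 1 n :=
    fun i hi => by simp at hi ⊢; omega
  have hle : ∀ i : ℕ, ((i + 1 : ℕ) : ℝ) / n ≤ ((i + 2 : ℕ) : ℝ) / n := fun i => by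
    gcongr; omega
  have hyf : ∀ i ∈ Finset.range (n - 1), (y i).1 =ᵐ[volume] fun x =>
      (√(v i))⁻¹ * (Set.Ioc (((i + 1 : ℕ) : ℝ) / n) (((i + 2 : ℕ) : ℝ) / n)).indicator f x := by
    intro i hi
    have h : (y i).1 = (√(v i))⁻¹ • ((z (i + 2)).1 - (z (i + 1)).1) := rfl
    rw [h]
    filter_upwards [Lp.coeFn_smul (√(v i))⁻¹ ((z (i + 2)).1 - (z (i + 1)).1),
      Lp.coeFn_sub (z (i + 2)).1 (z (i + 1)).1, hzf _ (hmem i hi).1, hzf _ (hmem i hi).2]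
      with x h1 h2 h3 h4
    rw [h1, Pi.smul_apply, h2, Pi.sub_apply, h3, h4, smul_eq_mul]
    congr 1
    have h0 : (0 : ℝ) ≤ ((i + 1 : ℕ) : ℝ) / n := by positivity
    have h5 := hle i
    simp only [Set.indicator_apply, Set.mem_Ioc]
    split_ifs <;> grind
  have ho : Orthonormal ℝ fun i : Fin (n - 1) => (y i).1 := by
    rw [orthonormal_iff_ite]
    intro i j
    have hi := Finset.mem_range.2 i.2
    have hj := Finset.mem_range.2 j.2
    have h : inner ℝ (y i).1 (y j).1 = ∫ x, (y i).1 x * (y j).1 x := by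
      rw [L2.inner_def]
      exact integral_congr_ae (ae_of_all _ fun x => by simp [mul_comm])
    rw [h]
    split_ifs with hij
    · subst hij
      rw [integral_congr_ae (g := fun x => (v i)⁻¹ * (Set.Ioc ((((i : ℕ) + 1 : ℕ) : ℝ) / n)
        ((((i : ℕ) + 2 : ℕ) : ℝ) / n)).indicator (fun x => f x ^ 2) x), integral_const_mul,
        integral_indicator measurableSet_Ioc, ← intervalIntegral.integral_of_le (hle i), hv _ hi,
        inv_mul_cancel₀ (hv0 _ hi).ne']
      filter_upwards [hyf _ hi] with x hx
      rw [hx]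
      have hs : √(v i) * √(v i) = v i := Real.mul_self_sqrt (hv0 _ hi).le
      simp only [Set.indicator_apply]
      split_ifs
      · rw [mul_mul_mul_comm, ← mul_inv, hs, pow_two]
      · simp
    · refine (integral_congr_ae (g := fun _ => (0 : ℝ)) ?_).trans (by simp)
      filter_upwards [hyf _ hi, hyf _ hj] with x h1 h2
      rw [h1, h2]
      have hne : (i : ℕ) ≠ j := fun h => hij (Fin.ext h)
      by_cases hxi : x ∈ Set.Ioc ((((i : ℕ) + 1 : ℕ) : ℝ) / n) ((((i : ℕ) + 2 : ℕ) : ℝ) / n)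
      · by_cases hxj : x ∈ Set.Ioc ((((j : ℕ) + 1 : ℕ) : ℝ) / n) ((((j : ℕ) + 2 : ℕ) : ℝ) / n)
        · exfalso
          rcases lt_or_gt_of_ne hne with h | h
          · have : ((((i : ℕ) + 2 : ℕ) : ℝ) / n) ≤ ((((j : ℕ) + 1 : ℕ) : ℝ) / n) := by
              have : (i : ℕ) + 2 ≤ j + 1 := by omega
              gcongr
            linarith [hxi.2, hxj.1]
          · have : ((((j : ℕ) + 2 : ℕ) : ℝ) / n) ≤ ((((i : ℕ) + 1 : ℕ) : ℝ) / n) := by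
              have : (j : ℕ) + 2 ≤ i + 1 := by omega
              gcongr
            linarith [hxi.1, hxj.2]
        · rw [Set.indicator_of_notMem hxj, mul_zero, mul_zero]
      · rw [Set.indicator_of_notMem hxi, mul_zero, zero_mul]
  refine ⟨fun i => (y i).2, isWhite_sumElim hW hε hM hM' (z := fun i : Fin (n - 1) => y i)
    (fun i => ?_) ho, fun i hi => ?_⟩
  · have hi := hmem _ (Finset.mem_range.2 i.2)
    exact Submodule.smul_mem _ _ (Submodule.sub_mem _ (hz _ hi.2) (hz _ hi.1))
  · have h : (y i).2 = (√(v i))⁻¹ • ((z (i + 2)).2 - (z (i + 1)).2) := rfl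
    simp only [h]
    filter_upwards [Lp.coeFn_smul (√(v i))⁻¹ ((z (i + 2)).2 - (z (i + 1)).2),
      Lp.coeFn_sub (z (i + 2)).2 (z (i + 1)).2] with ω h1 h2
    rw [h1, Pi.smul_apply, h2, Pi.sub_apply, smul_eq_mul,
      mul_inv_cancel_left₀ (Real.sqrt_ne_zero'.2 (hv0 i hi))]

/-- In the time-transformed model s_i² is exactly the integral of σ² over the cell and ρ = 0. In the
space-transformed model the increment of σW is σ at the left end times the increment of W, plus the
increment of σ times W at the right end; the latter is ρ, and the Lipschitz bound on σ² makes it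
O(1/n). -/
lemma exists_hasNoisyIncrements {ε : ℕ → ℕ → Ω → ℝ} (hW : IsPreBrownianReal W μ)
    (hε : IsMicroNoise μ W ε) (m : VolModel) {l u L u' : ℝ} (hl : 0 < l) (hL : 0 ≤ L)
    (hu : 0 ≤ u) (hu' : 0 ≤ u') :
    ∃ M A : ℝ, 0 ≤ M ∧ 0 ≤ A ∧ ∀ (n : ℕ) (σ τ : ℝ → ℝ) (Y : ℕ → Ω → ℝ), 0 < n →
      MemLp σ 2 (volume.restrict (Set.Icc (0 : ℝ) 1)) →
      (∀ x ∈ Set.Icc (0 : ℝ) 1, 0 < σ x ∧ l ≤ σ x ^ 2 ∧ σ x ^ 2 ≤ u) →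
      (m = .spaceTransformed → ∀ x ∈ Set.Icc (0 : ℝ) 1, ∀ y ∈ Set.Icc (0 : ℝ) 1,
        |σ x ^ 2 - σ y ^ 2| ≤ L * |x - y|) →
      (∀ x ∈ Set.Icc (0 : ℝ) 1, τ x ^ 2 ≤ u') →
      IsObservation m μ W ε σ τ n Y →
      ∃ s : ℕ → ℝ, HasNoisyIncrements μ M A n Y s (fun j => τ (((j + 1 : ℕ) : ℝ) / n)) ∧
        (∀ i ∈ Finset.range (n - 1), s i ^ 2 ≤ A / n) ∧
        (∀ j ∈ Finset.range n, τ (((j + 1 : ℕ) : ℝ) / n) ^ 2 ≤ A) ∧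
        ∀ i ∈ Finset.range (n - 1),
          |s i ^ 2 - ∫ x in ((i + 1 : ℕ) : ℝ) / n..((i + 2 : ℕ) : ℝ) / n, σ x ^ 2|
            ≤ A / n ^ 2 := by
  obtain ⟨M₁, hM₁, hM₁'⟩ := hε.exists_integral_pow_four_le
  set g₄ := ∫ x, x ^ 4 ∂gaussianReal 0 1 with hg₄
  have hg0 : 0 ≤ g₄ := integral_pow_four_gaussianReal_nonneg
  set M := max M₁ g₄
  set A := u + u' + L + L ^ 4 / l ^ 2 * g₄ with hA
  have hA4 : 0 ≤ L ^ 4 / l ^ 2 * g₄ := by positivity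
  have hA0 : 0 ≤ A := by positivity
  refine ⟨M, A, hM₁.trans (le_max_left _ _), hA0, fun n σ τ Y hn hσ2 hσ hLip hτ hY => ?_⟩
  have hn' : (0 : ℝ) < n := by exact_mod_cast hn
  have hM : ∀ i ∈ Finset.Icc 1 n, MemLp (ε n i) 4 μ ∧ ∫ ω, ε n i ω ^ 4 ∂μ ≤ M := fun i hi =>
    ⟨(hM₁' n i hi).1, (hM₁' n i hi).2.trans (le_max_left _ _)⟩
  have hIcc : ∀ i : ℕ, i ≤ n → (i : ℝ) / n ∈ Set.Icc (0 : ℝ) 1 := fun i hi =>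
    ⟨by positivity, (div_le_one hn').2 (by exact_mod_cast hi)⟩
  have hmem : ∀ i ∈ Finset.range (n - 1), i + 1 ∈ Finset.Icc 1 n ∧ i + 2 ∈ Finset.Icc 1 n :=
    fun i hi => by simp at hi ⊢; omega
  have hle : ∀ i : ℕ, ((i + 1 : ℕ) : ℝ) / n ≤ ((i + 2 : ℕ) : ℝ) / n := fun i => by
    gcongr; omega
  have hlen : ∀ i : ℕ, ((i + 2 : ℕ) : ℝ) / n - ((i + 1 : ℕ) : ℝ) / n = 1 / n := fun i => by
    rw [← sub_div]; push_cast; ring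
  have hsub : ∀ i ∈ Finset.range (n - 1),
      Set.Icc (((i + 1 : ℕ) : ℝ) / n) (((i + 2 : ℕ) : ℝ) / n) ⊆ Set.Icc 0 1 := fun i hi =>
    Set.Icc_subset_Icc (hIcc _ (by have := hmem i hi; simp at this; omega)).1
      (hIcc _ (by have := hmem i hi; simp at this; omega)).2
  have hint : ∀ i ∈ Finset.range (n - 1), IntervalIntegrable (fun x => σ x ^ 2) volume
      (((i + 1 : ℕ) : ℝ) / n) (((i + 2 : ℕ) : ℝ) / n) := fun i hi =>
    (intervalIntegrable_iff_integrableOn_Icc_of_le (hle i)).2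
      (IntegrableOn.mono_set hσ2.integrable_sq (hsub i hi))
  have hτA : ∀ j ∈ Finset.range n, τ (((j + 1 : ℕ) : ℝ) / n) ^ 2 ≤ A := fun j hj =>
    (hτ _ (hIcc _ (Finset.mem_range.1 hj))).trans (by linarith)
  have hcast : ∀ i : ℕ, (((i : ℝ≥0) / (n : ℝ≥0) : ℝ≥0) : ℝ) = (i : ℝ) / n := fun i => by simp
  have hle1 : ∀ i ∈ Finset.Icc 1 n, (i : ℝ≥0) / (n : ℝ≥0) ≤ 1 := fun i hi => by
    rw [← NNReal.coe_le_coe, hcast]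
    exact (hIcc i (Finset.mem_Icc.1 hi).2).2
  set v : ℕ → ℝ := fun i => ∫ x in ((i + 1 : ℕ) : ℝ) / n..((i + 2 : ℕ) : ℝ) / n, σ x ^ 2 with hv
  have hvu : ∀ i ∈ Finset.range (n - 1), v i ≤ u / n := fun i hi => by
    have := intervalIntegral.integral_mono_on (hle i) (hint i hi)
      (intervalIntegrable_const (c := u)) fun x hx => (hσ x (hsub i hi hx)).2.2
    rw [intervalIntegral.integral_const, hlen, smul_eq_mul] at this
    exact this.trans_eq (by ring)
  have hvl : ∀ i ∈ Finset.range (n - 1), 0 < v i := fun i hi => by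
    have := intervalIntegral.integral_mono_on (hle i)
      (intervalIntegrable_const (c := l)) (hint i hi) fun x hx => (hσ x (hsub i hi hx)).2.1
    rw [intervalIntegral.integral_const, hlen, smul_eq_mul] at this
    exact lt_of_lt_of_le (by positivity) this
  choose! X hX hYX using hY
  cases m with
  | timeTransformed =>
    have hz : ∀ i ∈ Finset.Icc 1 n, ∃ z ∈ wienerGraph hW,
        z.1 =ᵐ[volume] (Set.Ioc (0 : ℝ) ((i : ℝ) / n)).indicator σ ∧ z.2 =ᵐ[μ] X i := by
      intro i hi
      have h : IsWienerIntegral μ W σ ((i : ℝ≥0) / (n : ℝ≥0)) (X i) := hX i hi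
      have := h.exists_mem_wienerGraph hW (hle1 i hi) (hσ2.mono_measure
        (Measure.restrict_mono (Set.Ioc_subset_Icc_self.trans
          (Set.Icc_subset_Icc le_rfl (by exact_mod_cast hle1 i hi))) le_rfl))
      rwa [hcast] at this
    choose! z hzg hz1 hz2 using hz
    obtain ⟨ξ, hξ, hξz⟩ := exists_isWhite_increments hW hε hM (le_max_right _ _) hzg hz1
      (v := v) (fun i _ => rfl) hvl
    refine ⟨fun i => √(v i), ⟨ξ, fun j => ε n (j + 1), fun _ _ => 0, hξ,
      fun i _ => MemLp.zero, fun i _ => ?_, fun i hi => ?_⟩, fun i hi => ?_, hτA, fun i hi => ?_⟩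
    · simp only [ne_eq, OfNat.ofNat_ne_zero, not_false_eq_true, zero_pow, integral_zero]
      positivity
    · filter_upwards [hξz i hi, hz2 _ (hmem i hi).1, hz2 _ (hmem i hi).2, hYX _ (hmem i hi).1,
        hYX _ (hmem i hi).2] with ω h1 h2 h3 h4 h5
      rw [h4, h5, ← h1, h2, h3]
      ring
    · rw [Real.sq_sqrt (hvl i hi).le]
      refine (hvu i hi).trans ?_
      gcongr
      linarith
    · rw [Real.sq_sqrt (hvl i hi).le, sub_self, abs_zero]
      positivity
  | spaceTransformed =>
    specialize hLip rfl
    set t : ℕ → ℝ≥0 := fun i => (i : ℝ≥0) / (n : ℝ≥0) with ht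
    have hz1 : ∀ i ∈ Finset.Icc 1 n, (wienerGen hW (t i)).1 =ᵐ[volume]
        (Set.Ioc (0 : ℝ) ((i : ℝ) / n)).indicator fun _ => 1 := fun i _ => by
      have := coeFn_wienerGen_fst hW (t i)
      rwa [hcast] at this
    obtain ⟨ξ, hξ, hξz⟩ := exists_isWhite_increments hW hε hM (le_max_right _ _)
      (fun i hi => wienerGen_mem hW (hle1 i hi)) hz1
      (v := fun _ => 1 / n) (fun i _ => by simp only [one_pow]; rw [integral_one, hlen])
      (fun i _ => by positivity)
    set r : ℕ → ℝ := fun i => σ (((i + 2 : ℕ) : ℝ) / n) - σ (((i + 1 : ℕ) : ℝ) / n) with hr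
    have hr4 : ∀ i ∈ Finset.range (n - 1), r i ^ 4 ≤ L ^ 4 / l ^ 2 / n ^ 4 := by
      intro i hi
      have h1 := hsub i hi (Set.left_mem_Icc.2 (hle i))
      have h2 := hsub i hi (Set.right_mem_Icc.2 (hle i))
      have h3 := hLip _ h2 _ h1
      rw [hlen, abs_of_nonneg (by positivity : (0 : ℝ) ≤ 1 / n)] at h3
      obtain ⟨p1, q1, -⟩ := hσ _ h1
      obtain ⟨p2, -, -⟩ := hσ _ h2
      -- The increment of σ is that of σ² divided by the sum of the two values, and the square of
      -- this sum is at least l.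
      have h4 : r i ^ 2 * l ≤ (L * (1 / n)) ^ 2 := by
        calc r i ^ 2 * l ≤ r i ^ 2 * (σ (((i + 2 : ℕ) : ℝ) / n) + σ (((i + 1 : ℕ) : ℝ) / n)) ^ 2 := by
              gcongr
              nlinarith
          _ = |σ (((i + 2 : ℕ) : ℝ) / n) ^ 2 - σ (((i + 1 : ℕ) : ℝ) / n) ^ 2| ^ 2 := by
              rw [sq_abs]; ring
          _ ≤ _ := by gcongr
      have h5 : r i ^ 2 ≤ (L * (1 / n)) ^ 2 / l := (le_div_iff₀ hl).2 h4
      calc r i ^ 4 = (r i ^ 2) ^ 2 := by ring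
        _ ≤ ((L * (1 / n)) ^ 2 / l) ^ 2 := by gcongr
        _ = _ := by field_simp
    have hW4 := fun i => (memLp_of_map_eq_gaussianReal (hW.aemeasurable (t i))
      (hW.hasLaw_eval (t i)).map_eq)
    have hWm := fun i => (integral_pow_four_of_map_eq_gaussianReal (hW.aemeasurable (t i))
      (hW.hasLaw_eval (t i)).map_eq)
    refine ⟨fun i => σ (((i + 1 : ℕ) : ℝ) / n) * √(1 / n), ⟨ξ, fun j => ε n (j + 1),
      fun i ω => r i * W (t (i + 2)) ω, hξ, fun i _ => (hW4 (i + 2)).const_mul _,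
      fun i hi => ?_, fun i hi => ?_⟩, fun i hi => ?_, hτA, fun i hi => ?_⟩
    · simp only [mul_pow]
      rw [integral_const_mul, hWm, ← hg₄]
      have ht1 : (t (i + 2) : ℝ) ^ 2 ≤ 1 := pow_le_one₀ (t (i + 2)).2
        (by exact_mod_cast hle1 _ (hmem i hi).2)
      calc r i ^ 4 * ((t (i + 2) : ℝ) ^ 2 * g₄) ≤ L ^ 4 / l ^ 2 / n ^ 4 * (1 * g₄) := by
            gcongr
            exact hr4 i hi
        _ = (L ^ 4 / l ^ 2 * g₄) / n ^ 4 := by ring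
        _ ≤ A / n ^ 4 := by
            gcongr
            linarith
    · filter_upwards [hξz i hi, coeFn_wienerGen_snd hW (t (i + 1)),
        coeFn_wienerGen_snd hW (t (i + 2)), hYX _ (hmem i hi).1, hYX _ (hmem i hi).2,
        hX _ (hmem i hi).1, hX _ (hmem i hi).2] with ω h1 h2 h3 h4 h5 h6 h7
      rw [h4, h5, h6, h7, mul_assoc, ← h1, h2, h3, hcast, hcast, hr]
      ring
    · rw [mul_pow, Real.sq_sqrt (by positivity), mul_one_div]
      gcongr
      have := (hσ _ (hsub i hi (Set.left_mem_Icc.2 (hle i)))).2.2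
      linarith
    · have h1 := hsub i hi (Set.left_mem_Icc.2 (hle i))
      have h2 : σ (((i + 1 : ℕ) : ℝ) / n) ^ 2 * (1 / n) =
          ∫ x in ((i + 1 : ℕ) : ℝ) / n..((i + 2 : ℕ) : ℝ) / n, σ (((i + 1 : ℕ) : ℝ) / n) ^ 2 := by
        rw [intervalIntegral.integral_const, hlen, smul_eq_mul, mul_comm]
      rw [mul_pow, Real.sq_sqrt (by positivity), h2,
        ← intervalIntegral.integral_sub intervalIntegrable_const (hint i hi), ← Real.norm_eq_abs]
      refine (intervalIntegral.norm_integral_le_of_norm_le_const (C := L * (1 / n))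
        fun x hx => ?_).trans ?_
      · rw [Set.uIoc_of_le (hle i)] at hx
        rw [Real.norm_eq_abs]
        refine (hLip _ h1 _ (hsub i hi (Set.Ioc_subset_Icc_self hx))).trans ?_
        gcongr
        rw [abs_sub_comm, abs_of_nonneg (by linarith [hx.1])]
        linarith [hx.2, hlen i]
      · rw [hlen, abs_of_nonneg (by positivity), mul_assoc, one_div_mul_one_div, ← pow_two,
          mul_one_div]
        gcongr
        linarith

end Models

/-! ### Cosine series -/

/-- The cosine polynomial `a 0 + 2 ∑_{1 ≤ i ≤ m} a i cos (i π x)`. -/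
noncomputable def cosPoly (a : ℕ → ℝ) (m : ℕ) (x : ℝ) : ℝ :=
  a 0 + 2 * ∑ i ∈ Finset.Icc 1 m, a i * Real.cos (i * Real.pi * x)

@[fun_prop]
lemma continuous_cosPoly (a : ℕ → ℝ) (m : ℕ) : Continuous (cosPoly a m) := by
  unfold cosPoly; fun_prop

lemma integral_cos_natCast_mul_pi {k : ℕ} (hk : k ≠ 0) :
    ∫ x in (0 : ℝ)..1, Real.cos (k * Real.pi * x) = 0 := by
  have hk' : (k : ℝ) * Real.pi ≠ 0 := by positivity
  rw [intervalIntegral.integral_comp_mul_left (fun x => Real.cos x) hk', integral_cos]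
  simp [Real.sin_nat_mul_pi]

lemma integral_cos_mul_cos {i k : ℕ} (hk : k ≠ 0) :
    ∫ x in (0 : ℝ)..1, Real.cos (i * Real.pi * x) * Real.cos (k * Real.pi * x) =
      if i = k then 1 / 2 else 0 := by
  wlog h : i ≤ k generalizing i k
  · have hi : i ≠ 0 := by omega
    have := this (i := k) hi (by omega)
    simp only [mul_comm (Real.cos (k * Real.pi * _))] at this
    rw [this]
    simp [eq_comm]
  have e : ∀ x : ℝ, Real.cos (i * Real.pi * x) * Real.cos (k * Real.pi * x) =
      1 / 2 * (Real.cos ((k - i : ℕ) * Real.pi * x) + Real.cos ((k + i : ℕ) * Real.pi * x)) := by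
    intro x
    have e1 : ((k - i : ℕ) : ℝ) * Real.pi * x = k * Real.pi * x - i * Real.pi * x := by
      rw [Nat.cast_sub h]; ring
    have e2 : ((k + i : ℕ) : ℝ) * Real.pi * x = k * Real.pi * x + i * Real.pi * x := by
      push_cast; ring
    rw [e1, e2, Real.cos_sub, Real.cos_add]
    ring
  simp_rw [e]
  rw [intervalIntegral.integral_const_mul, intervalIntegral.integral_add
    (Continuous.intervalIntegrable (by fun_prop) _ _)
    (Continuous.intervalIntegrable (by fun_prop) _ _),
    integral_cos_natCast_mul_pi (show k + i ≠ 0 by omega)]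
  split_ifs with hik
  · simp [hik]
  · rw [integral_cos_natCast_mul_pi (show k - i ≠ 0 by omega)]
    simp

lemma integral_cosPoly_mul_cos (a : ℕ → ℝ) (m k : ℕ) :
    ∫ x in (0 : ℝ)..1, cosPoly a m x * Real.cos (k * Real.pi * x) = if k ≤ m then a k else 0 := by
  have hc : ∀ i : ℕ, IntervalIntegrable
      (fun x => a i * (Real.cos (i * Real.pi * x) * Real.cos (k * Real.pi * x))) volume 0 1 :=
    fun i => Continuous.intervalIntegrable (by fun_prop) _ _
  have e : ∀ x, cosPoly a m x * Real.cos (k * Real.pi * x) = a 0 * Real.cos (k * Real.pi * x) +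
      2 * ∑ i ∈ Finset.Icc 1 m, a i * (Real.cos (i * Real.pi * x) * Real.cos (k * Real.pi * x)) := by
    intro x
    rw [cosPoly, add_mul, mul_assoc (2 : ℝ), Finset.sum_mul]
    simp only [mul_assoc]
  simp_rw [e]
  rw [intervalIntegral.integral_add (Continuous.intervalIntegrable (by fun_prop) _ _)
    (Continuous.intervalIntegrable (by fun_prop) _ _), intervalIntegral.integral_const_mul,
    intervalIntegral.integral_const_mul, intervalIntegral.integral_finsetSum fun i _ => hc i]
  simp only [intervalIntegral.integral_const_mul]
  rcases eq_or_ne k 0 with rfl | hk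
  · have : ∀ i ∈ Finset.Icc 1 m, a i * ∫ x in (0 : ℝ)..1,
        Real.cos (i * Real.pi * x) * Real.cos ((0 : ℕ) * Real.pi * x) = 0 := fun i hi => by
      have hi' : i ≠ 0 := by simp at hi; omega
      simp [integral_cos_natCast_mul_pi hi']
    rw [Finset.sum_eq_zero this]
    simp
  · rw [integral_cos_natCast_mul_pi hk]
    simp only [integral_cos_mul_cos hk, mul_ite, mul_zero, Finset.sum_ite_eq', Finset.mem_Icc]
    have : 1 ≤ k := by omega
    simp only [this, true_and]
    split_ifs <;> ring

lemma integral_cosPoly_sq (a : ℕ → ℝ) (m : ℕ) :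
    ∫ x in (0 : ℝ)..1, cosPoly a m x ^ 2 = a 0 ^ 2 + 2 * ∑ i ∈ Finset.Icc 1 m, a i ^ 2 := by
  have e : ∀ x, cosPoly a m x ^ 2 = a 0 * (cosPoly a m x * Real.cos ((0 : ℕ) * Real.pi * x)) +
      2 * ∑ i ∈ Finset.Icc 1 m, a i * (cosPoly a m x * Real.cos (i * Real.pi * x)) := by
    intro x
    have : ∑ i ∈ Finset.Icc 1 m, a i * (cosPoly a m x * Real.cos (i * Real.pi * x)) =
        cosPoly a m x * ∑ i ∈ Finset.Icc 1 m, a i * Real.cos (i * Real.pi * x) := by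
      rw [Finset.mul_sum]
      exact Finset.sum_congr rfl fun i _ => by ring
    rw [this, pow_two]
    nth_rw 2 [cosPoly]
    simp
    ring
  simp_rw [e]
  rw [intervalIntegral.integral_add (Continuous.intervalIntegrable (by fun_prop) _ _)
    (Continuous.intervalIntegrable (by fun_prop) _ _), intervalIntegral.integral_const_mul,
    intervalIntegral.integral_const_mul, intervalIntegral.integral_finsetSum fun i _ =>
    Continuous.intervalIntegrable (by fun_prop) _ _]
  simp only [intervalIntegral.integral_const_mul, integral_cosPoly_mul_cos, zero_le, if_true]
  congr 1
  · ring
  · congr 1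
    refine Finset.sum_congr rfl fun i hi => ?_
    rw [if_pos (Finset.mem_Icc.1 hi).2, pow_two]

/-- `θ` are the coefficients of a cosine expansion of `f` on `[0, 1]` of smoothness `α`. -/
structure IsCosExpansion (α C : ℝ) (f : ℝ → ℝ) (θ : ℕ → ℝ) : Prop where
  tendsto : ∀ x ∈ Set.Icc (0 : ℝ) 1, Tendsto (fun m => cosPoly θ m x) atTop (𝓝 (f x))
  summable : Summable fun i : ℕ => ((i + 1 : ℕ) : ℝ) ^ (2 * α) * θ (i + 1) ^ 2
  tsum_le : ∑' i : ℕ, ((i + 1 : ℕ) : ℝ) ^ (2 * α) * θ (i + 1) ^ 2 ≤ C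

lemma exists_isCosExpansion {α C : ℝ} {f : ℝ → ℝ} (hf : f ∈ sobolevS α C) :
    ∃ θ, IsCosExpansion α C f θ := by
  obtain ⟨-, θ, h1, h2, h3⟩ := hf
  exact ⟨θ, h1, h2, h3⟩

lemma summable_natCast_succ_rpow {p : ℝ} (hp : p < -1) :
    Summable fun i : ℕ => ((i + 1 : ℕ) : ℝ) ^ p :=
  (summable_nat_add_iff 1).2 (Real.summable_nat_rpow.2 hp)

lemma Finset.sum_Icc_one_eq_sum_range {M : Type*} [AddCommMonoid M] (g : ℕ → M) (m : ℕ) :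
    ∑ i ∈ Finset.Icc 1 m, g i = ∑ i ∈ Finset.range m, g (i + 1) := by
  rw [Finset.range_eq_Ico, Finset.sum_Ico_add' g 0 m 1]
  rfl

namespace IsCosExpansion

variable {α C : ℝ} {f : ℝ → ℝ} {θ : ℕ → ℝ}

lemma sum_range_le (h : IsCosExpansion α C f θ) (m : ℕ) :
    ∑ i ∈ Finset.range m, ((i + 1 : ℕ) : ℝ) ^ (2 * α) * θ (i + 1) ^ 2 ≤ C :=
  (h.summable.sum_le_tsum _ fun i _ => by positivity).trans h.tsum_le

/-- Write i^r |θ_i| = (i^α |θ_i|) · i^{r-α} and bound the product by the sum of squares. Summing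
gives absolute convergence for r < α - 1/2, used with r = 0 for boundedness and r = 1 for the
Lipschitz property. -/
lemma rpow_mul_abs_le (θ : ℕ → ℝ) (α r : ℝ) (i : ℕ) :
    ((i + 1 : ℕ) : ℝ) ^ r * |θ (i + 1)| ≤
      ((i + 1 : ℕ) : ℝ) ^ (2 * α) * θ (i + 1) ^ 2 + ((i + 1 : ℕ) : ℝ) ^ (2 * r - 2 * α) := by
  have hp : (0 : ℝ) < ((i + 1 : ℕ) : ℝ) := by positivity
  set x := ((i + 1 : ℕ) : ℝ)
  have e1 : x ^ (2 * α) = (x ^ α) ^ 2 := by rw [← Real.rpow_natCast, ← Real.rpow_mul hp.le]; ring_nf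
  have e2 : x ^ (2 * r - 2 * α) = (x ^ (r - α)) ^ 2 := by
    rw [← Real.rpow_natCast, ← Real.rpow_mul hp.le]; ring_nf
  have e3 : x ^ r = x ^ α * x ^ (r - α) := by rw [← Real.rpow_add hp]; ring_nf
  rw [e1, e2, e3, ← sq_abs (θ (i + 1))]
  nlinarith [sq_nonneg (x ^ α * |θ (i + 1)| - x ^ (r - α)), sq_nonneg (x ^ α * |θ (i + 1)|),
    sq_nonneg (x ^ (r - α))]

lemma sum_rpow_mul_abs_le (h : IsCosExpansion α C f θ) {r : ℝ} (hr : 2 * r - 2 * α < -1) (m : ℕ) :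
    ∑ i ∈ Finset.range m, ((i + 1 : ℕ) : ℝ) ^ r * |θ (i + 1)| ≤
      C + ∑' i : ℕ, ((i + 1 : ℕ) : ℝ) ^ (2 * r - 2 * α) := by
  refine (Finset.sum_le_sum fun i _ => rpow_mul_abs_le θ α r i).trans ?_
  rw [Finset.sum_add_distrib]
  exact add_le_add (h.sum_range_le m)
    ((summable_natCast_succ_rpow hr).sum_le_tsum _ fun i _ => by positivity)

lemma abs_cosPoly_le (h : IsCosExpansion α C f θ) (hα : 1 / 2 < α) (m : ℕ) (x : ℝ) :
    |cosPoly θ m x| ≤ |θ 0| + 2 * (C + ∑' i : ℕ, ((i + 1 : ℕ) : ℝ) ^ (2 * (0 : ℝ) - 2 * α)) := by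
  have h1 := h.sum_rpow_mul_abs_le (r := 0) (by linarith) m
  simp only [Real.rpow_zero, one_mul] at h1
  rw [cosPoly]
  refine (abs_add_le _ _).trans (add_le_add le_rfl ?_)
  rw [abs_mul, abs_two, Finset.sum_Icc_one_eq_sum_range]
  refine mul_le_mul_of_nonneg_left (le_trans ((Finset.abs_sum_le_sum_abs _ _).trans
    (Finset.sum_le_sum fun i _ => ?_)) h1) zero_le_two
  rw [abs_mul]
  exact mul_le_of_le_one_right (abs_nonneg _) (Real.abs_cos_le_one _)

/-- For α > 3/2 the series Σ i |θ_i| converges, so the partial sums are Lipschitz with a common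
constant, and this passes to the pointwise limit. -/
lemma abs_sub_le (h : IsCosExpansion α C f θ) (hα : 3 / 2 < α) {x y : ℝ}
    (hx : x ∈ Set.Icc (0 : ℝ) 1) (hy : y ∈ Set.Icc (0 : ℝ) 1) :
    |f x - f y| ≤
      2 * Real.pi * (C + ∑' i : ℕ, ((i + 1 : ℕ) : ℝ) ^ (2 * (1 : ℝ) - 2 * α)) * |x - y| := by
  refine le_of_tendsto ((h.tendsto x hx).sub (h.tendsto y hy)).abs (Eventually.of_forall fun m => ?_)
  have h1 := h.sum_rpow_mul_abs_le (r := 1) (by linarith) m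
  have e : cosPoly θ m x - cosPoly θ m y = 2 * ∑ i ∈ Finset.range m, θ (i + 1) *
      (Real.cos ((i + 1 : ℕ) * Real.pi * x) - Real.cos ((i + 1 : ℕ) * Real.pi * y)) := by
    simp only [cosPoly, Finset.sum_Icc_one_eq_sum_range, mul_sub, Finset.sum_sub_distrib]
    ring
  rw [e, abs_mul, abs_two, mul_assoc, mul_assoc]
  refine mul_le_mul_of_nonneg_left ?_ zero_le_two
  calc |∑ i ∈ Finset.range m, θ (i + 1) *
      (Real.cos ((i + 1 : ℕ) * Real.pi * x) - Real.cos ((i + 1 : ℕ) * Real.pi * y))|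
      ≤ ∑ i ∈ Finset.range m, Real.pi * |x - y| * (((i + 1 : ℕ) : ℝ) ^ (1 : ℝ) * |θ (i + 1)|) := by
        refine (Finset.abs_sum_le_sum_abs _ _).trans (Finset.sum_le_sum fun i _ => ?_)
        have h2 := Real.abs_cos_sub_cos_le ((i + 1 : ℕ) * Real.pi * x) ((i + 1 : ℕ) * Real.pi * y)
        rw [← mul_sub, abs_mul, abs_of_nonneg (by positivity : 0 ≤ ((i + 1 : ℕ) : ℝ) * Real.pi)]
          at h2
        rw [abs_mul, Real.rpow_one]
        calc _ ≤ |θ (i + 1)| * (((i + 1 : ℕ) : ℝ) * Real.pi * |x - y|) := by gcongr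
          _ = _ := by ring
    _ ≤ _ := by
        rw [← Finset.mul_sum]
        refine (mul_le_mul_of_nonneg_left h1 (by positivity)).trans_eq ?_
        ring

/-- The partial sums are uniformly bounded, so dominated convergence allows integration term by term
and orthogonality picks out θ_k. -/
lemma integral_mul_cos (h : IsCosExpansion α C f θ) (hα : 1 / 2 < α) (k : ℕ) :
    ∫ x in (0 : ℝ)..1, f x * Real.cos (k * Real.pi * x) = θ k := by
  have h1 : Tendsto (fun m => ∫ x in (0 : ℝ)..1, cosPoly θ m x * Real.cos (k * Real.pi * x)) atTop
      (𝓝 (∫ x in (0 : ℝ)..1, f x * Real.cos (k * Real.pi * x))) := by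
    refine intervalIntegral.tendsto_integral_filter_of_dominated_convergence
      (fun _ => |θ 0| + 2 * (C + ∑' i : ℕ, ((i + 1 : ℕ) : ℝ) ^ (2 * (0 : ℝ) - 2 * α)))
      (Eventually.of_forall fun m => Continuous.aestronglyMeasurable (by fun_prop))
      (Eventually.of_forall fun m => ae_of_all _ fun x _ => ?_) intervalIntegrable_const
      (ae_of_all _ fun x hx => ?_)
    · rw [norm_mul, Real.norm_eq_abs, Real.norm_eq_abs]
      exact (mul_le_of_le_one_right (abs_nonneg _) (Real.abs_cos_le_one _)).trans
        (h.abs_cosPoly_le hα m x)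
    · rw [Set.uIoc_of_le zero_le_one] at hx
      exact (h.tendsto x (Set.Ioc_subset_Icc_self hx)).mul_const _
  refine tendsto_nhds_unique h1 (tendsto_const_nhds.congr' ?_)
  filter_upwards [eventually_ge_atTop k] with m hm
  rw [integral_cosPoly_mul_cos, if_pos hm]

lemma sum_Ioc_sq_le (h : IsCosExpansion α C f θ) (hα : 0 ≤ α) {N : ℕ} (hN : 1 ≤ N) (m : ℕ) :
    ∑ i ∈ Finset.Ioc N m, θ i ^ 2 ≤ C * (N : ℝ) ^ (-(2 * α)) := by
  have hN' : (0 : ℝ) < N := by exact_mod_cast hN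
  have h1 : ∑ i ∈ Finset.Ioc N m, (i : ℝ) ^ (2 * α) * θ i ^ 2 ≤ C := by
    refine le_trans ?_ (h.sum_range_le m)
    rw [← Finset.sum_Icc_one_eq_sum_range fun i : ℕ => (i : ℝ) ^ (2 * α) * θ i ^ 2]
    refine Finset.sum_le_sum_of_subset_of_nonneg (fun i hi => ?_) fun i _ _ => by positivity
    simp at hi ⊢; omega
  rw [Real.rpow_neg hN'.le, ← div_eq_mul_inv, le_div_iff₀ (by positivity), Finset.sum_mul]
  refine le_trans (Finset.sum_le_sum fun i hi => ?_) h1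
  rw [mul_comm]
  have : N ≤ i := (Finset.mem_Ioc.1 hi).1.le
  gcongr

/-- Fatou's lemma replaces f by its partial sums; for each of these the error is a cosine polynomial
and its L² norm is explicit. Beyond N only the tail of θ remains, and i^{2α} ≥ N^{2α} there. -/
lemma lintegral_sq_cosPoly_sub_le (h : IsCosExpansion α C f θ) (hα : 0 ≤ α) {N : ℕ} (hN : 1 ≤ N)
    (a : ℕ → ℝ) :
    ∫⁻ x in Set.Icc (0 : ℝ) 1, ENNReal.ofReal ((cosPoly a N x - f x) ^ 2) ≤
      ENNReal.ofReal ((a 0 - θ 0) ^ 2 + 2 * ∑ i ∈ Finset.Icc 1 N, (a i - θ i) ^ 2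
        + 2 * (C * (N : ℝ) ^ (-(2 * α)))) := by
  have e1 : ∫⁻ x in Set.Icc (0 : ℝ) 1, ENNReal.ofReal ((cosPoly a N x - f x) ^ 2) =
      ∫⁻ x in Set.Icc (0 : ℝ) 1,
        liminf (fun m => ENNReal.ofReal ((cosPoly a N x - cosPoly θ m x) ^ 2)) atTop := by
    refine setLIntegral_congr_fun measurableSet_Icc fun x hx => (Tendsto.liminf_eq ?_).symm
    exact ENNReal.tendsto_ofReal (((h.tendsto x hx).const_sub _).pow 2)
  rw [e1]
  refine (lintegral_liminf_le fun m => by fun_prop).trans ?_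
  refine liminf_le_of_frequently_le' (Eventually.frequently ?_)
  filter_upwards [eventually_ge_atTop N] with m hm
  set b : ℕ → ℝ := fun i => (if i ≤ N then a i else 0) - θ i with hb
  have e2 : ∀ x, cosPoly a N x - cosPoly θ m x = cosPoly b m x := by
    intro x
    have : ∑ i ∈ Finset.Icc 1 N, a i * Real.cos (i * Real.pi * x) =
        ∑ i ∈ Finset.Icc 1 m, (if i ≤ N then a i else 0) * Real.cos (i * Real.pi * x) := by
      rw [← Finset.sum_subset (Finset.Icc_subset_Icc_right hm) fun i hi hi' => ?_]
      · exact Finset.sum_congr rfl fun i hi => by rw [if_pos (Finset.mem_Icc.1 hi).2]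
      · have : ¬ i ≤ N := fun h => hi' (Finset.mem_Icc.2 ⟨(Finset.mem_Icc.1 hi).1, h⟩)
        simp [this]
    simp only [cosPoly, this, hb, sub_mul, Finset.sum_sub_distrib, zero_le, if_true]
    ring
  simp only [e2]
  rw [← ofReal_integral_eq_lintegral_ofReal
    (Continuous.integrableOn_Icc (by fun_prop)) (ae_of_all _ fun x => by positivity),
    integral_Icc_eq_integral_Ioc, ← intervalIntegral.integral_of_le zero_le_one,
    integral_cosPoly_sq]
  refine ENNReal.ofReal_le_ofReal ?_
  have e3 : ∑ i ∈ Finset.Icc 1 m, b i ^ 2 =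
      ∑ i ∈ Finset.Icc 1 N, (a i - θ i) ^ 2 + ∑ i ∈ Finset.Ioc N m, θ i ^ 2 := by
    have hu : Finset.Icc 1 m = Finset.Icc 1 N ∪ Finset.Ioc N m := by ext i; simp; omega
    rw [hu, Finset.sum_union (Finset.disjoint_left.2 fun i hi => by simp at hi ⊢; omega)]
    congr 1
    · exact Finset.sum_congr rfl fun i hi => by simp [hb, (Finset.mem_Icc.1 hi).2]
    · exact Finset.sum_congr rfl fun i hi => by
        simp [hb, not_le.2 (Finset.mem_Ioc.1 hi).1]
  have h4 := h.sum_Ioc_sq_le hα hN m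
  rw [e3]
  simp only [hb, zero_le, if_true]
  linarith

end IsCosExpansion

/-- The integral of `f` against the square of `halfCos k`. -/
lemma IsCosExpansion.integral_mul_halfCos_sq {α C : ℝ} {f : ℝ → ℝ} {θ : ℕ → ℝ}
    (h : IsCosExpansion α C f θ) (hα : 1 / 2 < α)
    (hf : IntervalIntegrable f volume 0 1) (k : ℕ) :
    ∫ x in (0 : ℝ)..1, f x * halfCos k x ^ 2 = if k = 0 then θ 0 else θ 0 + θ k := by
  have h0 := h.integral_mul_cos hα 0
  simp only [Nat.cast_zero, zero_mul, Real.cos_zero, mul_one] at h0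
  simp only [halfCos_sq]
  split_ifs
  · simpa using h0
  · simp only [mul_add, mul_one]
    rw [intervalIntegral.integral_add hf (hf.mul_continuousOn (by fun_prop)), h0,
      h.integral_mul_cos hα]

lemma abs_halfCos_sq_sub_le (k : ℕ) (x y : ℝ) :
    |halfCos k x ^ 2 - halfCos k y ^ 2| ≤ k * Real.pi * |x - y| := by
  simp only [halfCos_sq]
  split_ifs with hk
  · simp [hk]
  · rw [add_sub_add_left_eq_sub]
    refine (Real.abs_cos_sub_cos_le _ _).trans_eq ?_
    rw [← mul_sub, abs_mul, abs_of_nonneg (by positivity : 0 ≤ (k : ℝ) * Real.pi)]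

/-! ### Riemann sums -/

/-- There is no increment for the first cell (0, 1/n], which accounts for the 2u/n. On every other
cell f_k² is frozen at the left end, at cost u kπ/n², while g is compared only through its cell
integral, so no regularity of g enters beyond `hs`. -/
lemma abs_sum_mul_halfCos_sq_sub_integral_le {n k : ℕ} (hn : 0 < n) {g : ℝ → ℝ} {s : ℕ → ℝ}
    {A u : ℝ} (hA : 0 ≤ A) (hu : 0 ≤ u)
    (hg : IntervalIntegrable g volume 0 1) (hgu : ∀ x ∈ Set.Icc (0 : ℝ) 1, |g x| ≤ u)
    (hs : ∀ i ∈ Finset.range (n - 1),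
      |s i - ∫ x in ((i + 1 : ℕ) : ℝ) / n..((i + 2 : ℕ) : ℝ) / n, g x| ≤ A / n ^ 2) :
    |∑ i ∈ Finset.range (n - 1), s i * halfCos k (((i + 1 : ℕ) : ℝ) / n) ^ 2
        - ∫ x in (0 : ℝ)..1, g x * halfCos k x ^ 2| ≤ (2 * A + 2 * u + Real.pi * u) * (k + 1) / n := by
  have hn' : (0 : ℝ) < n := by exact_mod_cast hn
  have hle : ∀ i : ℕ, ((i + 1 : ℕ) : ℝ) / n ≤ ((i + 1 + 1 : ℕ) : ℝ) / n := fun i => by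
    gcongr; omega
  have hlen : ∀ i : ℕ, ((i + 1 + 1 : ℕ) : ℝ) / n - ((i + 1 : ℕ) : ℝ) / n = 1 / n := fun i => by
    rw [← sub_div]; push_cast; ring
  have hIcc : ∀ i : ℕ, i ≤ n → (i : ℝ) / n ∈ Set.Icc (0 : ℝ) 1 := fun i hi =>
    ⟨by positivity, (div_le_one hn').2 (by exact_mod_cast hi)⟩
  have hsub : ∀ i ∈ Finset.range (n - 1),
      Set.Icc (((i + 1 : ℕ) : ℝ) / n) (((i + 1 + 1 : ℕ) : ℝ) / n) ⊆ Set.Icc 0 1 := fun i hi =>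
    Set.Icc_subset_Icc (hIcc _ (by simp at hi; omega)).1 (hIcc _ (by simp at hi; omega)).2
  have hc : Continuous fun x => halfCos k x ^ 2 := by
    simp only [halfCos_sq]
    split_ifs <;> fun_prop
  have hgi : ∀ i ∈ Finset.range (n - 1), IntervalIntegrable g volume
      (((i + 1 : ℕ) : ℝ) / n) (((i + 1 + 1 : ℕ) : ℝ) / n) := fun i hi =>
    hg.mono_set (by
      rw [Set.uIcc_of_le (hle i), Set.uIcc_of_le zero_le_one]
      exact hsub i hi)
  have h1n : (1 : ℝ) / n ∈ Set.Icc (0 : ℝ) 1 := by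
    simpa using hIcc 1 hn
  have hprod : IntervalIntegrable (fun x => g x * halfCos k x ^ 2) volume 0 1 :=
    hg.mul_continuousOn hc.continuousOn
  have hsplit : ∫ x in (0 : ℝ)..1, g x * halfCos k x ^ 2 =
      (∫ x in (0 : ℝ)..1 / n, g x * halfCos k x ^ 2) + ∑ i ∈ Finset.range (n - 1),
        ∫ x in ((i + 1 : ℕ) : ℝ) / n..((i + 1 + 1 : ℕ) : ℝ) / n, g x * halfCos k x ^ 2 := by
    rw [intervalIntegral.sum_integral_adjacent_intervals
      (a := fun i => ((i + 1 : ℕ) : ℝ) / n) fun i hi => (hgi i (Finset.mem_range.2 hi)).mul_continuousOn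
        hc.continuousOn]
    have e : (((n - 1 + 1 : ℕ) : ℝ) / n) = 1 := by
      rw [Nat.sub_add_cancel hn, div_self hn'.ne']
    rw [e, zero_add, Nat.cast_one]
    refine (intervalIntegral.integral_add_adjacent_intervals ?_ ?_).symm
    · exact hprod.mono_set (by
        rw [Set.uIcc_of_le h1n.1, Set.uIcc_of_le zero_le_one]
        exact Set.Icc_subset_Icc_right h1n.2)
    · exact hprod.mono_set (by
        rw [Set.uIcc_of_le h1n.2, Set.uIcc_of_le zero_le_one]
        exact Set.Icc_subset_Icc_left h1n.1)
  have hfirst : |∫ x in (0 : ℝ)..1 / n, g x * halfCos k x ^ 2| ≤ 2 * u / n := by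
    rw [← Real.norm_eq_abs]
    refine (intervalIntegral.norm_integral_le_of_norm_le_const (C := u * 2) fun x hx => ?_).trans_eq ?_
    · rw [Set.uIoc_of_le h1n.1] at hx
      rw [norm_mul, Real.norm_eq_abs, Real.norm_eq_abs, abs_of_nonneg (sq_nonneg (halfCos k x))]
      exact mul_le_mul (hgu x ⟨hx.1.le, hx.2.trans h1n.2⟩) (halfCos_sq_le _ _) (sq_nonneg _) hu
    · rw [sub_zero, abs_of_nonneg (by positivity)]
      ring
  have hstep : ∀ i ∈ Finset.range (n - 1), |s i * halfCos k (((i + 1 : ℕ) : ℝ) / n) ^ 2 -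
      ∫ x in ((i + 1 : ℕ) : ℝ) / n..((i + 1 + 1 : ℕ) : ℝ) / n, g x * halfCos k x ^ 2| ≤
      (2 * A + Real.pi * u * k) / n ^ 2 := by
    intro i hi
    set a := ((i + 1 : ℕ) : ℝ) / n
    set b := ((i + 1 + 1 : ℕ) : ℝ) / n
    have e : s i * halfCos k a ^ 2 - ∫ x in a..b, g x * halfCos k x ^ 2 =
        (s i - ∫ x in a..b, g x) * halfCos k a ^ 2 +
        ∫ x in a..b, g x * (halfCos k a ^ 2 - halfCos k x ^ 2) := by
      simp only [mul_sub]
      rw [intervalIntegral.integral_sub ((hgi i hi).mul_const _)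
        ((hgi i hi).mul_continuousOn hc.continuousOn), intervalIntegral.integral_mul_const]
      ring
    have e1 : |(s i - ∫ x in a..b, g x) * halfCos k a ^ 2| ≤ A / n ^ 2 * 2 := by
      rw [abs_mul, abs_of_nonneg (sq_nonneg (halfCos k a))]
      exact mul_le_mul (hs i hi) (halfCos_sq_le _ _) (sq_nonneg _) (by positivity)
    have e2 : |∫ x in a..b, g x * (halfCos k a ^ 2 - halfCos k x ^ 2)| ≤
        u * (k * Real.pi * (1 / n)) * (1 / n) := by
      rw [← Real.norm_eq_abs]
      refine (intervalIntegral.norm_integral_le_of_norm_le_const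
        (C := u * (k * Real.pi * (1 / n))) fun x hx => ?_).trans_eq ?_
      · rw [Set.uIoc_of_le (hle i)] at hx
        rw [norm_mul, Real.norm_eq_abs, Real.norm_eq_abs]
        refine mul_le_mul (hgu x (hsub i hi (Set.Ioc_subset_Icc_self hx))) ?_ (abs_nonneg _) hu
        refine (abs_halfCos_sq_sub_le k a x).trans ?_
        gcongr
        rw [abs_sub_comm, abs_of_nonneg (by linarith [hx.1]), ← hlen i]
        linarith [hx.2]
      · rw [hlen, abs_of_nonneg (by positivity)]
    rw [e]
    refine (abs_add_le _ _).trans ((add_le_add e1 e2).trans_eq ?_)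
    field_simp
  rw [hsplit, sub_add_eq_sub_sub, sub_right_comm, ← Finset.sum_sub_distrib]
  refine (abs_sub _ _).trans ((add_le_add ((Finset.abs_sum_le_sum_abs _ _).trans
    (Finset.sum_le_sum hstep)) hfirst).trans ?_)
  rw [Finset.sum_const, Finset.card_range, nsmul_eq_mul]
  have h1 : ((n - 1 : ℕ) : ℝ) ≤ n := by exact_mod_cast Nat.sub_le _ _
  have hk : (0 : ℝ) ≤ k := k.cast_nonneg
  calc ((n - 1 : ℕ) : ℝ) * ((2 * A + Real.pi * u * k) / n ^ 2) + 2 * u / n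
      ≤ n * ((2 * A + Real.pi * u * k) / n ^ 2) + 2 * u / n := by gcongr
    _ = (2 * A + Real.pi * u * k + 2 * u) / n := by field_simp
    _ ≤ _ := by
        gcongr
        have : 0 ≤ Real.pi * u := by positivity
        nlinarith [mul_nonneg hA hk, mul_nonneg hu hk]

/-! ### The risk for a fixed cut-off -/

section Risk

variable {Ω : Type*} [MeasurableSpace Ω] {μ : Measure Ω} [IsProbabilityMeasure μ]

/-- The coefficient error for k ≥ 1 is d_k - d_0, since θ_0 cancels. Each contributes at most 4K in
mean, twice in Parseval, and the constant term contributes K: in total K + 8NK ≤ 9NK. -/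
lemma mise_sigmaSqHat_le {α C K : ℝ} {f : ℝ → ℝ} {θ : ℕ → ℝ} (h : IsCosExpansion α C f θ)
    (hα : 0 ≤ α) (hC : 0 ≤ C) (hK : 0 ≤ K) {n N : ℕ} (hN : 1 ≤ N) {Y : ℕ → Ω → ℝ}
    (hs : ∀ k ≤ N,
      MemLp (fun ω => sHat n k (fun i => Y i ω) - if k = 0 then θ 0 else θ 0 + θ k) 2 μ ∧
      ∫ ω, (sHat n k (fun i => Y i ω) - if k = 0 then θ 0 else θ 0 + θ k) ^ 2 ∂μ ≤ K) :
    mise μ (fun ω => sigmaSqHat n N fun i => Y i ω) f ≤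
      ENNReal.ofReal (9 * (N * K) + 2 * (C * (N : ℝ) ^ (-(2 * α)))) := by
  set d : ℕ → Ω → ℝ := fun k ω => sHat n k (fun i => Y i ω) - if k = 0 then θ 0 else θ 0 + θ k
    with hd
  have hint : ∀ k ≤ N, Integrable (fun ω => d k ω ^ 2) μ := fun k hk => (hs k hk).1.integrable_sq
  have hint2 : Integrable (fun ω => ∑ i ∈ Finset.Icc 1 N, (2 * d i ω ^ 2 + 2 * d 0 ω ^ 2)) μ :=
    integrable_finsetSum _ fun i hi => Integrable.fun_add
      ((hint i (Finset.mem_Icc.1 hi).2).const_mul 2) ((hint 0 N.zero_le).const_mul 2)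
  have hpt : ∀ ω, ∫⁻ t in Set.Icc (0 : ℝ) 1,
      ENNReal.ofReal ((sigmaSqHat n N (fun i => Y i ω) t - f t) ^ 2) ≤
      ENNReal.ofReal (d 0 ω ^ 2 + 2 * ∑ i ∈ Finset.Icc 1 N, (2 * d i ω ^ 2 + 2 * d 0 ω ^ 2)
        + 2 * (C * (N : ℝ) ^ (-(2 * α)))) := by
    intro ω
    set a : ℕ → ℝ := fun k => if k = 0 then sHat n 0 (fun i => Y i ω) else
      sHat n k (fun i => Y i ω) - sHat n 0 (fun i => Y i ω) with ha
    have e : ∀ t, sigmaSqHat n N (fun i => Y i ω) t = cosPoly a N t := fun t => by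
      simp only [sigmaSqHat, cosPoly, ha, if_true]
      congr 2
      refine Finset.sum_congr rfl fun i hi => ?_
      rw [if_neg (by simp at hi; omega)]
    simp only [e]
    refine (h.lintegral_sq_cosPoly_sub_le hα hN a).trans (ENNReal.ofReal_le_ofReal ?_)
    have e0 : a 0 - θ 0 = d 0 ω := by simp [ha, hd]
    rw [e0]
    gcongr with i hi
    · have hi' : i ≠ 0 := by simp at hi; omega
      have : a i - θ i = d i ω - d 0 ω := by
        simp only [ha, hd, if_neg hi', if_true]
        ring
      rw [this]
      nlinarith [sq_nonneg (d i ω + d 0 ω)]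
  refine (lintegral_mono hpt).trans ?_
  rw [← ofReal_integral_eq_lintegral_ofReal
    (((hint 0 N.zero_le).fun_add (hint2.const_mul 2)).fun_add (integrable_const _))
    (ae_of_all _ fun ω => by positivity)]
  refine ENNReal.ofReal_le_ofReal ?_
  rw [integral_add ((hint 0 N.zero_le).fun_add (hint2.const_mul 2)) (integrable_const _),
    integral_add (hint 0 N.zero_le) (hint2.const_mul 2), integral_const_mul,
    integral_finsetSum _ fun i hi => Integrable.fun_add
      ((hint i (Finset.mem_Icc.1 hi).2).const_mul 2) ((hint 0 N.zero_le).const_mul 2)]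
  have h0 : ∫ ω, d 0 ω ^ 2 ∂μ ≤ K := (hs 0 N.zero_le).2
  have h1 : ∑ i ∈ Finset.Icc 1 N, ∫ ω, (2 * d i ω ^ 2 + 2 * d 0 ω ^ 2) ∂μ ≤ N * (4 * K) := by
    refine (Finset.sum_le_card_nsmul _ _ (4 * K) fun i hi => ?_).trans_eq ?_
    · have hiN := (Finset.mem_Icc.1 hi).2
      rw [integral_add ((hint i hiN).const_mul 2) ((hint 0 N.zero_le).const_mul 2),
        integral_const_mul, integral_const_mul]
      have : ∫ ω, d i ω ^ 2 ∂μ ≤ K := (hs i hiN).2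
      linarith
    · simp
  rw [integral_const, probReal_univ, one_smul]
  have hN' : (1 : ℝ) ≤ N := by exact_mod_cast hN
  nlinarith

lemma integral_sq_add_const_le {X : Ω → ℝ} {c K : ℝ} (hX : MemLp X 2 μ)
    (hK : ∫ ω, X ω ^ 2 ∂μ ≤ K) (hc : c ^ 2 ≤ K) :
    MemLp (fun ω => X ω + c) 2 μ ∧ ∫ ω, (X ω + c) ^ 2 ∂μ ≤ 4 * K := by
  have h := hX.add (memLp_const c)
  refine ⟨h, ?_⟩
  have h1 : ∫ ω, (X ω + c) ^ 2 ∂μ ≤ ∫ ω, (2 * X ω ^ 2 + 2 * c ^ 2) ∂μ :=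
    integral_mono h.integrable_sq ((hX.integrable_sq.const_mul 2).fun_add (integrable_const _))
      fun ω => by nlinarith [sq_nonneg (X ω - c)]
  rw [integral_add (hX.integrable_sq.const_mul 2) (integrable_const _), integral_const_mul,
    integral_const, probReal_univ, one_smul] at h1
  linarith

end Risk

/-! ### The worst case risk -/

/-- The class constrains only σ², so measurability of σ is recovered by taking the square root,
positivity on [0,1] fixing the sign. -/
lemma IsRootOf.memLp {α C l u : ℝ} {σ : ℝ → ℝ} (h : IsRootOf α C l u σ) :
    MemLp σ 2 (volume.restrict (Set.Icc (0 : ℝ) 1)) := by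
  have hf : MemLp (fun x => σ x ^ 2) 2 (volume.restrict (Set.Icc (0 : ℝ) 1)) := h.2.1.1
  have hm : AEStronglyMeasurable σ (volume.restrict (Set.Icc (0 : ℝ) 1)) := by
    refine (Real.continuous_sqrt.comp_aestronglyMeasurable hf.1).congr ?_
    filter_upwards [ae_restrict_mem measurableSet_Icc] with x hx
    exact Real.sqrt_sq (h.1 x hx).le
  exact (memLp_two_iff_integrable_sq hm).2 (hf.integrable (by norm_num))

/-- The squared Riemann sum error is thus absorbed into the stochastic error n^{-1/2}. -/
lemma sq_div_le_of_pow_four_le {n k : ℕ} (hn : 0 < n) (hk : (k : ℝ) ^ 4 ≤ n) :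
    (((k : ℝ) + 1) / n) ^ 2 ≤ 4 / √n := by
  have hn' : (1 : ℝ) ≤ n := by exact_mod_cast hn
  have h1 : (1 : ℝ) ≤ √n := Real.one_le_sqrt.2 hn'
  have h2 : √(n : ℝ) ^ 2 = n := Real.sq_sqrt (by positivity)
  have h3 : (k : ℝ) ^ 2 ≤ √n := Real.le_sqrt_of_sq_le (by nlinarith)
  rw [div_pow, div_le_div_iff₀ (by positivity) (by positivity)]
  have h4 : ((k : ℝ) + 1) ^ 2 ≤ 4 * √n := by nlinarith [sq_nonneg ((k : ℝ) - 1)]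
  calc ((k : ℝ) + 1) ^ 2 * √n ≤ 4 * √n * √n := by gcongr
    _ = 4 * n := by rw [mul_assoc, ← pow_two, h2]
    _ ≤ 4 * (n : ℝ) ^ 2 := by nlinarith

section WorstMise

variable {Ω : Type*} [MeasurableSpace Ω]

/-- The constants of the increment representation depend only on the class bounds and the moments,
so one C works for every σ, τ and version of the data, and for all N with N⁴ ≤ n simultaneously. -/
lemma exists_worstMise_le (μ : Measure Ω) [IsProbabilityMeasure μ]
    {W : ℝ≥0 → Ω → ℝ} (hW : IsPreBrownianReal W μ)
    {ε : ℕ → ℕ → Ω → ℝ} (hε : IsMicroNoise μ W ε)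
    (m : VolModel) {α β Q Q' σmin σmax τmin τmax : ℝ} (hQ : 0 < Q) (hσmin : 0 < σmin)
    (hσ : σmin < σmax) (hτmin : 0 < τmin) (hτ : τmin < τmax) (hα : 1 / 2 < α)
    (hαm : m = VolModel.spaceTransformed → 3 / 2 < α) :
    ∃ C : ℝ, 0 ≤ C ∧ ∀ᶠ n : ℕ in atTop, ∀ N : ℕ, 1 ≤ N → (N : ℝ) ^ 4 ≤ n →
      worstMise m μ W ε α Q σmin σmax β Q' τmin τmax n N
        ≤ ENNReal.ofReal (C * riskBound α n N) := by
  set L := 2 * Real.pi * (Q + ∑' i : ℕ, ((i + 1 : ℕ) : ℝ) ^ (2 * (1 : ℝ) - 2 * α)) with hL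
  have hL0 : 0 ≤ L := by
    have : 0 ≤ ∑' i : ℕ, ((i + 1 : ℕ) : ℝ) ^ (2 * (1 : ℝ) - 2 * α) :=
      tsum_nonneg fun i => by positivity
    positivity
  have hu : 0 ≤ σmax := (hσmin.trans hσ).le
  obtain ⟨M, A, hM, hA, hmodel⟩ := exists_hasNoisyIncrements hW hε m (u := σmax) (u' := τmax)
    hσmin hL0 hu (hτmin.trans hτ).le
  obtain ⟨K, hK, hev⟩ := eventually_integral_sq_sHat_sub_le μ hM hA
  set B := 2 * A + 2 * σmax + Real.pi * σmax with hB
  have hB0 : 0 ≤ B := by positivity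
  set K' := K + 4 * B ^ 2 with hK'
  have hK'0 : 0 ≤ K' := by positivity
  refine ⟨36 * K' + 2 * Q, by positivity, ?_⟩
  filter_upwards [hev, eventually_gt_atTop 0] with n hn hn0 N hN hNn
  have hn' : (0 : ℝ) < n := by exact_mod_cast hn0
  refine iSup_le fun σ => iSup_le fun τ => iSup_le fun Y => iSup_le fun hσr => iSup_le fun hτr =>
    iSup_le fun hY => ?_
  obtain ⟨θ, hθ⟩ := exists_isCosExpansion hσr.2.1
  obtain ⟨s, hs, hs2, hb, hsv⟩ := hmodel n σ τ Y hn0 hσr.memLp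
    (fun x hx => ⟨hσr.1 x hx, hσr.2.2 x hx⟩)
    (fun hm x hx y hy => hθ.abs_sub_le (hαm hm) hx hy) (fun x hx => (hτr.2.2 x hx).2) hY
  have hint : IntervalIntegrable (fun x => σ x ^ 2) volume 0 1 :=
    (intervalIntegrable_iff_integrableOn_Icc_of_le zero_le_one).2 hσr.memLp.integrable_sq
  have hrisk : ∀ k ≤ N,
      MemLp (fun ω => sHat n k (fun i => Y i ω) - if k = 0 then θ 0 else θ 0 + θ k) 2 μ ∧
      ∫ ω, (sHat n k (fun i => Y i ω) - if k = 0 then θ 0 else θ 0 + θ k) ^ 2 ∂μ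
        ≤ 4 * (K' / √n) := by
    intro k hk
    have hkn : (k : ℝ) ^ 4 ≤ n := le_trans (by gcongr) hNn
    obtain ⟨h1, h2⟩ := hn k Y s _ hkn hs hs2 hb
    have h3 := abs_sum_mul_halfCos_sq_sub_integral_le (k := k) hn0 hA hu hint
      (fun x hx => by
        rw [abs_of_nonneg (sq_nonneg (σ x))]
        exact (hσr.2.2 x hx).2) hsv
    rw [hθ.integral_mul_halfCos_sq hα hint] at h3
    -- The constant c is the deterministic Riemann error, so that random error plus c is the
    -- distance to the cosine coefficients.
    have h4 := integral_sq_add_const_le h1 (K := K' / √n)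
      (c := ∑ i ∈ Finset.range (n - 1), s i ^ 2 * halfCos k (((i + 1 : ℕ) : ℝ) / n) ^ 2 -
        if k = 0 then θ 0 else θ 0 + θ k) (h2.trans (by gcongr; nlinarith)) (by
        rw [← sq_abs]
        calc _ ≤ (B * (k + 1) / n) ^ 2 := by gcongr
          _ = B ^ 2 * ((k + 1) / n) ^ 2 := by ring
          _ ≤ B ^ 2 * (4 / √n) := by
              gcongr
              exact sq_div_le_of_pow_four_le hn0 hkn
          _ = (4 * B ^ 2) / √n := by ring
          _ ≤ K' / √n := by gcongr; linarith)
    simpa only [sub_add_sub_cancel] using h4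
  refine (mise_sigmaSqHat_le hθ (by linarith) hQ.le (by positivity) hN hrisk).trans
    (ENNReal.ofReal_le_ofReal ?_)
  have hsq : (n : ℝ) ^ (-(1 / 2) : ℝ) = 1 / √n := by
    rw [Real.rpow_neg hn'.le, ← Real.sqrt_eq_rpow, one_div]
  rw [riskBound, hsq]
  have hp : 0 ≤ (N : ℝ) ^ (-(2 * α)) := by positivity
  have hq : 0 ≤ (N : ℝ) * (1 / √n) := by positivity
  have e : 9 * ((N : ℝ) * (4 * (K' / √n))) = 36 * K' * (N * (1 / √n)) := by ring
  rw [e]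
  nlinarith [mul_nonneg hK'0 hp, mul_nonneg hQ.le hq]

end WorstMise

/-! ### The choice of the cut-off -/

lemma rpow_neg_half_eq {α : ℝ} (hα : 0 < α) {n : ℕ} :
    (n : ℝ) ^ (-(1 / 2) : ℝ) = ((n : ℝ) ^ (1 / (4 * α + 2))) ^ (-(2 * α + 1)) := by
  rw [← Real.rpow_mul (by positivity)]
  congr 1
  field_simp
  ring

/-- At x = n^{1/(4α+2)} the variance term and the bias term of the bound coincide. -/
lemma mul_rpow_neg_half_eq {α : ℝ} (hα : 0 < α) {n : ℕ} (hn : 0 < n) :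
    (n : ℝ) ^ (1 / (4 * α + 2)) * (n : ℝ) ^ (-(1 / 2) : ℝ) =
      ((n : ℝ) ^ (1 / (4 * α + 2))) ^ (-(2 * α)) := by
  have hx : 0 < (n : ℝ) ^ (1 / (4 * α + 2)) := Real.rpow_pos_of_pos (by exact_mod_cast hn) _
  rw [rpow_neg_half_eq hα]
  nth_rw 1 [← Real.rpow_one ((n : ℝ) ^ (1 / (4 * α + 2)))]
  rw [← Real.rpow_add hx]
  ring_nf

/-- Comparison with the cut-off ⌈x⌉, where x = n^{1/(4α+2)} ≥ 1 and thus ⌈x⌉ ≤ 2x, shows that the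
minimum is at most 3x^{-2α}. Each of the two terms then obeys this bound: the variance term limits N
from above and the bias term limits it from below. -/
lemma isTheta_of_isMinimizer {α : ℝ} (hα : 0 < α) {N : ℕ → ℕ}
    (hN : ∀ᶠ n in atTop, 1 ≤ N n ∧ ∀ M : ℕ, 1 ≤ M → riskBound α n (N n) ≤ riskBound α n M) :
    (fun n => (N n : ℝ)) =Θ[atTop] (fun n : ℕ => (n : ℝ) ^ (1 / (4 * α + 2))) := by
  have key : ∀ᶠ n : ℕ in atTop, (N n : ℝ) ≤ 3 * (n : ℝ) ^ (1 / (4 * α + 2)) ∧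
      (n : ℝ) ^ (1 / (4 * α + 2)) ≤ (3 : ℝ) ^ (1 / (2 * α)) * N n := by
    filter_upwards [hN, eventually_gt_atTop 0] with n ⟨h1, h2⟩ hn
    have hn1 : (1 : ℝ) ≤ n := by exact_mod_cast hn
    set x := (n : ℝ) ^ (1 / (4 * α + 2)) with hx
    have hx1 : 1 ≤ x := Real.one_le_rpow hn1 (by positivity)
    have hx0 : 0 < x := by positivity
    have hr0 : 0 < (n : ℝ) ^ (-(1 / 2) : ℝ) := by positivity
    have hxr : x * (n : ℝ) ^ (-(1 / 2) : ℝ) = x ^ (-(2 * α)) := mul_rpow_neg_half_eq hα hn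
    have hN0 : (0 : ℝ) < N n := by exact_mod_cast h1
    have hM1 : x ≤ ⌈x⌉₊ := Nat.le_ceil x
    have hM2 : (⌈x⌉₊ : ℝ) ≤ 2 * x := by linarith [Nat.ceil_lt_add_one hx0.le]
    have hM := h2 ⌈x⌉₊ (Nat.one_le_ceil_iff.2 hx0)
    have hle : riskBound α n (N n) ≤ 3 * x ^ (-(2 * α)) := by
      refine hM.trans ?_
      rw [riskBound]
      have e1 : (⌈x⌉₊ : ℝ) ^ (-(2 * α)) ≤ x ^ (-(2 * α)) :=
        Real.rpow_le_rpow_of_nonpos hx0 hM1 (by linarith)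
      nlinarith [mul_le_mul_of_nonneg_right hM2 hr0.le]
    rw [riskBound] at hle
    have p1 : 0 < (N n : ℝ) ^ (-(2 * α)) := by positivity
    have p2 : 0 < (N n : ℝ) * (n : ℝ) ^ (-(1 / 2) : ℝ) := by positivity
    constructor
    · refine le_of_mul_le_mul_right ?_ hr0
      rw [mul_assoc, hxr]
      linarith
    · have h3 : (N n : ℝ) ^ (-(2 * α)) ≤ 3 * x ^ (-(2 * α)) := by linarith
      rw [Real.rpow_neg hN0.le, Real.rpow_neg hx0.le, ← div_eq_mul_inv, inv_eq_one_div,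
        div_le_div_iff₀ (by positivity) (by positivity), one_mul] at h3
      have e3 : (3 : ℝ) = ((3 : ℝ) ^ (1 / (2 * α))) ^ (2 * α) := by
        rw [← Real.rpow_mul (by norm_num), one_div_mul_cancel (by positivity), Real.rpow_one]
      rw [e3, ← Real.mul_rpow (by positivity) hN0.le] at h3
      exact (Real.rpow_le_rpow_iff hx0.le (by positivity) (by positivity)).1 h3
  constructor
  · refine IsBigO.of_bound 3 (key.mono fun n hn => ?_)
    rw [Real.norm_of_nonneg (by positivity), Real.norm_of_nonneg (by positivity)]
    exact hn.1
  · refine IsBigO.of_bound ((3 : ℝ) ^ (1 / (2 * α))) (key.mono fun n hn => ?_)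
    rw [Real.norm_of_nonneg (by positivity), Real.norm_of_nonneg (by positivity)]
    exact hn.2

lemma eventually_pow_four_le {N : ℕ → ℕ}
    (hN : (fun n => (N n : ℝ)) =o[atTop] (fun n : ℕ => (n : ℝ) ^ (1 / 4 : ℝ))) :
    ∀ᶠ n : ℕ in atTop, (N n : ℝ) ^ 4 ≤ n := by
  filter_upwards [hN.bound one_pos] with n hn
  rw [one_mul, Real.norm_of_nonneg (by positivity), Real.norm_of_nonneg (by positivity)] at hn
  calc (N n : ℝ) ^ 4 ≤ ((n : ℝ) ^ (1 / 4 : ℝ)) ^ 4 := by gcongr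
    _ = (n : ℝ) := by
      rw [← Real.rpow_natCast, ← Real.rpow_mul (by positivity)]
      norm_num

lemma isLittleO_rpow_of_isTheta {α : ℝ} (hα : 1 / 2 < α) {N : ℕ → ℕ}
    (hN : (fun n => (N n : ℝ)) =Θ[atTop] (fun n : ℕ => (n : ℝ) ^ (1 / (4 * α + 2)))) :
    (fun n => (N n : ℝ)) =o[atTop] (fun n : ℕ => (n : ℝ) ^ (1 / 4 : ℝ)) := by
  refine hN.1.trans_isLittleO ?_
  have h : (1 / (4 * α + 2) : ℝ) < 1 / 4 := one_div_lt_one_div_of_lt (by norm_num) (by linarith)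
  have hr : (fun x : ℝ => x ^ (1 / (4 * α + 2))) =o[atTop] fun x => x ^ (1 / 4 : ℝ) := by
    refine (isLittleO_iff_tendsto' ?_).2 ?_
    · filter_upwards [eventually_gt_atTop 0] with x hx h0
      exact absurd h0 (Real.rpow_pos_of_pos hx _).ne'
    · refine (tendsto_rpow_neg_atTop (sub_pos.2 h)).congr' ?_
      filter_upwards [eventually_gt_atTop 0] with x hx
      rw [neg_sub, Real.rpow_sub hx]
  exact hr.comp_tendsto tendsto_natCast_atTop_atTop

lemma exists_riskBound_le_of_isTheta {α : ℝ} (hα : 0 < α) {N : ℕ → ℕ}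
    (hN : (fun n => (N n : ℝ)) =Θ[atTop] (fun n : ℕ => (n : ℝ) ^ (1 / (4 * α + 2)))) :
    ∃ C : ℝ, ∀ᶠ n : ℕ in atTop,
      1 ≤ N n ∧ riskBound α n (N n) ≤ C * (n : ℝ) ^ (-(α / (2 * α + 1))) := by
  obtain ⟨c, hc0, hc⟩ := hN.1.exists_pos
  obtain ⟨d, hd0, hd⟩ := hN.2.exists_pos
  refine ⟨d ^ (2 * α) + c, ?_⟩
  filter_upwards [hc.bound, hd.bound, eventually_gt_atTop 0] with n h1 h2 hn
  have hn0 : (0 : ℝ) < n := by exact_mod_cast hn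
  have hxa : (n : ℝ) ^ (-(α / (2 * α + 1))) = ((n : ℝ) ^ (1 / (4 * α + 2))) ^ (-(2 * α)) := by
    rw [← Real.rpow_mul hn0.le]
    congr 1
    field_simp
    ring
  have hxr := mul_rpow_neg_half_eq hα hn
  rw [hxa]
  set x := (n : ℝ) ^ (1 / (4 * α + 2)) with hx
  have hx0 : 0 < x := by positivity
  rw [Real.norm_of_nonneg (by positivity), Real.norm_of_nonneg (by positivity)] at h1 h2
  -- The lower half of the order relation already excludes N = 0, so N ≥ 1 eventually without
  -- further assumption.
  have hN0 : (0 : ℝ) < N n := by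
    by_contra h
    have : (N n : ℝ) = 0 := le_antisymm (not_lt.1 h) (by positivity)
    rw [this, mul_zero] at h2
    linarith
  refine ⟨by exact_mod_cast hN0, ?_⟩
  rw [riskBound, add_mul]
  refine add_le_add ?_ ?_
  · have h3 : x / d ≤ N n := (div_le_iff₀' hd0).2 h2
    refine (Real.rpow_le_rpow_of_nonpos (by positivity) h3 (by linarith)).trans_eq ?_
    rw [Real.div_rpow hx0.le hd0.le, Real.rpow_neg hd0.le, div_inv_eq_mul, mul_comm]
  · rw [← hxr, ← mul_assoc]
    gcongr

theorem theorem2 {Ω : Type*} [MeasurableSpace Ω] (μ : Measure Ω) [IsProbabilityMeasure μ]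
    (W : ℝ≥0 → Ω → ℝ) (hW : IsBrownianReal W μ)
    (ε : ℕ → ℕ → Ω → ℝ) (hε : IsMicroNoise μ W ε)
    (m : VolModel) (α β Q Q' σmin σmax τmin τmax : ℝ)
    (hQ : 0 < Q) (hQ' : 0 < Q')
    (hσmin : 0 < σmin) (hσ : σmin < σmax) (hτmin : 0 < τmin) (hτ : τmin < τmax)
    (hβ : 5 / 4 < β)
    (hα : (m = VolModel.timeTransformed ∧ 3 / 4 < α) ∨
      (m = VolModel.spaceTransformed ∧ 3 / 2 < α)) :
    -- upper bound for every cut-off sequence `N = o(n^{1/4})`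
    (∀ N : ℕ → ℕ, (∀ᶠ n in atTop, 1 ≤ N n) →
      (fun n => (N n : ℝ)) =o[atTop] (fun n : ℕ => (n : ℝ) ^ (1 / 4 : ℝ)) →
      ∃ C : ℝ, ∀ᶠ n : ℕ in atTop,
        worstMise m μ W ε α Q σmin σmax β Q' τmin τmax n (N n)
          ≤ ENNReal.ofReal (C * riskBound α n (N n))) ∧
    -- minimizers of the bound are of exact order `n^{1/(4α+2)}`
    (∀ N : ℕ → ℕ,
      (∀ᶠ n in atTop, 1 ≤ N n ∧ ∀ M : ℕ, 1 ≤ M → riskBound α n (N n) ≤ riskBound α n M) →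
      (fun n => (N n : ℝ)) =Θ[atTop] (fun n : ℕ => (n : ℝ) ^ (1 / (4 * α + 2)))) ∧
    -- rate for every cut-off sequence of that order
    (∀ N : ℕ → ℕ,
      (fun n => (N n : ℝ)) =Θ[atTop] (fun n : ℕ => (n : ℝ) ^ (1 / (4 * α + 2))) →
      ∃ C : ℝ, ∀ᶠ n : ℕ in atTop,
        worstMise m μ W ε α Q σmin σmax β Q' τmin τmax n (N n)
          ≤ ENNReal.ofReal (C * (n : ℝ) ^ (-(α / (2 * α + 1))))) := by
  have hα' : 1 / 2 < α := by rcases hα with ⟨-, h⟩ | ⟨-, h⟩ <;> linarith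
  have hαm : m = VolModel.spaceTransformed → 3 / 2 < α := by
    rintro rfl
    rcases hα with ⟨h, -⟩ | ⟨-, h⟩
    · cases h
    · exact h
  obtain ⟨C, hC, hev⟩ := exists_worstMise_le μ hW.toIsPreBrownianReal hε m (β := β) (Q' := Q')
    hQ hσmin hσ hτmin hτ hα' hαm
  refine ⟨fun N hN hNo => ⟨C, ?_⟩, fun N hN => isTheta_of_isMinimizer (by linarith) hN,
    fun N hN => ?_⟩
  · filter_upwards [hev, hN, eventually_pow_four_le hNo] with n h1 h2 h3
    exact h1 _ h2 h3
  · obtain ⟨D, hD⟩ := exists_riskBound_le_of_isTheta (by linarith) hN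
    refine ⟨C * D, ?_⟩
    filter_upwards [hev, hD, eventually_pow_four_le (isLittleO_rpow_of_isTheta hα' hN)]
      with n h1 h2 h3
    refine (h1 _ h2.1 h3).trans (ENNReal.ofReal_le_ofReal ?_)
    rw [mul_assoc]
    exact mul_le_mul_of_nonneg_left h2.2 hC
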